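/- Let $\Sigma$ be a connected smooth two-dimensional manifold (Hausdorff, second countable, without boundary, not necessarily compact), and let $\mathcal P$ be a smooth Poisson bivector on $\mathbb R^n$ with components $\mathcal P^{ij}$. The fields of the Poisson sigma model are a smooth map $X=(X^i)\colon\Sigma\to\mathbb R^n$ and smooth one-forms $A_1,\dots,A_n$ on $\Sigma$. The field equations are $$dX^i+\mathcal P^{ij}(X)A_j=0,\qquad dA_i+\tfrac12\,(\partial_i\mathcal P^{kl})(X)\,A_k\wedge A_l=0 .$$ Gauge equivalence of solutions is the equivalence relation generated by integrating the infinitesimal symmetries $$\delta X^i=\epsilon_j\mathcal P^{ji}(X),\qquad \delta A_i=d\epsilon_i+(\partial_i\mathcal P^{kl})(X)A_k\epsilon_l$$ along smooth paths of fields, with arbitrary smooth (path-parameter dependent) functions $\epsilon_i$ on $\Sigma$; the classical moduli space $\mathcal M_{\rm cl}(\Sigma)$ is the set of solutions modulo gauge equivalence. Suppose that $\dim\ker\mathcal P=k$ everywhere and that the symplectic foliation of $(\mathbb R^n,\mathcal P)$ is trivial with leaves $\mathbb R^{n-k}$: there are global coordinates $(X^I,X^\alpha)\colon\mathbb R^n\to\mathbb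 R^k\times\mathbb R^{n-k}$ (a diffeomorphism) such that the symplectic leaves are the fibres $X^I=\mathrm{const}$. Write $A_I,A_\alpha$ for the components of $A$ in these coordinates. Then: 1. For all constants $C=(C^I)\in\mathbb R^k$ and closed one-forms $\alpha_1,\dots,\alpha_k$ on $\Sigma$ there is exactly one field configuration with $$X^I=C^I,\qquad X^\alpha=0=A_\alpha,\qquad A_I=\alpha_I,$$ and it solves the field equations. Every solution is gauge equivalent to one of this form. Two of these, with data $(C,\alpha)$ and $(C',\alpha')$, are gauge equivalent if and only if $C=C'$ and $[\alpha_I]=[\alpha'_I]$ in the de Rham cohomology $H^1(\Sigma)=H^1(\Sigma;\mathbb R)$ for all $I$. 2. If $r=\operatorname{rank}H^1(\Sigma)$ is finite, then $\mathcal M_{\rm cl}(\Sigma)\cong\mathbb R^{k(r+1)}$, by a bijection that maps the class of the solution with data $(C,\alpha)$ to the image of $(C,([\alpha_I])_I)$ under a linear isomorphism $\mathbb R^k\times H^1(\Sigma)^k\cong\mathbb R^{k(r+1)}$. Moreover $r$ is the rank of $\pi_1(\Sigma)$, meaning the maximal number of linearly independent elements of its abelianization. -/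

import Mathlib

open scoped Manifold ContDiff

noncomputable section

namespace PSM

/-- The model plane of a surface. -/
abbrev Plane : Type := EuclideanSpace ℝ (Fin 2)

section Forms

/-! Differential forms of degree one on a surface `S`, with values in a normed space `F`. -/

/-- An (a priori not smooth) `F`-valued one-form on `S`: a linear map on every tangent space. -/
abbrev RawForm (S : Type*) [TopologicalSpace S] [ChartedSpace Plane S]
    (F : Type*) [NormedAddCommGroup F] [NormedSpace ℝ F] : Type _ :=
  ∀ x : S, TangentSpace (𝓡 2) x →L[ℝ] F

/-- The one-form `η` in the local coordinates around `x₀`: its pull-back to the plane under the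
inverse of the chart. -/
def formInChart {S : Type*} [TopologicalSpace S] [ChartedSpace Plane S]
    {F : Type*} [NormedAddCommGroup F] [NormedSpace ℝ F]
    (η : RawForm S F) (x₀ : S) (y : Plane) : Plane →L[ℝ] F :=
  (η ((extChartAt (𝓡 2) x₀).symm y)).comp
    (mfderiv 𝓘(ℝ, Plane) (𝓡 2) (extChartAt (𝓡 2) x₀).symm y)

/-- A one-form is smooth if its coefficients in local coordinates are. -/
def IsSmoothForm {S : Type*} [TopologicalSpace S] [ChartedSpace Plane S]
    {F : Type*} [NormedAddCommGroup F] [NormedSpace ℝ F] (η : RawForm S F) : Prop :=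
  ∀ x₀ : S, ContDiffOn ℝ ∞ (formInChart η x₀) (extChartAt (𝓡 2) x₀).target

/-- The exterior derivative `∂_u g(v) - ∂_v g(u)` of a one-form `g` on the plane. -/
def planeExtD {F : Type*} [NormedAddCommGroup F] [NormedSpace ℝ F]
    (g : Plane → Plane →L[ℝ] F) (y u v : Plane) : F :=
  fderiv ℝ g y u v - fderiv ℝ g y v u

/-- The exterior derivative `dη` of a one-form on `S`, computed at `x` in the coordinates around
`x`. (Tangent vectors at `x` are identified with vectors of the plane by this same chart.) -/
def extD {S : Type*} [TopologicalSpace S] [ChartedSpace Plane S]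
    {F : Type*} [NormedAddCommGroup F] [NormedSpace ℝ F]
    (η : RawForm S F) (x : S) (u v : TangentSpace (𝓡 2) x) : F :=
  planeExtD (formInChart η x) (extChartAt (𝓡 2) x x) u v

/-- The differential `df` of a function. -/
def dFun {S : Type*} [TopologicalSpace S] [ChartedSpace Plane S]
    {F : Type*} [NormedAddCommGroup F] [NormedSpace ℝ F] (f : S → F) : RawForm S F :=
  fun x => mfderiv (𝓡 2) 𝓘(ℝ, F) f x

theorem formInChart_add {S : Type*} [TopologicalSpace S] [ChartedSpace Plane S]
    {F : Type*} [NormedAddCommGroup F] [NormedSpace ℝ F] (η ζ : RawForm S F) (x₀ : S) :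
    formInChart (η + ζ) x₀ = formInChart η x₀ + formInChart ζ x₀ := by
  funext y; ext v; rfl

theorem formInChart_smul {S : Type*} [TopologicalSpace S] [ChartedSpace Plane S]
    {F : Type*} [NormedAddCommGroup F] [NormedSpace ℝ F] (c : ℝ) (η : RawForm S F) (x₀ : S) :
    formInChart (c • η) x₀ = c • formInChart η x₀ := by
  funext y; ext v; rfl

theorem formInChart_zero {S : Type*} [TopologicalSpace S] [ChartedSpace Plane S]
    {F : Type*} [NormedAddCommGroup F] [NormedSpace ℝ F] (x₀ : S) :
    formInChart (0 : RawForm S F) x₀ = 0 := by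
  funext y; ext v; rfl

theorem IsSmoothForm.differentiableAt {S : Type*} [TopologicalSpace S] [ChartedSpace Plane S]
    {F : Type*} [NormedAddCommGroup F] [NormedSpace ℝ F] {η : RawForm S F}
    (h : IsSmoothForm η) (x : S) :
    DifferentiableAt ℝ (formInChart η x) (extChartAt (𝓡 2) x x) :=
  ((h x).contDiffAt ((isOpen_extChartAt_target x).mem_nhds
    (mem_extChartAt_target x))).differentiableAt (by simp)

theorem planeExtD_zero {F : Type*} [NormedAddCommGroup F] [NormedSpace ℝ F] (y u v : Plane) :
    planeExtD (0 : Plane → Plane →L[ℝ] F) y u v = 0 := by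
  simp [planeExtD]

theorem planeExtD_add {F : Type*} [NormedAddCommGroup F] [NormedSpace ℝ F]
    {g h : Plane → Plane →L[ℝ] F} {y : Plane} (hg : DifferentiableAt ℝ g y)
    (hh : DifferentiableAt ℝ h y) (u v : Plane) :
    planeExtD (g + h) y u v = planeExtD g y u v + planeExtD h y u v := by
  simp only [planeExtD, fderiv_add hg hh, add_apply]
  abel

theorem planeExtD_smul {F : Type*} [NormedAddCommGroup F] [NormedSpace ℝ F]
    {g : Plane → Plane →L[ℝ] F} {y : Plane} (hg : DifferentiableAt ℝ g y) (c : ℝ) (u v : Plane) :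
    planeExtD (c • g) y u v = c • planeExtD g y u v := by
  simp only [planeExtD, fderiv_const_smul hg, smul_apply, smul_sub]

/-- The real vector space of closed smooth real-valued one-forms on `S`. -/
def closedForms (S : Type*) [TopologicalSpace S] [ChartedSpace Plane S] :
    Submodule ℝ (RawForm S ℝ) where
  carrier := {α | IsSmoothForm α ∧ ∀ x u v, extD α x u v = 0}
  zero_mem' := by
    refine ⟨fun x₀ => ?_, fun x u v => ?_⟩
    · rw [formInChart_zero]; exact contDiffOn_const
    · rw [extD, formInChart_zero]; exact planeExtD_zero _ _ _
  add_mem' := by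
    rintro α β ⟨hα, dα⟩ ⟨hβ, dβ⟩
    refine ⟨fun x₀ => ?_, fun x u v => ?_⟩
    · rw [formInChart_add]; exact (hα x₀).add (hβ x₀)
    · have h1 := dα x u v
      have h2 := dβ x u v
      rw [extD] at h1 h2 ⊢
      rw [formInChart_add]
      refine (planeExtD_add (hα.differentiableAt x) (hβ.differentiableAt x) _ _).trans ?_
      rw [h1, h2, add_zero]
  smul_mem' := by
    rintro c α ⟨hα, dα⟩
    refine ⟨fun x₀ => ?_, fun x u v => ?_⟩
    · rw [formInChart_smul]; exact (hα x₀).const_smul c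
    · have h1 := dα x u v
      rw [extD] at h1 ⊢
      rw [formInChart_smul]
      refine (planeExtD_smul (hα.differentiableAt x) c _ _).trans ?_
      rw [h1, smul_zero]

/-- The closed forms that are exact, `α = df` with `f` a smooth function on `S`. -/
def exactForms (S : Type*) [TopologicalSpace S] [ChartedSpace Plane S] :
    Submodule ℝ (closedForms S) where
  carrier := {α | ∃ f : S → ℝ, ContMDiff (𝓡 2) 𝓘(ℝ, ℝ) ∞ f ∧ (α : RawForm S ℝ) = dFun f}
  zero_mem' := by
    refine ⟨fun _ => 0, contMDiff_const, ?_⟩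
    funext x
    exact (mfderiv_const (I := 𝓡 2) (I' := 𝓘(ℝ, ℝ))).symm
  add_mem' := by
    rintro α β ⟨f, hf, ef⟩ ⟨g, hg, eg⟩
    refine ⟨f + g, hf.add hg, ?_⟩
    funext x
    have hf' : MDifferentiableAt (𝓡 2) 𝓘(ℝ, ℝ) f x := hf.mdifferentiableAt (by simp)
    have hg' : MDifferentiableAt (𝓡 2) 𝓘(ℝ, ℝ) g x := hg.mdifferentiableAt (by simp)
    have := mfderiv_add hf' hg'
    simp only [Submodule.coe_add, ef, eg]
    exact this.symm
  smul_mem' := by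
    rintro c α ⟨f, hf, ef⟩
    refine ⟨c • f, ((contMDiff_const (c := c)).mul hf : ContMDiff (𝓡 2) 𝓘(ℝ, ℝ) ∞ fun x => c * f x), ?_⟩
    funext x
    have hf' : MDifferentiableAt (𝓡 2) 𝓘(ℝ, ℝ) f x := hf.mdifferentiableAt (by simp)
    have := const_smul_mfderiv hf' c
    simp only [Submodule.coe_smul, ef]
    exact this.symm

/-- The first de Rham cohomology `H¹(S)` over the real numbers: closed modulo exact one-forms. -/
abbrev H1 (S : Type*) [TopologicalSpace S] [ChartedSpace Plane S] : Type _ :=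
  closedForms S ⧸ exactForms S

/-- The class `[α] ∈ H¹(S)` of a closed one-form. -/
def cohomologyClass {S : Type*} [TopologicalSpace S] [ChartedSpace Plane S]
    (α : closedForms S) : H1 S :=
  Submodule.Quotient.mk α

end Forms

section Target

/-! Poisson structures on `ℝⁿ`. -/

/-- The partial derivative `∂f/∂xⁱ`. -/
def pd {n : ℕ} (i : Fin n) (f : (Fin n → ℝ) → ℝ) (x : Fin n → ℝ) : ℝ :=
  fderiv ℝ f x (Pi.single i 1)

/-- `P` is (the matrix of components `P^{ij}` of) a smooth Poisson bivector on `ℝⁿ`. -/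
structure IsPoisson {n : ℕ} (P : (Fin n → ℝ) → Matrix (Fin n) (Fin n) ℝ) : Prop where
  smooth : ∀ i j, ContDiff ℝ ∞ (fun x => P x i j)
  antisymm : ∀ x i j, P x i j = - P x j i
  jacobi : ∀ x i j k,
    ∑ l, (P x i l * pd l (fun y => P y j k) x + P x j l * pd l (fun y => P y k i) x
      + P x k l * pd l (fun y => P y i j) x) = 0

/-- Global coordinates `(X^I, X^α)`, `X^I ∈ ℝᵏ`, `X^α ∈ ℝⁿ⁻ᵏ`, exhibiting the symplectic foliation
of `(ℝⁿ, P)` as trivial: a diffeomorphism `ℝⁿ ≅ ℝᵏ × ℝⁿ⁻ᵏ` for which the leaves are the fibres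
`X^I = const`. Here `k` is the dimension of `ker P`. The leaves of `P` are the (maximal) connected
integral manifolds of the distribution spanned by the Hamiltonian vector fields, that is, of the
range of `P`; so that the (connected) fibres are the leaves means that their tangent spaces, the
common kernels of the differentials `dX^I`, form this distribution. -/
structure TrivialFoliation {n : ℕ} (P : (Fin n → ℝ) → Matrix (Fin n) (Fin n) ℝ) (k : ℕ) where
  coord : (Fin n → ℝ) ≃ (Fin k → ℝ) × (Fin (n - k) → ℝ)
  smooth : ContDiff ℝ ∞ coord
  smooth_symm : ContDiff ℝ ∞ coord.symm
  dim_ker : ∀ x, Module.finrank ℝ (LinearMap.ker (P x).mulVecLin) = k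
  leaves : ∀ x, LinearMap.range (P x).mulVecLin
    = LinearMap.ker (fderiv ℝ (fun y => (coord y).1) x : (Fin n → ℝ) →ₗ[ℝ] (Fin k → ℝ))

end Target

section Model

/-! The Poisson sigma model with worldsheet `S` and target `(ℝⁿ, P)`. -/

/-- Smooth fields: a map `X : S → ℝⁿ` and one-forms `A₁, …, Aₙ` on `S`, here collected in one
`ℝⁿ`-valued form. -/
@[ext]
structure Config (S : Type*) [TopologicalSpace S] [ChartedSpace Plane S] (n : ℕ) where
  X : S → Fin n → ℝ
  A : RawForm S (Fin n → ℝ)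
  smooth_X : ContMDiff (𝓡 2) 𝓘(ℝ, Fin n → ℝ) ∞ X
  smooth_A : IsSmoothForm A

/-- The field equations `dXⁱ + P^{ij}(X) A_j = 0` and
`dA_i + ½ (∂_i P^{kl})(X) A_k ∧ A_l = 0`. -/
structure IsSolution {S : Type*} [TopologicalSpace S] [ChartedSpace Plane S] {n : ℕ}
    (P : (Fin n → ℝ) → Matrix (Fin n) (Fin n) ℝ) (φ : Config S n) : Prop where
  eq_X : ∀ (x : S) (v : TangentSpace (𝓡 2) x) (i : Fin n),
    dFun φ.X x v i + ∑ j, P (φ.X x) i j * φ.A x v j = 0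
  eq_A : ∀ (x : S) (u v : TangentSpace (𝓡 2) x) (i : Fin n),
    extD φ.A x u v i + (1 / 2) * ∑ k, ∑ l, pd i (fun y => P y k l) (φ.X x)
      * (φ.A x u k * φ.A x v l - φ.A x v k * φ.A x u l) = 0

/-- The space of solutions of the field equations. -/
def Solution (S : Type*) [TopologicalSpace S] [ChartedSpace Plane S] {n : ℕ}
    (P : (Fin n → ℝ) → Matrix (Fin n) (Fin n) ℝ) : Type _ :=
  {φ : Config S n // IsSolution P φ}

/-- A smooth path of fields that integrates the infinitesimal symmetries
`δXⁱ = ε_j P^{ji}(X)`, `δA_i = dε_i + (∂_i P^{kl})(X) A_k ε_l`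
with smooth, arbitrarily time dependent parameters `ε`. -/
structure IsGaugePath {S : Type*} [TopologicalSpace S] [ChartedSpace Plane S] {n : ℕ}
    (P : (Fin n → ℝ) → Matrix (Fin n) (Fin n) ℝ)
    (φ : ℝ → Config S n) (ε : ℝ → S → Fin n → ℝ) : Prop where
  smooth_X : ContMDiff (𝓘(ℝ, ℝ).prod (𝓡 2)) 𝓘(ℝ, Fin n → ℝ) ∞
    (fun p : ℝ × S => (φ p.1).X p.2)
  smooth_A : ∀ x₀ : S, ContDiffOn ℝ ∞
    (fun p : ℝ × Plane => formInChart (φ p.1).A x₀ p.2)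
    (Set.univ ×ˢ (extChartAt (𝓡 2) x₀).target)
  smooth_ε : ContMDiff (𝓘(ℝ, ℝ).prod (𝓡 2)) 𝓘(ℝ, Fin n → ℝ) ∞
    (fun p : ℝ × S => ε p.1 p.2)
  deriv_X : ∀ (t : ℝ) (x : S) (i : Fin n),
    HasDerivAt (fun s => (φ s).X x i) (∑ j, ε t x j * P ((φ t).X x) j i) t
  deriv_A : ∀ (t : ℝ) (x : S) (v : TangentSpace (𝓡 2) x) (i : Fin n),
    HasDerivAt (fun s => (φ s).A x v i)
      (dFun (ε t) x v i
        + ∑ k, ∑ l, pd i (fun y => P y k l) ((φ t).X x) * (φ t).A x v k * ε t x l) t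

/-- Two fields are related if a path integrating the symmetries leads from one to the other. -/
def GaugeStep {S : Type*} [TopologicalSpace S] [ChartedSpace Plane S] {n : ℕ}
    (P : (Fin n → ℝ) → Matrix (Fin n) (Fin n) ℝ) (φ ψ : Config S n) : Prop :=
  ∃ (Φ : ℝ → Config S n) (ε : ℝ → S → Fin n → ℝ), IsGaugePath P Φ ε ∧ Φ 0 = φ ∧ Φ 1 = ψ

/-- Gauge equivalence of solutions: the equivalence relation generated by the symmetries. -/
def gaugeSetoid (S : Type*) [TopologicalSpace S] [ChartedSpace Plane S] {n : ℕ}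
    (P : (Fin n → ℝ) → Matrix (Fin n) (Fin n) ℝ) : Setoid (Solution S P) :=
  (Relation.EqvGen.setoid (GaugeStep (S := S) P)).comap Subtype.val

/-- Gauge equivalence of two solutions. -/
def GaugeEquiv {S : Type*} [TopologicalSpace S] [ChartedSpace Plane S] {n : ℕ}
    {P : (Fin n → ℝ) → Matrix (Fin n) (Fin n) ℝ} (φ ψ : Solution S P) : Prop :=
  gaugeSetoid S P φ ψ

/-- The classical moduli space: solutions modulo gauge equivalence. -/
def ModuliSpace (S : Type*) [TopologicalSpace S] [ChartedSpace Plane S] {n : ℕ}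
    (P : (Fin n → ℝ) → Matrix (Fin n) (Fin n) ℝ) : Type _ :=
  Quotient (gaugeSetoid S P)

/-- The point of the moduli space represented by a solution. -/
def gaugeClass {S : Type*} [TopologicalSpace S] [ChartedSpace Plane S] {n : ℕ}
    {P : (Fin n → ℝ) → Matrix (Fin n) (Fin n) ℝ} (φ : Solution S P) : ModuliSpace S P :=
  Quotient.mk (gaugeSetoid S P) φ

/-- The component along `w` of the form `A = A_i dXⁱ` in the coordinates `T.coord`: if `w` is the
basis vector of the coordinate `X^a`, this is `A_a = A_i ∂Xⁱ/∂X^a`. -/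
def adaptedComponent {S : Type*} [TopologicalSpace S] [ChartedSpace Plane S] {n k : ℕ}
    {P : (Fin n → ℝ) → Matrix (Fin n) (Fin n) ℝ} (T : TrivialFoliation P k) (φ : Config S n)
    (w : (Fin k → ℝ) × (Fin (n - k) → ℝ)) (x : S) (v : TangentSpace (𝓡 2) x) : ℝ :=
  ∑ i, φ.A x v i * fderiv ℝ T.coord.symm (T.coord (φ.X x)) w i

/-- In the coordinates `(X^I, X^α)` the fields are `X^I = C^I` constant, `X^α = 0 = A_α` and
`A_I = α_I` with given closed one-forms `α_I`. -/
structure IsRepresentative {S : Type*} [TopologicalSpace S] [ChartedSpace Plane S] {n k : ℕ}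
    {P : (Fin n → ℝ) → Matrix (Fin n) (Fin n) ℝ} (T : TrivialFoliation P k)
    (C : Fin k → ℝ) (α : Fin k → closedForms S) (φ : Config S n) : Prop where
  casimir_X : ∀ x, (T.coord (φ.X x)).1 = C
  leaf_X : ∀ x, (T.coord (φ.X x)).2 = 0
  leaf_A : ∀ (a : Fin (n - k)) (x : S) (v : TangentSpace (𝓡 2) x),
    adaptedComponent T φ (0, Pi.single a 1) x v = 0
  casimir_A : ∀ (I : Fin k) (x : S) (v : TangentSpace (𝓡 2) x),
    adaptedComponent T φ (Pi.single I 1, 0) x v = (α I : RawForm S ℝ) x v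

end Model

end PSM

end

/-!
The proof rests on a change of variables that linearizes the model. In the adapted coordinates
`(X^I, X^α)` the leaves carry symplectic forms `ω_I`, the inverses of the restricted Poisson tensor;
the Jacobi identity says that they are closed (`FoliatedPoisson.leafForm_closed`), so they have a
primitive `θ` that depends smoothly on the leaf (`FoliatedPoisson.potential`). The Lie derivative of
the Poisson tensor along a transverse field `∂_I` is then, up to sign, the leafwise differential of
`∂_I θ` (`FoliatedPoisson.lie_casDir`). Consequently the one-forms `B_I = A_I - X^*(∂_I θ)` (called
`charge` below) are closed on solutions (`charge_mem_closedForms`) and change by exact forms under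
gauge transformations (`IsFlow.exists_hasMFDerivAt`). A gauge transformation also preserves the
first field equation, whose defect `dX + P A` obeys a homogeneous linear differential equation
(`IsFlow.defect_eq_zero`), and the Casimir functions `X^I`. So the constants `C^I` and the classes
`[B_I]` are invariants of gauge equivalence, and on the standard solutions they are `C^I` and
`[α_I]`.

Conversely, the contraction `(X^I, X^α) ↦ (X^I, (1 - t) X^α)` of the leaves lifts to a gauge flow
(`isFlow_contract`): the parameters `ε_α` and the forms `A_α` are dictated by the symplectic forms,
and `ε_I`, `A_I` by the conservation of `B_I`. That this path obeys the equation of motion of `A` need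
not be computed. The defect `r` of that equation is a covector, and the general variation formulas
for `dX + P A` and `B_I` give `P r = 0` and `r(∂_I) = 0`, hence `r = 0`. The flow ends in a standard
solution. Two of these with the same constants and classes are joined by the straight segment
(`isFlow_exact`).

The classification makes the moduli space `ℝᵏ × H¹(S)ᵏ`. The rank of the fundamental group is
compared with `H¹` through the periods of closed forms along loops. A form whose periods vanish is
exact, and every additive function on loops is the period of a closed form: a partition of unity
glues its local branches to a multivalued smooth function with the given increments, whose
differential is single valued (`period_surjective`). Hence `H¹(S)` is the dual of the abelianized
fundamental group (`deRhamEquiv`).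

Covectors on the target are treated as continuous linear forms, so that the field equations and the
symmetries can be written without indices; `dualForm` translates. Tangent vectors of the worldsheet
are mostly taken as vectors of the plane, which they are by definition.
-/

noncomputable section

namespace PSM

/-! ### Additive functions on homotopy classes of paths -/

/-- A real-valued function on homotopy classes of paths that turns concatenation into addition:
a homomorphism from the fundamental groupoid to `ℝ`. -/
structure PathHom (X : Type*) [TopologicalSpace X] where
  val : ∀ {x y : X}, Path.Homotopic.Quotient x y → ℝ
  val_trans : ∀ {x y z : X} (p : Path.Homotopic.Quotient x y) (q : Path.Homotopic.Quotient y z),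
    val (p.trans q) = val p + val q

namespace PathHom

variable {X : Type*} [TopologicalSpace X]

theorem val_refl (H : PathHom X) (x : X) : H.val (Path.Homotopic.Quotient.refl x) = 0 := by
  have h := H.val_trans (Path.Homotopic.Quotient.refl x) (Path.Homotopic.Quotient.refl x)
  have h2 : (Path.Homotopic.Quotient.refl x).trans (Path.Homotopic.Quotient.refl x)
      = Path.Homotopic.Quotient.refl x := by
    rw [← Path.Homotopic.Quotient.mk_refl, ← Path.Homotopic.Quotient.mk_trans]
    simp
  rw [h2] at h
  linarith

theorem val_cast (H : PathHom X) {x y x' y' : X} (p : Path.Homotopic.Quotient x y) (hx : x' = x)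
    (hy : y' = y) : H.val (p.cast hx hy) = H.val p := by
  subst hx hy
  rw [Path.Homotopic.Quotient.cast_rfl_rfl]

/-- The fundamental groupoid is generated by short paths: homomorphisms that agree on all paths
inside members of a cover are equal. -/
theorem val_eq_of_short {H J : PathHom X} {U : X → Set X} (hU : ∀ p, U p ∈ nhds p)
    (h : ∀ p x y (γ : Path x y), Set.range γ ⊆ U p →
      H.val (Path.Homotopic.Quotient.mk γ) = J.val (Path.Homotopic.Quotient.mk γ))
    {x y : X} (q : Path.Homotopic.Quotient x y) : H.val q = J.val q := by
  obtain ⟨γ, rfl⟩ := Path.Homotopic.Quotient.mk_surjective q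
  set g : unitInterval → ℝ := fun t =>
    H.val (Path.Homotopic.Quotient.mk (γ.subpath 0 t))
      - J.val (Path.Homotopic.Quotient.mk (γ.subpath 0 t)) with hg
  have hloc : IsLocallyConstant g := by
    refine (IsLocallyConstant.iff_eventually_eq g).2 fun t => ?_
    obtain ⟨δ, hδ, hδU⟩ := Metric.mem_nhds_iff.1
      (γ.continuous.continuousAt.preimage_mem_nhds (hU (γ t)))
    filter_upwards [Metric.ball_mem_nhds t hδ] with s hs
    have hr : Set.range (γ.subpath t s) ⊆ U (γ t) := by
      rw [Path.range_subpath]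
      rintro _ ⟨r, hr, rfl⟩
      refine hδU (Metric.mem_ball'.2 (lt_of_le_of_lt ?_ (Metric.mem_ball'.1 hs)))
      have hr' : (r : ℝ) ∈ Set.uIcc (t : ℝ) s := by
        rcases Set.mem_uIcc.1 hr with h | h
        · exact Set.mem_uIcc.2 (Or.inl h)
        · exact Set.mem_uIcc.2 (Or.inr h)
      exact Real.dist_left_le_of_mem_uIcc hr'
    have e : Path.Homotopic.Quotient.mk (γ.subpath 0 s)
        = (Path.Homotopic.Quotient.mk (γ.subpath 0 t)).trans
          (Path.Homotopic.Quotient.mk (γ.subpath t s)) := by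
      rw [← Path.Homotopic.Quotient.mk_trans, Path.Homotopic.Quotient.eq]
      exact ⟨(Path.Homotopy.subpathTransSubpath γ 0 t s).symm⟩
    simp only [hg]
    rw [e, H.val_trans, J.val_trans, h _ _ _ _ hr]
    ring
  have h1 : g 1 = g 0 := hloc.apply_eq_of_preconnectedSpace 1 0
  have h0 : g 0 = 0 := by
    simp only [hg, Path.subpath_self, Path.Homotopic.Quotient.mk_refl, val_refl, sub_self]
  rw [h0] at h1
  simp only [hg, Path.subpath_zero_one, Path.Homotopic.Quotient.mk_cast, val_cast] at h1
  linarith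

end PathHom

/-- The real numbers with the discrete topology, the fibre of the covering space formed by the
branches of a multivalued function. -/
def DiscreteReal : Type := ℝ

/-- The underlying real number. -/
def DiscreteReal.toReal (v : DiscreteReal) : ℝ := v

/-- A real number as a point of the discrete copy of `ℝ`. -/
def DiscreteReal.ofReal (v : ℝ) : DiscreteReal := v

instance : TopologicalSpace DiscreteReal := ⊥

instance : DiscreteTopology DiscreteReal := ⟨rfl⟩

section Branches

variable {X : Type*} [TopologicalSpace X] {U : X → Set X} {f : X → X → ℝ}

/-- Functions `f p` on the members `U p` of an open cover whose differences are locally constant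
on the overlaps. They are the local branches of a multivalued function on `X`. -/
structure IsBranchSystem (U : X → Set X) (f : X → X → ℝ) : Prop where
  isOpen : ∀ p, IsOpen (U p)
  mem : ∀ p, p ∈ U p
  eventually_sub_eq : ∀ p q, ∀ x ∈ U p ∩ U q, ∀ᶠ y in nhds x, f p y - f q y = f p x - f q x

/-- The covering space whose points over `x` are the values at `x` of the branches of the
multivalued function: in the trivialization over `U p`, the coordinate of a value `v` at `x` is
`v - f p x`. -/
def IsBranchSystem.core (h : IsBranchSystem U f) : FiberBundleCore X X DiscreteReal where
  baseSet := U
  isOpen_baseSet := h.isOpen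
  indexAt := id
  mem_baseSet_at := h.mem
  coordChange i j x v := .ofReal (v.toReal + (f i x - f j x))
  coordChange_self i x _ v := by
    change (v.toReal + (f i x - f i x) : ℝ) = v.toReal
    ring
  continuousOn_coordChange i j := by
    rintro ⟨x, v⟩ ⟨hx, -⟩
    refine ContinuousAt.continuousWithinAt ?_
    refine (continuousAt_const (y := DiscreteReal.ofReal (v.toReal + (f i x - f j x)))).congr ?_
    have h1 : ∀ᶠ w in nhds v, w = v := by simp [nhds_discrete]
    have h2 := (h.eventually_sub_eq i j x hx).prod_nhds h1
    filter_upwards [h2] with z hz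
    rw [hz.2, hz.1]
  coordChange_comp i j k x _ v := by
    change v.toReal + (f i x - f j x) + (f j x - f k x) = v.toReal + (f i x - f k x)
    ring

/-- The value of the branch that a point of the covering space stands for. -/
def IsBranchSystem.eval (h : IsBranchSystem U f) (e : h.core.TotalSpace) : ℝ :=
  DiscreteReal.toReal e.2 + f e.1 e.1

theorem IsBranchSystem.isCoveringMap (h : IsBranchSystem U f) : IsCoveringMap h.core.proj :=
  FiberBundle.isCoveringMap (F := DiscreteReal) (E := h.core.Fiber)

/-- Along a path in the covering space the evaluation differs from any branch by a locally
constant function. -/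
theorem IsBranchSystem.eventually_eval_sub (h : IsBranchSystem U f) (p : X)
    (e : h.core.TotalSpace) (he : e.1 ∈ U p) :
    ∀ᶠ e' in nhds e, h.eval e' - f p e'.1 = h.eval e - f p e.1 := by
  have hsrc : e ∈ (h.core.localTriv p).source := (h.core.mem_localTriv_source p e).2 he
  have hval : ∀ e' : h.core.TotalSpace,
      (h.core.localTriv p e').2 = .ofReal (h.eval e' - f p e'.1) := by
    intro e'
    rw [h.core.localTriv_apply]
    change DiscreteReal.toReal e'.2 + (f e'.1 e'.1 - f p e'.1)
      = DiscreteReal.toReal e'.2 + f e'.1 e'.1 - f p e'.1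
    ring
  have hc : ContinuousAt (fun e' => (h.core.localTriv p e').2) e :=
    continuous_snd.continuousAt.comp
      ((h.core.localTriv p).continuousOn.continuousAt
        ((h.core.localTriv p).open_source.mem_nhds hsrc))
  have h2 : ∀ᶠ w in nhds (h.core.localTriv p e).2, w = (h.core.localTriv p e).2 := by
    simp [nhds_discrete]
  filter_upwards [hc.eventually h2] with e' he'
  rw [hval, hval] at he'
  exact he'

/-- The increment of a branch system along paths: continuing a branch along a path defines a
homomorphism of the fundamental groupoid, by the monodromy theorem. -/
theorem IsBranchSystem.exists_pathHom (h : IsBranchSystem U f) :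
    ∃ H : PathHom X, ∀ p x y (γ : Path x y), Set.range γ ⊆ U p →
      H.val (Path.Homotopic.Quotient.mk γ) = f p y - f p x := by
  set cov := h.isCoveringMap
  -- the increment of the evaluation along lifts of `γ` does not depend on the initial branch
  have key : ∀ {x y : X} (γ : Path x y) (Γ Γ' : C(unitInterval, h.core.TotalSpace)),
      h.core.proj ∘ Γ = γ → h.core.proj ∘ Γ' = γ →
      h.eval (Γ 1) - h.eval (Γ 0) = h.eval (Γ' 1) - h.eval (Γ' 0) := by
    intro x y γ Γ Γ' hΓ hΓ'
    have hloc : IsLocallyConstant (fun t => h.eval (Γ t) - h.eval (Γ' t)) := by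
      refine (IsLocallyConstant.iff_eventually_eq _).2 fun t => ?_
      have e1 : ∀ s, (Γ s).1 = γ s := fun s => congrFun hΓ s
      have e2 : ∀ s, (Γ' s).1 = γ s := fun s => congrFun hΓ' s
      have c1 := Γ.continuous.continuousAt.eventually
        (h.eventually_eval_sub (γ t) (Γ t) (by rw [e1]; exact h.mem _))
      have c2 := Γ'.continuous.continuousAt.eventually
        (h.eventually_eval_sub (γ t) (Γ' t) (by rw [e2]; exact h.mem _))
      filter_upwards [c1, c2] with s h1 h2
      rw [e1, e1] at h1
      rw [e2, e2] at h2
      linarith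
    have := hloc.apply_eq_of_preconnectedSpace 1 0
    linarith
  have hex : ∀ {x y : X} (q : Path.Homotopic.Quotient x y), ∃ r : ℝ, ∀ γ : Path x y,
      Path.Homotopic.Quotient.mk γ = q → ∀ Γ : C(unitInterval, h.core.TotalSpace),
      h.core.proj ∘ Γ = γ → h.eval (Γ 1) - h.eval (Γ 0) = r := by
    intro x y q
    obtain ⟨γ, rfl⟩ := Path.Homotopic.Quotient.mk_surjective q
    let e : h.core.TotalSpace := ⟨x, (0 : ℝ)⟩
    have h0 : ∀ γ' : Path x y, (γ' : C(unitInterval, X)) 0 = h.core.proj e := fun γ' => γ'.source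
    refine ⟨h.eval (cov.liftPath γ e (h0 γ) 1) - h.eval (cov.liftPath γ e (h0 γ) 0),
      fun γ' hγ' Γ hΓ => ?_⟩
    have hh : (γ' : C(unitInterval, X)).HomotopicRel γ {0, 1} :=
      Path.Homotopic.Quotient.eq.1 hγ'
    have := cov.liftPath_apply_one_eq_of_homotopicRel hh e (h0 γ') (h0 γ)
    rw [key γ' Γ _ hΓ (cov.liftPath_lifts γ' e (h0 γ')), this,
      cov.liftPath_zero, cov.liftPath_zero]
  choose I hI using @hex
  have hlift : ∀ {x y : X} (γ : Path x y), ∃ Γ : C(unitInterval, h.core.TotalSpace),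
      h.core.proj ∘ Γ = γ := fun {x y} γ =>
    ⟨cov.liftPath γ (⟨x, (0 : ℝ)⟩ : h.core.TotalSpace) γ.source, cov.liftPath_lifts _ _ _⟩
  refine ⟨⟨@I, ?_⟩, ?_⟩
  · intro x y z p q
    obtain ⟨γ, rfl⟩ := Path.Homotopic.Quotient.mk_surjective p
    obtain ⟨δ, rfl⟩ := Path.Homotopic.Quotient.mk_surjective q
    obtain ⟨Γ, hΓ⟩ := hlift γ
    have hs : (δ : C(unitInterval, X)) 0 = h.core.proj (Γ 1) := by
      have := congrFun hΓ 1
      simp only [Function.comp_apply] at this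
      rw [this]
      simp
    set Δ := cov.liftPath δ (Γ 1) hs with hΔ
    have hΔ0 : Δ 0 = Γ 1 := cov.liftPath_zero _ _ _
    let G : Path (Γ 0) (Γ 1) := ⟨Γ, rfl, rfl⟩
    let D : Path (Γ 1) (Δ 1) := ⟨Δ, hΔ0, rfl⟩
    have hGD : h.core.proj ∘ ((G.trans D : Path (Γ 0) (Δ 1)) : C(unitInterval, _))
        = γ.trans δ := by
      funext t
      have e1 : ∀ s, h.core.proj (Γ s) = γ s := fun s => congrFun hΓ s
      have e2 : ∀ s, h.core.proj (Δ s) = δ s := fun s => congrFun (cov.liftPath_lifts _ _ hs) s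
      change h.core.proj ((G.trans D) t) = _
      rw [Path.trans_apply, Path.trans_apply]
      split_ifs
      · exact e1 _
      · exact e2 _
    rw [← hI _ _ (Path.Homotopic.Quotient.mk_trans γ δ) _ hGD, ← hI _ γ rfl Γ hΓ,
      ← hI _ δ rfl Δ (cov.liftPath_lifts _ _ hs), hΔ0]
    simp
  · intro p x y γ hγ
    obtain ⟨Γ, hΓ⟩ := hlift γ
    have e1 : ∀ s, (Γ s).1 = γ s := fun s => congrFun hΓ s
    change I _ = _
    rw [← hI _ γ rfl Γ hΓ]
    have hloc : IsLocallyConstant (fun t => h.eval (Γ t) - f p (γ t)) := by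
      refine (IsLocallyConstant.iff_eventually_eq _).2 fun t => ?_
      have c1 := Γ.continuous.continuousAt.eventually
        (h.eventually_eval_sub p (Γ t) (by rw [e1]; exact hγ ⟨t, rfl⟩))
      filter_upwards [c1] with s h1
      rwa [e1, e1] at h1
    have := hloc.apply_eq_of_preconnectedSpace 1 0
    simp only [γ.source, γ.target] at this
    linarith

end Branches

/-! ### One-forms in charts -/

theorem two_le_infty : (2 : WithTop ℕ∞) ≤ ∞ := by
  exact WithTop.coe_le_coe.2 (le_top : (2 : ℕ∞) ≤ ⊤)

section PlaneForms

variable {F : Type*} [NormedAddCommGroup F] [NormedSpace ℝ F]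

/-- The exterior derivative commutes with pull-backs: the terms with the second derivative of the
map cancel by its symmetry. -/
theorem planeExtD_pullback {g g₀ : Plane → Plane →L[ℝ] F} {φ : Plane → Plane} {y : Plane}
    (h : g₀ =ᶠ[nhds y] fun w => (g (φ w)).comp (fderiv ℝ φ w)) (hφ : ContDiffAt ℝ 2 φ y)
    (hg : DifferentiableAt ℝ g (φ y)) (u v : Plane) :
    planeExtD g₀ y u v = planeExtD g (φ y) (fderiv ℝ φ y u) (fderiv ℝ φ y v) := by
  have hφ1 : DifferentiableAt ℝ φ y := hφ.differentiableAt (by norm_num)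
  have hφ2 : DifferentiableAt ℝ (fderiv ℝ φ) y :=
    (hφ.fderiv_right (m := 1) (by norm_num)).differentiableAt (by norm_num)
  have hgφ : HasFDerivAt (fun w => g (φ w)) ((fderiv ℝ g (φ y)).comp (fderiv ℝ φ y)) y :=
    hg.hasFDerivAt.comp y hφ1.hasFDerivAt
  have hsymm := (hφ.isSymmSndFDerivAt (by simp)).eq u v
  have hd := (hgφ.clm_comp hφ2.hasFDerivAt).fderiv
  rw [planeExtD, planeExtD, h.fderiv_eq, hd]
  simp [hsymm]

theorem planeExtD_fderiv {f : Plane → F} {y : Plane} (hf : ContDiffAt ℝ 2 f y) (u v : Plane) :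
    planeExtD (fderiv ℝ f) y u v = 0 := by
  have hsymm := (hf.isSymmSndFDerivAt (by simp)).eq u v
  rw [planeExtD, hsymm, sub_self]

end PlaneForms

section Discs

variable {S : Type*} [TopologicalSpace S] [ChartedSpace Plane S]

theorem exists_ball_subset_target (p : S) :
    ∃ r > 0, Metric.ball (extChartAt (𝓡 2) p p) r ⊆ (extChartAt (𝓡 2) p).target :=
  Metric.isOpen_iff.1 (isOpen_extChartAt_target p) _ (mem_extChartAt_target p)

/-- The image in the plane of a coordinate disc around `p`. -/
def discBall (p : S) : Set Plane :=
  Metric.ball (extChartAt (𝓡 2) p p) (exists_ball_subset_target p).choose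

/-- A coordinate disc around `p`. -/
def disc (p : S) : Set S := (extChartAt (𝓡 2) p).source ∩ extChartAt (𝓡 2) p ⁻¹' discBall p

theorem discBall_subset (p : S) : discBall p ⊆ (extChartAt (𝓡 2) p).target :=
  (exists_ball_subset_target p).choose_spec.2

theorem isOpen_disc (p : S) : IsOpen (disc p) :=
  (continuousOn_extChartAt p).isOpen_inter_preimage (isOpen_extChartAt_source p)
    Metric.isOpen_ball

theorem mem_disc (p : S) : p ∈ disc p :=
  ⟨mem_extChartAt_source p, Metric.mem_ball_self (exists_ball_subset_target p).choose_spec.1⟩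

theorem chart_symm_mem_disc (p : S) {y : Plane} (hy : y ∈ discBall p) :
    (extChartAt (𝓡 2) p).symm y ∈ disc p := by
  refine ⟨(extChartAt (𝓡 2) p).map_target (discBall_subset p hy), ?_⟩
  rwa [Set.mem_preimage, (extChartAt (𝓡 2) p).right_inv (discBall_subset p hy)]

theorem lineMap_mem_discBall (p : S) {x y : Plane} (hx : x ∈ discBall p) (hy : y ∈ discBall p)
    (t : unitInterval) : AffineMap.lineMap x y (t : ℝ) ∈ discBall p :=
  (convex_ball _ _).lineMap_mem hx hy t.2

theorem exists_path_disc (p : S) {x y : S} (hx : x ∈ disc p) (hy : y ∈ disc p) :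
    ∃ γ : Path x y, Set.range γ ⊆ disc p := by
  refine ⟨⟨⟨fun t : unitInterval => (extChartAt (𝓡 2) p).symm (AffineMap.lineMap
    (extChartAt (𝓡 2) p x) (extChartAt (𝓡 2) p y) (t : ℝ)), ?_⟩, ?_, ?_⟩, ?_⟩
  · refine (continuousOn_extChartAt_symm p).comp_continuous ?_ fun t =>
      discBall_subset p (lineMap_mem_discBall p hx.2 hy.2 t)
    exact AffineMap.lineMap_continuous.comp continuous_subtype_val
  · simpa using (extChartAt (𝓡 2) p).left_inv hx.1
  · simpa using (extChartAt (𝓡 2) p).left_inv hy.1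
  · rintro _ ⟨t, rfl⟩
    exact chart_symm_mem_disc p (lineMap_mem_discBall p hx.2 hy.2 t)

/-- Coordinate discs are simply connected. -/
theorem homotopic_of_range_subset_disc (p : S) {x y : S} (γ δ : Path x y)
    (hγ : Set.range γ ⊆ disc p) (hδ : Set.range δ ⊆ disc p) : γ.Homotopic δ := by
  have gm : ∀ t, γ t ∈ disc p := fun t => hγ ⟨t, rfl⟩
  have dm : ∀ t, δ t ∈ disc p := fun t => hδ ⟨t, rfl⟩
  have gc : Continuous fun t => extChartAt (𝓡 2) p (γ t) :=
    (continuousOn_extChartAt p).comp_continuous γ.continuous fun t => (gm t).1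
  have dc : Continuous fun t => extChartAt (𝓡 2) p (δ t) :=
    (continuousOn_extChartAt p).comp_continuous δ.continuous fun t => (dm t).1
  refine ⟨⟨⟨⟨fun q : unitInterval × unitInterval => (extChartAt (𝓡 2) p).symm (AffineMap.lineMap
    (extChartAt (𝓡 2) p (γ q.2)) (extChartAt (𝓡 2) p (δ q.2)) (q.1 : ℝ)), ?_⟩, ?_, ?_⟩, ?_⟩⟩
  · refine (continuousOn_extChartAt_symm p).comp_continuous ?_ fun q =>
      discBall_subset p (lineMap_mem_discBall p (gm q.2).2 (dm q.2).2 q.1)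
    simp only [AffineMap.lineMap_apply, vsub_eq_sub, vadd_eq_add]
    have h1 := gc.comp (continuous_snd (X := unitInterval))
    have h2 := dc.comp (continuous_snd (X := unitInterval))
    have h3 : Continuous fun q : unitInterval × unitInterval => (q.1 : ℝ) := by fun_prop
    exact (h3.smul (h2.sub h1)).add h1
  · intro t
    simpa using (extChartAt (𝓡 2) p).left_inv (gm t).1
  · intro t
    simpa using (extChartAt (𝓡 2) p).left_inv (dm t).1
  · rintro s t (rfl | rfl)
    · simpa using (extChartAt (𝓡 2) p).left_inv (by simpa using (gm 0).1)
    · simpa using (extChartAt (𝓡 2) p).left_inv (by simpa using (gm 1).1)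

end Discs

section Charts

variable {S : Type*} [TopologicalSpace S] [ChartedSpace Plane S] [IsManifold (𝓡 2) ∞ S]
variable {F : Type*} [NormedAddCommGroup F] [NormedSpace ℝ F]

theorem contMDiffAt_chart_symm (p : S) {y : Plane} (hy : y ∈ (extChartAt (𝓡 2) p).target) :
    ContMDiffAt 𝓘(ℝ, Plane) (𝓡 2) ∞ (extChartAt (𝓡 2) p).symm y :=
  (contMDiffOn_extChartAt_symm p).contMDiffAt ((isOpen_extChartAt_target p).mem_nhds hy)

theorem mdifferentiableAt_chart_symm (p : S) {y : Plane}
    (hy : y ∈ (extChartAt (𝓡 2) p).target) :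
    MDifferentiableAt 𝓘(ℝ, Plane) (𝓡 2) (extChartAt (𝓡 2) p).symm y :=
  (contMDiffAt_chart_symm p hy).mdifferentiableAt (by simp)

theorem contMDiffAt_chart (p : S) {z : S} (hz : z ∈ (extChartAt (𝓡 2) p).source) :
    ContMDiffAt (𝓡 2) 𝓘(ℝ, Plane) ∞ (extChartAt (𝓡 2) p) z :=
  (contMDiffOn_extChartAt (x := p)).contMDiffAt
    ((isOpen_extChartAt_source p).mem_nhds hz |> fun h => by simpa using h)

theorem mdifferentiableAt_chart (p : S) {z : S} (hz : z ∈ (extChartAt (𝓡 2) p).source) :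
    MDifferentiableAt (𝓡 2) 𝓘(ℝ, Plane) (extChartAt (𝓡 2) p) z :=
  (contMDiffAt_chart p hz).mdifferentiableAt (by simp)

theorem mfderiv_chart_symm_comp_mfderiv_chart (p : S) {z : S}
    (hz : z ∈ (extChartAt (𝓡 2) p).source) :
    (mfderiv 𝓘(ℝ, Plane) (𝓡 2) (extChartAt (𝓡 2) p).symm (extChartAt (𝓡 2) p z)).comp
      (mfderiv (𝓡 2) 𝓘(ℝ, Plane) (extChartAt (𝓡 2) p) z)
      = ContinuousLinearMap.id ℝ Plane := by
  have h2 := (mdifferentiableAt_chart p hz).hasMFDerivAt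
  have h1 := (mdifferentiableAt_chart_symm p ((extChartAt (𝓡 2) p).map_source hz)).hasMFDerivAt
  have h3 := HasMFDerivAt.comp z h1 h2
  have h4 : HasMFDerivAt (𝓡 2) (𝓡 2) ((extChartAt (𝓡 2) p).symm ∘ extChartAt (𝓡 2) p) z
      (ContinuousLinearMap.id ℝ (TangentSpace (𝓡 2) z)) := by
    refine (hasMFDerivAt_id z).congr_of_eventuallyEq ?_
    filter_upwards [(isOpen_extChartAt_source p).mem_nhds hz] with w hw
    exact (extChartAt (𝓡 2) p).left_inv hw
  exact hasMFDerivAt_unique h3 h4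

/-- The derivative at `x` of the chart around `x` is the identity, by the construction of the
tangent bundle. -/
theorem mfderiv_chart_symm_self (x : S) :
    mfderiv 𝓘(ℝ, Plane) (𝓡 2) (extChartAt (𝓡 2) x).symm (extChartAt (𝓡 2) x x)
      = ContinuousLinearMap.id ℝ Plane := by
  have hx := mem_extChartAt_target (I := 𝓡 2) x
  have hy : ∀ᶠ y in nhds (extChartAt (𝓡 2) x x),
      extChartAt (𝓡 2) x ((extChartAt (𝓡 2) x).symm y) = y := by
    filter_upwards [(isOpen_extChartAt_target x).mem_nhds hx] with y hy
    exact (extChartAt (𝓡 2) x).right_inv hy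
  rw [(mdifferentiableAt_chart_symm x hx).mfderiv]
  have hw : writtenInExtChartAt 𝓘(ℝ, Plane) (𝓡 2) (extChartAt (𝓡 2) x x)
      (extChartAt (𝓡 2) x).symm =ᶠ[nhds (extChartAt (𝓡 2) x x)] id := by
    filter_upwards [hy] with y hy
    simp only [writtenInExtChartAt, Function.comp_apply, extChartAt_model_space_eq_id,
      PartialEquiv.refl_symm, PartialEquiv.refl_coe, id]
    rw [extChartAt_to_inv]
    exact hy
  simp only [ModelWithCorners.range_eq_univ, fderivWithin_univ]
  exact hw.fderiv_eq.trans fderiv_id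

theorem formInChart_self (η : RawForm S F) (x : S) :
    formInChart η x (extChartAt (𝓡 2) x x) = η x := by
  have hx : (extChartAt (𝓡 2) x).symm (extChartAt (𝓡 2) x x) = x := extChartAt_to_inv x
  have h : ∀ z, z = x → (η z : Plane →L[ℝ] F) = η x := by
    rintro z rfl; rfl
  ext v
  have h2 := congrArg (fun L : Plane →L[ℝ] Plane => L v) (mfderiv_chart_symm_self x)
  refine (congrArg (fun L : Plane →L[ℝ] F => L _) (h _ hx)).trans ?_
  exact congrArg (fun w : Plane => (η x : Plane →L[ℝ] F) w) h2

theorem formInChart_comp_mfderiv_chart (η : RawForm S F) (p : S) {z : S}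
    (hz : z ∈ (extChartAt (𝓡 2) p).source) :
    (formInChart η p (extChartAt (𝓡 2) p z)).comp
      (mfderiv (𝓡 2) 𝓘(ℝ, Plane) (extChartAt (𝓡 2) p) z) = η z := by
  have hx : (extChartAt (𝓡 2) p).symm (extChartAt (𝓡 2) p z) = z :=
    (extChartAt (𝓡 2) p).left_inv hz
  have h : ∀ w, w = z → (η w : Plane →L[ℝ] F) = η z := by
    rintro w rfl; rfl
  ext v
  have h2 := congrArg (fun L : Plane →L[ℝ] Plane => L v)
    (mfderiv_chart_symm_comp_mfderiv_chart p hz)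
  refine (congrArg (fun L : Plane →L[ℝ] F => L _) (h _ hx)).trans ?_
  exact congrArg (fun w : Plane => (η z : Plane →L[ℝ] F) w) h2

theorem formInChart_dFun {f : S → F} (p : S) {y : Plane}
    (hy : y ∈ (extChartAt (𝓡 2) p).target)
    (hf : MDifferentiableAt (𝓡 2) 𝓘(ℝ, F) f ((extChartAt (𝓡 2) p).symm y)) :
    formInChart (dFun f) p y = fderiv ℝ (f ∘ (extChartAt (𝓡 2) p).symm) y := by
  rw [← mfderiv_eq_fderiv]
  exact (mfderiv_comp y hf (mdifferentiableAt_chart_symm p hy)).symm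

theorem contDiffAt_comp_chart_symm {f : S → F} (p : S) {y : Plane}
    (hy : y ∈ (extChartAt (𝓡 2) p).target)
    (hf : ContMDiffAt (𝓡 2) 𝓘(ℝ, F) ∞ f ((extChartAt (𝓡 2) p).symm y)) :
    ContDiffAt ℝ ∞ (f ∘ (extChartAt (𝓡 2) p).symm) y :=
  contMDiffAt_iff_contDiffAt.1 (hf.comp y (contMDiffAt_chart_symm p hy))

theorem hasFDerivAt_comp_chart_symm {f : S → F} {η : RawForm S F} (p : S) {y : Plane}
    (hy : y ∈ (extChartAt (𝓡 2) p).target)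
    (hf : HasMFDerivAt (𝓡 2) 𝓘(ℝ, F) f ((extChartAt (𝓡 2) p).symm y)
      (η ((extChartAt (𝓡 2) p).symm y))) :
    HasFDerivAt (f ∘ (extChartAt (𝓡 2) p).symm) (formInChart η p y) y :=
  (HasMFDerivAt.comp y hf (mdifferentiableAt_chart_symm p hy).hasMFDerivAt).hasFDerivAt

theorem hasMFDerivAt_of_comp_chart_symm {f : S → F} {η : RawForm S F} (p : S) {z : S}
    (hz : z ∈ (extChartAt (𝓡 2) p).source)
    (hf : HasFDerivAt (f ∘ (extChartAt (𝓡 2) p).symm) (formInChart η p (extChartAt (𝓡 2) p z))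
      (extChartAt (𝓡 2) p z)) :
    HasMFDerivAt (𝓡 2) 𝓘(ℝ, F) f z (η z) := by
  have h := HasMFDerivAt.comp z hf.hasMFDerivAt (mdifferentiableAt_chart p hz).hasMFDerivAt
  rw [← formInChart_comp_mfderiv_chart η p hz]
  refine h.congr_of_eventuallyEq ?_
  filter_upwards [(isOpen_extChartAt_source p).mem_nhds hz] with w hw
  exact congrArg f ((extChartAt (𝓡 2) p).left_inv hw).symm

theorem contDiffAt_chart_change (p q : S) {z : S} (hp : z ∈ (extChartAt (𝓡 2) p).source)
    (hq : z ∈ (extChartAt (𝓡 2) q).source) :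
    ContDiffAt ℝ ∞ (extChartAt (𝓡 2) q ∘ (extChartAt (𝓡 2) p).symm) (extChartAt (𝓡 2) p z) := by
  refine contDiffAt_comp_chart_symm p ((extChartAt (𝓡 2) p).map_source hp) ?_
  rw [(extChartAt (𝓡 2) p).left_inv hp]
  exact contMDiffAt_chart q hq

theorem formInChart_eventuallyEq (η : RawForm S F) (p q : S) {z : S}
    (hp : z ∈ (extChartAt (𝓡 2) p).source) (hq : z ∈ (extChartAt (𝓡 2) q).source) :
    formInChart η p =ᶠ[nhds (extChartAt (𝓡 2) p z)] fun w =>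
      (formInChart η q ((extChartAt (𝓡 2) q ∘ (extChartAt (𝓡 2) p).symm) w)).comp
        (fderiv ℝ (extChartAt (𝓡 2) q ∘ (extChartAt (𝓡 2) p).symm) w) := by
  have h1 := (isOpen_extChartAt_target p).mem_nhds ((extChartAt (𝓡 2) p).map_source hp)
  have h2 : (extChartAt (𝓡 2) p).symm ⁻¹' (extChartAt (𝓡 2) q).source
      ∈ nhds (extChartAt (𝓡 2) p z) := by
    refine (continuousAt_extChartAt_symm' hp).preimage_mem_nhds ?_
    rw [(extChartAt (𝓡 2) p).left_inv hp]
    exact (isOpen_extChartAt_source q).mem_nhds hq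
  filter_upwards [h1, h2] with w hw1 hw2
  have h3 := mfderiv_comp w (mdifferentiableAt_chart q hw2) (mdifferentiableAt_chart_symm p hw1)
  rw [mfderiv_eq_fderiv] at h3
  rw [h3]
  have h4 := formInChart_comp_mfderiv_chart η q hw2
  ext v
  exact (congrArg (fun L : Plane →L[ℝ] F => L (mfderiv 𝓘(ℝ, Plane) (𝓡 2)
    (extChartAt (𝓡 2) p).symm w v)) h4).symm

theorem planeExtD_formInChart {η : RawForm S F} (p q : S) {z : S}
    (hp : z ∈ (extChartAt (𝓡 2) p).source) (hq : z ∈ (extChartAt (𝓡 2) q).source)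
    (hη : DifferentiableAt ℝ (formInChart η q) (extChartAt (𝓡 2) q z)) (u v : Plane) :
    planeExtD (formInChart η p) (extChartAt (𝓡 2) p z) u v
      = planeExtD (formInChart η q) (extChartAt (𝓡 2) q z)
          (fderiv ℝ (extChartAt (𝓡 2) q ∘ (extChartAt (𝓡 2) p).symm) (extChartAt (𝓡 2) p z) u)
          (fderiv ℝ (extChartAt (𝓡 2) q ∘ (extChartAt (𝓡 2) p).symm) (extChartAt (𝓡 2) p z) v) := by
  have e : (extChartAt (𝓡 2) q ∘ (extChartAt (𝓡 2) p).symm) (extChartAt (𝓡 2) p z)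
      = extChartAt (𝓡 2) q z := by
    simp only [Function.comp_apply]
    rw [(extChartAt (𝓡 2) p).left_inv hp]
  have := planeExtD_pullback (formInChart_eventuallyEq η p q hp hq)
    ((contDiffAt_chart_change p q hp hq).of_le two_le_infty) (by rwa [e]) u v
  rwa [e] at this

/-- A closed form is closed in every chart. -/
theorem closedForms_planeExtD (α : closedForms S) (p : S) {y : Plane}
    (hy : y ∈ (extChartAt (𝓡 2) p).target) (u v : Plane) :
    planeExtD (formInChart (α : RawForm S ℝ) p) y u v = 0 := by
  have hz := (extChartAt (𝓡 2) p).map_target hy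
  have h := planeExtD_formInChart p ((extChartAt (𝓡 2) p).symm y) hz
    (mem_extChartAt_source (I := 𝓡 2) _) (α.2.1.differentiableAt _) u v
  rw [(extChartAt (𝓡 2) p).right_inv hy] at h
  rw [h]
  exact α.2.2 _ _ _

/-- A function with vanishing differential near `x` is constant near `x`. -/
theorem eventually_eq_of_hasMFDerivAt_zero {f : S → F} {x : S}
    (hf : ∀ᶠ z in nhds x, HasMFDerivAt (𝓡 2) 𝓘(ℝ, F) f z (0 : Plane →L[ℝ] F)) :
    ∀ᶠ z in nhds x, f z = f x := by
  have hx := mem_extChartAt_target (I := 𝓡 2) x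
  have h1 : ∀ᶠ y in nhds (extChartAt (𝓡 2) x x), y ∈ (extChartAt (𝓡 2) x).target ∧
      HasMFDerivAt (𝓡 2) 𝓘(ℝ, F) f ((extChartAt (𝓡 2) x).symm y) (0 : Plane →L[ℝ] F) := by
    refine Filter.Eventually.and ((isOpen_extChartAt_target x).mem_nhds hx) ?_
    rw [← extChartAt_to_inv (I := 𝓡 2) x] at hf
    exact (continuousAt_extChartAt_symm (I := 𝓡 2) x).eventually hf
  obtain ⟨r, hr, hb⟩ := Metric.eventually_nhds_iff_ball.1 h1
  have hd : ∀ y ∈ Metric.ball (extChartAt (𝓡 2) x x) r,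
      HasFDerivAt (f ∘ (extChartAt (𝓡 2) x).symm) (0 : Plane →L[ℝ] F) y := by
    intro y hy
    have := hasFDerivAt_comp_chart_symm (η := fun _ => (0 : Plane →L[ℝ] F)) x (hb y hy).1
      (hb y hy).2
    refine this.congr_fderiv ?_
    ext v; rfl
  filter_upwards [(isOpen_extChartAt_source (I := 𝓡 2) x).mem_nhds (mem_extChartAt_source x),
    (continuousAt_extChartAt (I := 𝓡 2) x).preimage_mem_nhds (Metric.ball_mem_nhds _ hr)]
    with z hz hz2
  have := (convex_ball (extChartAt (𝓡 2) x x) r).is_const_of_fderivWithin_eq_zero (𝕜 := ℝ)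
    (fun y hy => (hd y hy).differentiableAt.differentiableWithinAt)
    (fun y hy => by
      rw [fderivWithin_of_isOpen Metric.isOpen_ball hy, (hd y hy).fderiv]) hz2
    (Metric.mem_ball_self hr)
  simp only [Function.comp_apply] at this
  rwa [(extChartAt (𝓡 2) x).left_inv hz, extChartAt_to_inv] at this

/-- A function with a smooth differential is smooth. -/
theorem contMDiff_of_hasMFDerivAt {f : S → F} {η : RawForm S F} (hη : IsSmoothForm η)
    (hf : ∀ x, HasMFDerivAt (𝓡 2) 𝓘(ℝ, F) f x (η x)) : ContMDiff (𝓡 2) 𝓘(ℝ, F) ∞ f := by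
  intro x
  have ho := isOpen_extChartAt_target (I := 𝓡 2) x
  have hd : ∀ y ∈ (extChartAt (𝓡 2) x).target,
      HasFDerivAt (f ∘ (extChartAt (𝓡 2) x).symm) (formInChart η x y) y :=
    fun y hy => hasFDerivAt_comp_chart_symm x hy (hf _)
  have hs : ContDiffOn ℝ ∞ (f ∘ (extChartAt (𝓡 2) x).symm) (extChartAt (𝓡 2) x).target := by
    rw [contDiffOn_infty_iff_fderiv_of_isOpen ho]
    exact ⟨fun y hy => (hd y hy).differentiableAt.differentiableWithinAt,
      (hη x).congr fun y hy => (hd y hy).fderiv⟩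
  have h1 : ContMDiffAt (𝓡 2) 𝓘(ℝ, F) ∞
      ((f ∘ (extChartAt (𝓡 2) x).symm) ∘ extChartAt (𝓡 2) x) x :=
    ContMDiffAt.comp x (hs.contDiffAt (ho.mem_nhds (mem_extChartAt_target x))).contMDiffAt
      (contMDiffAt_chart x (mem_extChartAt_source x))
  refine h1.congr_of_eventuallyEq ?_
  filter_upwards [(isOpen_extChartAt_source (I := 𝓡 2) x).mem_nhds (mem_extChartAt_source x)]
    with w hw
  exact congrArg f ((extChartAt (𝓡 2) x).left_inv hw).symm

/-- Near a point where `η = df` with smooth `f`, the coefficients of `η` are those of the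
derivative of `f` in coordinates. -/
theorem formInChart_eventuallyEq_fderiv {f : S → F} {η : RawForm S F} (p : S) {y : Plane}
    (hy : y ∈ (extChartAt (𝓡 2) p).target)
    (hf : ContMDiffAt (𝓡 2) 𝓘(ℝ, F) ∞ f ((extChartAt (𝓡 2) p).symm y))
    (hη : ∀ᶠ z in nhds ((extChartAt (𝓡 2) p).symm y), η z = dFun f z) :
    formInChart η p =ᶠ[nhds y] fderiv ℝ (f ∘ (extChartAt (𝓡 2) p).symm) := by
  have hm : ∀ᶠ z in nhds ((extChartAt (𝓡 2) p).symm y), MDifferentiableAt (𝓡 2) 𝓘(ℝ, F) f z := by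
    have h1 : ContMDiffAt (𝓡 2) 𝓘(ℝ, F) 1 f ((extChartAt (𝓡 2) p).symm y) :=
      hf.of_le (one_le_two.trans two_le_infty)
    filter_upwards [(contMDiffAt_iff_contMDiffAt_nhds (by simp)).1 h1] with z hz
    exact hz.mdifferentiableAt (by simp)
  have hc := (contMDiffAt_chart_symm p hy).continuousAt
  filter_upwards [(isOpen_extChartAt_target p).mem_nhds hy, hc.eventually hm, hc.eventually hη]
    with w hw hw1 hw2
  rw [← formInChart_dFun p hw hw1]
  simp only [formInChart]
  rw [hw2]

/-- A form that is locally the differential of smooth functions is smooth. -/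
theorem isSmoothForm_of_locally_exact {η : RawForm S F}
    (h : ∀ x, ∃ f : S → F, ContMDiffAt (𝓡 2) 𝓘(ℝ, F) ∞ f x ∧ ∀ᶠ z in nhds x, η z = dFun f z) :
    IsSmoothForm η := by
  intro p y hy
  obtain ⟨f, hf, hη⟩ := h ((extChartAt (𝓡 2) p).symm y)
  refine ContDiffAt.contDiffWithinAt ?_
  exact ((contDiffAt_comp_chart_symm p hy hf).fderiv_right (m := ∞) (by simp)).congr_of_eventuallyEq
    (formInChart_eventuallyEq_fderiv p hy hf hη)

/-- A form that is locally the differential of smooth functions is closed. -/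
theorem mem_closedForms_of_locally_exact {η : RawForm S ℝ}
    (h : ∀ x, ∃ f : S → ℝ, ContMDiffAt (𝓡 2) 𝓘(ℝ, ℝ) ∞ f x ∧ ∀ᶠ z in nhds x, η z = dFun f z) :
    η ∈ closedForms S := by
  refine ⟨isSmoothForm_of_locally_exact h, fun x u v => ?_⟩
  obtain ⟨f, hf, hη⟩ := h x
  have hx := mem_extChartAt_target (I := 𝓡 2) x
  rw [← extChartAt_to_inv (I := 𝓡 2) x] at hf hη
  have e := formInChart_eventuallyEq_fderiv x hx hf hη
  have h2 := planeExtD_fderiv ((contDiffAt_comp_chart_symm x hx hf).of_le two_le_infty) u v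
  refine Eq.trans ?_ h2
  unfold extD planeExtD
  rw [e.fderiv_eq]

theorem isSmoothForm_dFun {f : S → F} (hf : ContMDiff (𝓡 2) 𝓘(ℝ, F) ∞ f) :
    IsSmoothForm (dFun f) :=
  isSmoothForm_of_locally_exact fun x => ⟨f, hf x, Filter.Eventually.of_forall fun _ => rfl⟩

/-- The Poincaré lemma on a coordinate disc. -/
theorem exists_primitive_disc (α : closedForms S) (p : S) :
    ∃ f : S → ℝ, ∀ x ∈ disc p, HasMFDerivAt (𝓡 2) 𝓘(ℝ, ℝ) f x ((α : RawForm S ℝ) x) := by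
  obtain ⟨g, hg⟩ := Convex.exists_forall_hasFDerivAt_of_fderiv_symmetric (𝕜 := ℝ)
    (convex_ball _ _ : Convex ℝ (discBall p)) Metric.isOpen_ball
    (((α.2.1 p).differentiableOn (by simp)).mono (discBall_subset p)) (fun y hy u v =>
      sub_eq_zero.1 (closedForms_planeExtD α p (discBall_subset p hy) u v))
  refine ⟨g ∘ extChartAt (𝓡 2) p, fun x hx => hasMFDerivAt_of_comp_chart_symm p hx.1 ?_⟩
  refine (hg _ hx.2).congr_of_eventuallyEq ?_
  filter_upwards [Metric.isOpen_ball.mem_nhds hx.2] with y hy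
  exact congrArg g ((extChartAt (𝓡 2) p).right_inv (discBall_subset p hy))

end Charts

/-! ### Homomorphisms of the fundamental groupoid and of the fundamental group -/

section Loops

variable {X : Type*} [TopologicalSpace X]

/-- The restriction of a homomorphism of the fundamental groupoid to loops at a base point, as a
linear form on the abelianized fundamental group. -/
def PathHom.loops (H : PathHom X) (x₀ : X) :
    Additive (Abelianization (FundamentalGroup X x₀)) →ₗ[ℤ] ℝ :=
  (MonoidHom.toAdditiveLeft (Abelianization.lift
    ({ toFun := fun q => Multiplicative.ofAdd (H.val q.toPath)
       map_one' := congrArg Multiplicative.ofAdd (H.val_refl x₀)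
       map_mul' := fun p q => congrArg Multiplicative.ofAdd
        ((H.val_trans q.toPath p.toPath).trans (add_comm _ _)) } :
      FundamentalGroup X x₀ →* Multiplicative ℝ))).toIntLinearMap

/-- The class of a loop in the abelianized fundamental group. -/
def loopClass {x₀ : X} (q : Path.Homotopic.Quotient x₀ x₀) :
    Additive (Abelianization (FundamentalGroup X x₀)) :=
  Additive.ofMul (Abelianization.of (FundamentalGroup.fromPath q))

theorem PathHom.loops_loopClass (H : PathHom X) {x₀ : X} (q : Path.Homotopic.Quotient x₀ x₀) :
    H.loops x₀ (loopClass q) = H.val q := by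
  rfl

theorem loopClass_surjective {x₀ : X} (g : Additive (Abelianization (FundamentalGroup X x₀))) :
    ∃ q : Path.Homotopic.Quotient x₀ x₀, loopClass q = g := by
  obtain ⟨q, hq⟩ := QuotientGroup.mk_surjective g.toMul
  exact ⟨q.toPath, hq⟩

theorem loopClass_trans {x₀ : X} (p q : Path.Homotopic.Quotient x₀ x₀) :
    loopClass (p.trans q) = loopClass p + loopClass q := by
  have h : FundamentalGroup.fromPath (p.trans q)
      = FundamentalGroup.fromPath q * FundamentalGroup.fromPath p := rfl
  rw [loopClass, h, map_mul, ofMul_mul, add_comm]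
  rfl

theorem quotient_trans_assoc {w x y z : X} (p : Path.Homotopic.Quotient w x)
    (q : Path.Homotopic.Quotient x y) (r : Path.Homotopic.Quotient y z) :
    (p.trans q).trans r = p.trans (q.trans r) := by
  obtain ⟨p, rfl⟩ := Path.Homotopic.Quotient.mk_surjective p
  obtain ⟨q, rfl⟩ := Path.Homotopic.Quotient.mk_surjective q
  obtain ⟨r, rfl⟩ := Path.Homotopic.Quotient.mk_surjective r
  simp only [← Path.Homotopic.Quotient.mk_trans]
  exact Path.Homotopic.Quotient.eq.2 ⟨Path.Homotopy.transAssoc p q r⟩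

theorem quotient_symm_trans_cancel {x y z : X} (p : Path.Homotopic.Quotient y x)
    (q : Path.Homotopic.Quotient y z) : p.trans (p.symm.trans q) = q := by
  obtain ⟨p, rfl⟩ := Path.Homotopic.Quotient.mk_surjective p
  obtain ⟨q, rfl⟩ := Path.Homotopic.Quotient.mk_surjective q
  simp only [← Path.Homotopic.Quotient.mk_trans, ← Path.Homotopic.Quotient.mk_symm]
  refine Path.Homotopic.Quotient.eq.2 ?_
  refine Path.Homotopic.trans (Path.Homotopic.symm ⟨Path.Homotopy.transAssoc _ _ _⟩) ?_
  refine Path.Homotopic.trans (Path.Homotopic.hcomp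
    (Path.Homotopic.symm ⟨Path.Homotopy.reflTransSymm p⟩) (Path.Homotopic.refl q)) ?_
  exact ⟨Path.Homotopy.reflTrans q⟩

/-- On a path-connected space every linear form on the abelianized fundamental group extends to a
homomorphism of the fundamental groupoid. -/
theorem exists_pathHom_loops [PathConnectedSpace X] (x₀ : X)
    (L : Additive (Abelianization (FundamentalGroup X x₀)) →ₗ[ℤ] ℝ) :
    ∃ H : PathHom X, H.loops x₀ = L := by
  -- an arbitrary choice of paths from the base point turns paths into loops
  let τ : ∀ x : X, Path.Homotopic.Quotient x₀ x := fun x =>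
    Path.Homotopic.Quotient.mk (PathConnectedSpace.somePath x₀ x)
  have hsub : ∀ {x y z : X} (p : Path.Homotopic.Quotient x y) (q : Path.Homotopic.Quotient y z),
      (((τ x).trans p).trans (τ y).symm).trans (((τ y).trans q).trans (τ z).symm)
        = ((τ x).trans (p.trans q)).trans (τ z).symm := by
    intro x y z p q
    simp only [quotient_trans_assoc]
    congr 2
    have := quotient_symm_trans_cancel (τ y).symm (q.trans (τ z).symm)
    obtain ⟨t, ht⟩ := Path.Homotopic.Quotient.mk_surjective (τ y)
    rw [← ht] at this ⊢
    simpa only [← Path.Homotopic.Quotient.mk_symm, Path.symm_symm] using this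
  let H : PathHom X :=
    { val := fun {x y} q => L (loopClass (((τ x).trans q).trans (τ y).symm))
      val_trans := by
        intro x y z p q
        rw [← map_add, ← loopClass_trans, hsub] }
  refine ⟨H, LinearMap.ext fun g => ?_⟩
  obtain ⟨q, rfl⟩ := loopClass_surjective g
  rw [PathHom.loops_loopClass]
  change L (loopClass (((τ x₀).trans q).trans (τ x₀).symm)) = L (loopClass q)
  have e : loopClass ((τ x₀).trans (τ x₀).symm) = 0 := by
    have h := congrArg loopClass (quotient_symm_trans_cancel (τ x₀) ((τ x₀)))
    simp only [loopClass_trans] at h ⊢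
    rw [← add_assoc] at h
    exact add_eq_right.1 h
  rw [loopClass_trans] at e
  rw [loopClass_trans, loopClass_trans]
  congr 1
  rw [add_right_comm, e, zero_add]

end Loops

section Rank

open Module TensorProduct

/-- The rank of an abelian group is the dimension of its space of real linear forms, if that is
finite. -/
theorem rank_eq_finrank_dual (G : Type*) [AddCommGroup G]
    [hfin : Module.Finite ℝ (G →ₗ[ℤ] ℝ)] :
    Module.rank ℤ G = Module.finrank ℝ (G →ₗ[ℤ] ℝ) := by
  let e : (G →ₗ[ℤ] ℝ) ≃ₗ[ℝ] (ℝ ⊗[ℤ] G →ₗ[ℝ] ℝ) := LinearMap.liftBaseChangeEquiv ℝ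
  have h2 : Module.Finite ℝ (Module.Dual ℝ (ℝ ⊗[ℤ] G)) := Module.Finite.equiv e
  have h3 : Module.Finite ℝ (ℝ ⊗[ℤ] G) := (Module.finite_dual_iff ℝ).1 h2
  rw [e.finrank_eq, show finrank ℝ (ℝ ⊗[ℤ] G →ₗ[ℝ] ℝ) = finrank ℝ (ℝ ⊗[ℤ] G) from
    Subspace.dual_finrank_eq, Module.finrank_eq_rank]
  exact ((TensorProduct.isBaseChange ℤ G ℝ).rank_eq (P := ℝ ⊗[ℤ] G)).symm

end Rank

/-! ### Periods of closed forms -/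

section Periods

theorem sub_eq_of_eventually_sub_eq {X : Type*} [TopologicalSpace X] {f g : X → ℝ} {U : Set X}
    (h : ∀ x ∈ U, ∀ᶠ y in nhds x, f y - g y = f x - g x) {x y : X} (γ : Path x y)
    (hγ : Set.range γ ⊆ U) : f y - g y = f x - g x := by
  have hloc : IsLocallyConstant (fun t => f (γ t) - g (γ t)) :=
    (IsLocallyConstant.iff_eventually_eq _).2 fun t =>
      γ.continuous.continuousAt.eventually (h (γ t) (hγ ⟨t, rfl⟩))
  simpa using hloc.apply_eq_of_preconnectedSpace 1 0

variable {S : Type*} [TopologicalSpace S] [ChartedSpace Plane S]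

theorem disc_mem_nhds (p : S) : disc p ∈ nhds p := (isOpen_disc p).mem_nhds (mem_disc p)

theorem hasMFDerivAt_add_const {f : S → ℝ} {x : S} {L : TangentSpace (𝓡 2) x →L[ℝ] ℝ}
    (h : HasMFDerivAt (𝓡 2) 𝓘(ℝ, ℝ) f x L) (c : ℝ) :
    HasMFDerivAt (𝓡 2) 𝓘(ℝ, ℝ) (fun y => f y + c) x L := by
  have h1 := h.add (hasMFDerivAt_const c x)
  exact h1.congr_mfderiv (add_zero L)

theorem pathConnectedSpace_of_chartedSpace [ConnectedSpace S] : PathConnectedSpace S := by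
  have : LocallyPathConnectedSpace S := ChartedSpace.locallyPathConnectedSpace Plane S
  exact PathConnectedSpace.of_locallyPathConnectedSpace

variable [IsManifold (𝓡 2) ∞ S]

/-- Two primitives of the same form differ by a locally constant function. -/
theorem eventually_sub_eq_of_primitives {f g : S → ℝ} {η : RawForm S ℝ} {U : Set S}
    (hU : IsOpen U) (hf : ∀ x ∈ U, HasMFDerivAt (𝓡 2) 𝓘(ℝ, ℝ) f x (η x))
    (hg : ∀ x ∈ U, HasMFDerivAt (𝓡 2) 𝓘(ℝ, ℝ) g x (η x)) {x : S} (hx : x ∈ U) :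
    ∀ᶠ y in nhds x, f y - g y = f x - g x := by
  refine eventually_eq_of_hasMFDerivAt_zero (f := fun y => f y - g y) ?_
  filter_upwards [hU.mem_nhds hx] with y hy
  have := (hf y hy).sub (hg y hy)
  rwa [sub_self] at this

/-- Integration of a closed form along homotopy classes of paths, characterized by its values on
paths in coordinate discs. -/
theorem exists_integral (α : closedForms S) :
    ∃ H : PathHom S, ∀ (p : S) (f : S → ℝ),
      (∀ z ∈ disc p, HasMFDerivAt (𝓡 2) 𝓘(ℝ, ℝ) f z ((α : RawForm S ℝ) z)) →
      ∀ (x y : S) (γ : Path x y), Set.range γ ⊆ disc p →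
      H.val (Path.Homotopic.Quotient.mk γ) = f y - f x := by
  choose F hF using exists_primitive_disc α
  have hB : IsBranchSystem disc F := by
    refine ⟨isOpen_disc, mem_disc, fun p q x hx => ?_⟩
    exact eventually_sub_eq_of_primitives ((isOpen_disc p).inter (isOpen_disc q))
      (fun z hz => hF p z hz.1) (fun z hz => hF q z hz.2) hx
  obtain ⟨H, hH⟩ := hB.exists_pathHom
  refine ⟨H, fun p f hf x y γ hγ => ?_⟩
  rw [hH p x y γ hγ]
  have := sub_eq_of_eventually_sub_eq
    (fun z hz => eventually_sub_eq_of_primitives (isOpen_disc p) (hF p) hf hz) γ hγ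
  linarith

/-- The integral of a closed form along homotopy classes of paths. -/
def integral (α : closedForms S) : PathHom S := (exists_integral α).choose

theorem integral_mk (α : closedForms S) {p : S} {f : S → ℝ}
    (hf : ∀ z ∈ disc p, HasMFDerivAt (𝓡 2) 𝓘(ℝ, ℝ) f z ((α : RawForm S ℝ) z))
    {x y : S} (γ : Path x y) (hγ : Set.range γ ⊆ disc p) :
    (integral α).val (Path.Homotopic.Quotient.mk γ) = f y - f x :=
  (exists_integral α).choose_spec p f hf x y γ hγ

theorem integral_add (α β : closedForms S) {x y : S} (q : Path.Homotopic.Quotient x y) :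
    (integral (α + β)).val q = (integral α).val q + (integral β).val q := by
  let J : PathHom S :=
    { val := fun q => (integral α).val q + (integral β).val q
      val_trans := fun p q => by rw [(integral α).val_trans, (integral β).val_trans]; ring }
  refine PathHom.val_eq_of_short (J := J) disc_mem_nhds (fun p x y γ hγ => ?_) q
  obtain ⟨f, hf⟩ := exists_primitive_disc α p
  obtain ⟨g, hg⟩ := exists_primitive_disc β p
  change _ = (integral α).val _ + (integral β).val _
  rw [integral_mk α hf γ hγ, integral_mk β hg γ hγ,
    integral_mk (α + β) (f := f + g) (fun z hz => (hf z hz).add (hg z hz)) γ hγ]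
  simp only [Pi.add_apply]
  ring

theorem integral_smul (c : ℝ) (α : closedForms S) {x y : S} (q : Path.Homotopic.Quotient x y) :
    (integral (c • α)).val q = c * (integral α).val q := by
  let J : PathHom S :=
    { val := fun q => c * (integral α).val q
      val_trans := fun p q => by rw [(integral α).val_trans]; ring }
  refine PathHom.val_eq_of_short (J := J) disc_mem_nhds (fun p x y γ hγ => ?_) q
  obtain ⟨f, hf⟩ := exists_primitive_disc α p
  change _ = c * (integral α).val _
  rw [integral_mk α hf γ hγ,
    integral_mk (c • α) (f := c • f) (fun z hz => (hf z hz).const_smul c) γ hγ]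
  simp only [Pi.smul_apply, smul_eq_mul]
  ring

theorem integral_of_exact {α : closedForms S} {f : S → ℝ}
    (hf : ∀ x, HasMFDerivAt (𝓡 2) 𝓘(ℝ, ℝ) f x ((α : RawForm S ℝ) x)) {x y : S}
    (q : Path.Homotopic.Quotient x y) : (integral α).val q = f y - f x := by
  let J : PathHom S :=
    { val := fun {x y} _ => f y - f x
      val_trans := fun p q => by ring }
  exact PathHom.val_eq_of_short (J := J) disc_mem_nhds
    (fun p x y γ hγ => integral_mk α (fun z _ => hf z) γ hγ) q

/-- The periods of closed forms along loops at a base point. -/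
def period (x₀ : S) :
    closedForms S →ₗ[ℝ] (Additive (Abelianization (FundamentalGroup S x₀)) →ₗ[ℤ] ℝ) where
  toFun α := (integral α).loops x₀
  map_add' α β := by
    ext g
    obtain ⟨q, rfl⟩ := loopClass_surjective g
    simp only [LinearMap.add_apply, PathHom.loops_loopClass, integral_add]
  map_smul' c α := by
    ext g
    obtain ⟨q, rfl⟩ := loopClass_surjective g
    simp only [LinearMap.smul_apply, PathHom.loops_loopClass, integral_smul, RingHom.id_apply,
      smul_eq_mul]

/-- A closed form without periods is exact: its integral along paths from the base point depends
only on the end point. -/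
theorem ker_period [ConnectedSpace S] (x₀ : S) : LinearMap.ker (period x₀) = exactForms S := by
  have : PathConnectedSpace S := pathConnectedSpace_of_chartedSpace
  ext α
  rw [LinearMap.mem_ker]
  constructor
  · intro h
    have hloop : ∀ q : Path.Homotopic.Quotient x₀ x₀, (integral α).val q = 0 := fun q => by
      rw [← PathHom.loops_loopClass]
      exact LinearMap.congr_fun h (loopClass q)
    let τ : ∀ x : S, Path.Homotopic.Quotient x₀ x := fun x =>
      Path.Homotopic.Quotient.mk (PathConnectedSpace.somePath x₀ x)
    have hindep : ∀ {x y : S} (q : Path.Homotopic.Quotient x y),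
        (integral α).val q = (integral α).val (τ y) - (integral α).val (τ x) := by
      intro x y q
      have h1 := hloop (((τ x).trans q).trans (τ y).symm)
      have h2 := hloop ((τ y).trans (τ y).symm)
      simp only [PathHom.val_trans] at h1 h2
      linarith
    have hd : ∀ x, HasMFDerivAt (𝓡 2) 𝓘(ℝ, ℝ) (fun y => (integral α).val (τ y)) x
        ((α : RawForm S ℝ) x) := by
      intro x
      obtain ⟨f, hf⟩ := exists_primitive_disc α x
      have e : (fun y => (integral α).val (τ y)) =ᶠ[nhds x]
          fun y => f y + ((integral α).val (τ x) - f x) := by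
        filter_upwards [disc_mem_nhds x] with y hy
        obtain ⟨γ, hγ⟩ := exists_path_disc x (mem_disc x) hy
        have h1 := integral_mk α hf γ hγ
        rw [hindep] at h1
        linarith
      exact (hasMFDerivAt_add_const (hf x (mem_disc x)) _).congr_of_eventuallyEq e
    exact ⟨_, contMDiff_of_hasMFDerivAt α.2.1 hd, funext fun x => (hd x).mfderiv.symm⟩
  · rintro ⟨f, hf, e⟩
    have hd : ∀ x, HasMFDerivAt (𝓡 2) 𝓘(ℝ, ℝ) f x ((α : RawForm S ℝ) x) := fun x => by
      rw [e]
      exact (hf.mdifferentiableAt (by simp)).hasMFDerivAt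
    refine LinearMap.ext fun g => ?_
    obtain ⟨q, rfl⟩ := loopClass_surjective g
    change (integral α).loops x₀ _ = 0
    rw [PathHom.loops_loopClass, integral_of_exact hd, sub_self]

/-- Every homomorphism of the fundamental groupoid is, up to the increments of a function, the
integral of a closed form: its branches on coordinate discs are made smooth with a partition of
unity. -/
theorem exists_integral_eq [T2Space S] [SecondCountableTopology S] (H : PathHom S) :
    ∃ (α : closedForms S) (w : S → ℝ), ∀ (x y : S) (q : Path.Homotopic.Quotient x y),
      (integral α).val q = H.val q - (w y - w x) := by
  have : LocallyCompactSpace S := ChartedSpace.locallyCompactSpace Plane S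
  have : SigmaCompactSpace S := sigmaCompactSpace_of_locallyCompact_secondCountable
  obtain ⟨ρ, hρ⟩ := SmoothPartitionOfUnity.exists_isSubordinate (𝓡 2) (s := (Set.univ : Set S))
    isClosed_univ disc isOpen_disc fun x _ => Set.mem_iUnion.2 ⟨x, mem_disc x⟩
  -- the branch of `H` on the disc around `p` that vanishes at `p`
  have hu : ∀ p x, ∃ r : ℝ, ∀ γ : Path p x, Set.range γ ⊆ disc p →
      H.val (Path.Homotopic.Quotient.mk γ) = r := by
    intro p x
    by_cases hx : x ∈ disc p
    · obtain ⟨γ, hγ⟩ := exists_path_disc p (mem_disc p) hx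
      refine ⟨H.val (Path.Homotopic.Quotient.mk γ), fun δ hδ => ?_⟩
      rw [Path.Homotopic.Quotient.eq.2 (homotopic_of_range_subset_disc p δ γ hδ hγ)]
    · exact ⟨0, fun γ hγ => absurd (hγ ⟨1, γ.target⟩) hx⟩
  choose u hu using hu
  have hinc : ∀ p {x y : S} (γ : Path x y), Set.range γ ⊆ disc p →
      H.val (Path.Homotopic.Quotient.mk γ) = u p y - u p x := by
    intro p x y γ hγ
    obtain ⟨δ, hδ⟩ := exists_path_disc p (mem_disc p) (hγ ⟨0, γ.source⟩)
    have h1 := hu p y (δ.trans γ) (by rw [Path.trans_range]; exact Set.union_subset hδ hγ)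
    rw [Path.Homotopic.Quotient.mk_trans, H.val_trans, hu p x δ hδ] at h1
    linarith
  have hloc : ∀ p q, ∀ x ∈ disc p ∩ disc q, ∀ᶠ y in nhds x,
      u p y - u q y = u p x - u q x := by
    intro p q x hx
    have : LocallyPathConnectedSpace S := ChartedSpace.locallyPathConnectedSpace Plane S
    obtain ⟨V, ⟨hV, hVc⟩, hVs⟩ := (LocallyPathConnectedSpace.path_connected_basis x).mem_iff.1
      (((isOpen_disc p).inter (isOpen_disc q)).mem_nhds hx)
    filter_upwards [hV] with y hy
    obtain ⟨γ, hγ⟩ := hVc.joinedIn x (mem_of_mem_nhds hV) y hy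
    have hr : Set.range γ ⊆ V := by rintro _ ⟨t, rfl⟩; exact hγ t
    have h1 := hinc p γ (hr.trans (hVs.trans Set.inter_subset_left))
    have h2 := hinc q γ (hr.trans (hVs.trans Set.inter_subset_right))
    linarith
  set f : S → S → ℝ := fun p x => ∑ᶠ j, ρ j x • (u p x - u j x) with hf
  set w : S → ℝ := fun x => ∑ᶠ j, ρ j x • u j x with hw
  have hfin : ∀ (x : S) (g : S → ℝ), (Function.support fun j => ρ j x • g j).Finite := by
    intro x g
    refine (ρ.locallyFinite.point_finite x).subset fun j hj => ?_
    exact left_ne_zero_of_smul hj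
  have hfw : ∀ p x, f p x = u p x - w x := by
    intro p x
    have h1 : (∑ᶠ j, ρ j x • u p x) = u p x := by
      rw [← finsum_smul, ρ.sum_eq_one (Set.mem_univ x),
        one_smul]
    simp only [hf, hw, smul_sub]
    rw [finsum_sub_distrib (hfin x _) (hfin x _), h1]
  have hsmooth : ∀ p, ∀ x ∈ disc p, ContMDiffAt (𝓡 2) 𝓘(ℝ, ℝ) ∞ (f p) x := by
    intro p x hx
    refine ρ.contMDiffAt_finsum (n := ⊤) fun j hj => ?_
    refine (contMDiffAt_const (c := u p x - u j x)).congr_of_eventuallyEq ?_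
    exact hloc p j x ⟨hx, hρ j hj⟩
  have hdf : ∀ p q, ∀ x ∈ disc p ∩ disc q, f p =ᶠ[nhds x] fun y => f q y + (u p x - u q x) := by
    intro p q x hx
    filter_upwards [hloc p q x hx] with y hy
    rw [hfw, hfw]
    linarith
  -- the differentials of the smoothed branches agree on overlaps
  let η : RawForm S ℝ := fun x => dFun (f x) x
  have hη : ∀ p, ∀ x ∈ disc p, HasMFDerivAt (𝓡 2) 𝓘(ℝ, ℝ) (f p) x (η x) := by
    intro p x hx
    have h1 : HasMFDerivAt (𝓡 2) 𝓘(ℝ, ℝ) (f x) x (η x) :=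
      ((hsmooth x x (mem_disc x)).mdifferentiableAt (by simp)).hasMFDerivAt
    exact (hasMFDerivAt_add_const h1 _).congr_of_eventuallyEq (hdf p x x ⟨hx, mem_disc x⟩)
  have hcl : η ∈ closedForms S := by
    refine mem_closedForms_of_locally_exact fun x => ⟨f x, hsmooth x x (mem_disc x), ?_⟩
    filter_upwards [disc_mem_nhds x] with z hz
    exact (hη x z hz).mfderiv.symm
  refine ⟨⟨η, hcl⟩, w, fun x y q => ?_⟩
  let J : PathHom S :=
    { val := fun {x y} q => H.val q - (w y - w x)
      val_trans := fun p q => by rw [H.val_trans]; ring }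
  refine PathHom.val_eq_of_short (J := J) disc_mem_nhds (fun p x y γ hγ => ?_) q
  rw [integral_mk ⟨η, hcl⟩ (hη p) γ hγ]
  change _ = H.val _ - (w y - w x)
  rw [hinc p γ hγ, hfw, hfw]
  ring

theorem period_surjective [T2Space S] [SecondCountableTopology S] [ConnectedSpace S] (x₀ : S) :
    Function.Surjective (period x₀) := by
  have : PathConnectedSpace S := pathConnectedSpace_of_chartedSpace
  intro L
  obtain ⟨H, rfl⟩ := exists_pathHom_loops x₀ L
  obtain ⟨α, w, h⟩ := exists_integral_eq H
  refine ⟨α, LinearMap.ext fun g => ?_⟩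
  obtain ⟨q, rfl⟩ := loopClass_surjective g
  change (integral α).loops x₀ _ = _
  rw [PathHom.loops_loopClass, PathHom.loops_loopClass, h, sub_self, sub_zero]

/-- De Rham's theorem in degree one. -/
def deRhamEquiv [T2Space S] [SecondCountableTopology S] [ConnectedSpace S] (x₀ : S) :
    H1 S ≃ₗ[ℝ] (Additive (Abelianization (FundamentalGroup S x₀)) →ₗ[ℤ] ℝ) :=
  (Submodule.quotEquivOfEq _ _ (ker_period x₀).symm).trans
    ((period x₀).quotKerEquivOfSurjective (period_surjective x₀))

theorem rank_fundamentalGroup [T2Space S] [SecondCountableTopology S] [ConnectedSpace S]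
    [Module.Finite ℝ (H1 S)] (x₀ : S) :
    Module.rank ℤ (Additive (Abelianization (FundamentalGroup S x₀)))
      = (Module.finrank ℝ (H1 S) : Cardinal) := by
  have := Module.Finite.equiv (deRhamEquiv x₀)
  rw [rank_eq_finrank_dual, (deRhamEquiv x₀).finrank_eq]

end Periods

/-! ### Integrals depending smoothly on parameters -/

section ParametricIntegral

universe u

variable {E F : Type u} [NormedAddCommGroup E] [NormedSpace ℝ E] [NormedAddCommGroup F]
  [NormedSpace ℝ F]

/-- Differentiation under the integral sign for a continuously differentiable integrand. -/
theorem hasFDerivAt_integral_of_contDiffOn {f : E × ℝ → F} {U : Set E} (hU : IsOpen U)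
    (hf : ContDiffOn ℝ 1 f (U ×ˢ Set.univ)) {x₀ : E} (hx₀ : x₀ ∈ U) :
    HasFDerivAt (fun x => ∫ s in (0 : ℝ)..1, f (x, s))
      (∫ s in (0 : ℝ)..1, (fderiv ℝ f (x₀, s)).comp (ContinuousLinearMap.inl ℝ E ℝ)) x₀ := by
  have ho : IsOpen (U ×ˢ (Set.univ : Set ℝ)) := hU.prod isOpen_univ
  have hd : ∀ x ∈ U, ∀ s, DifferentiableAt ℝ f (x, s) := fun x hx s =>
    (hf.differentiableOn (by simp)).differentiableAt (ho.mem_nhds ⟨hx, trivial⟩)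
  have hslice : ∀ x ∈ U, ∀ s, HasFDerivAt (fun x' => f (x', s))
      ((fderiv ℝ f (x, s)).comp (ContinuousLinearMap.inl ℝ E ℝ)) x := fun x hx s =>
    (hd x hx s).hasFDerivAt.comp x ((hasFDerivAt_prodMk_left x s))
  have hcd : ContinuousOn (fun p => (fderiv ℝ f p).comp (ContinuousLinearMap.inl ℝ E ℝ))
      (U ×ˢ Set.univ) :=
    (hf.continuousOn_fderiv_of_isOpen ho le_rfl).clm_comp continuousOn_const
  have hline : ∀ x ∈ U, Continuous fun s : ℝ => f (x, s) := fun x hx =>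
    hf.continuousOn.comp_continuous (by fun_prop) fun s => ⟨hx, trivial⟩
  have hline' : Continuous fun s : ℝ =>
      (fderiv ℝ f (x₀, s)).comp (ContinuousLinearMap.inl ℝ E ℝ) :=
    hcd.comp_continuous (by fun_prop) fun s => ⟨hx₀, trivial⟩
  obtain ⟨M, hM⟩ := (isCompact_Icc (a := (0 : ℝ)) (b := 1)).exists_bound_of_continuousOn
    hline'.continuousOn
  have hnear : ∀ᶠ x in nhds x₀, ∀ s ∈ Set.Icc (0 : ℝ) 1,
      ‖(fderiv ℝ f (x, s)).comp (ContinuousLinearMap.inl ℝ E ℝ)‖ < M + 1 := by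
    refine isCompact_Icc.eventually_forall_of_forall_eventually fun s hs => ?_
    have hc := (hcd.continuousAt (ho.mem_nhds (show (x₀, s) ∈ U ×ˢ Set.univ from ⟨hx₀, trivial⟩))).norm
    exact hc.eventually (gt_mem_nhds (lt_of_le_of_lt (hM s hs) (lt_add_one M)))
  refine intervalIntegral.hasFDerivAt_integral_of_dominated_of_fderiv_le (𝕜 := ℝ)
    (s := {x | x ∈ U ∧ ∀ s ∈ Set.Icc (0 : ℝ) 1,
      ‖(fderiv ℝ f (x, s)).comp (ContinuousLinearMap.inl ℝ E ℝ)‖ < M + 1})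
    (F := fun x s => f (x, s))
    (F' := fun x s => (fderiv ℝ f (x, s)).comp (ContinuousLinearMap.inl ℝ E ℝ))
    (bound := fun _ => M + 1) ?_ ?_ ?_ ?_ ?_ ?_ ?_
  · exact Filter.inter_mem (hU.mem_nhds hx₀) hnear
  · filter_upwards [hU.mem_nhds hx₀] with x hx
    exact (hline x hx).aestronglyMeasurable
  · exact (hline x₀ hx₀).intervalIntegrable _ _
  · exact hline'.aestronglyMeasurable
  · refine Filter.Eventually.of_forall fun s hs x hx => ?_
    rw [Set.uIoc_of_le zero_le_one] at hs
    exact (hx.2 s ⟨hs.1.le, hs.2⟩).le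
  · exact intervalIntegrable_const
  · exact Filter.Eventually.of_forall fun s _ x hx => hslice x hx.1 s

theorem contDiff_integral {f : E × ℝ → F} (hf : ContDiff ℝ ∞ f) :
    ContDiff ℝ ∞ fun x => ∫ s in (0 : ℝ)..1, f (x, s) := by
  have key : ∀ (n : ℕ) (F : Type u) [NormedAddCommGroup F] [NormedSpace ℝ F] (f : E × ℝ → F),
      ContDiff ℝ n f → ContDiff ℝ n fun x => ∫ s in (0 : ℝ)..1, f (x, s) := by
    intro n
    induction n with
    | zero =>
      intro F _ _ f hf
      rw [Nat.cast_zero, contDiff_zero] at hf ⊢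
      exact intervalIntegral.continuous_parametric_intervalIntegral_of_continuous'
        (f := fun x s => f (x, s)) hf 0 1
    | succ n ih =>
      intro F _ _ f hf
      have h1 : ContDiff ℝ 1 f := hf.of_le (by
        rw [Nat.cast_add, Nat.cast_one]; exact le_add_self)
      have hd : ∀ x, HasFDerivAt (fun x => ∫ s in (0 : ℝ)..1, f (x, s))
          (∫ s in (0 : ℝ)..1, (fderiv ℝ f (x, s)).comp (ContinuousLinearMap.inl ℝ E ℝ)) x :=
        fun x => hasFDerivAt_integral_of_contDiffOn isOpen_univ h1.contDiffOn (Set.mem_univ x)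
      rw [Nat.cast_add, Nat.cast_one] at hf ⊢
      rw [contDiff_succ_iff_fderiv]
      refine ⟨fun x => (hd x).differentiableAt, by simp, ?_⟩
      rw [funext fun x => (hd x).fderiv]
      exact ih _ (fun p => (fderiv ℝ f p).comp (ContinuousLinearMap.inl ℝ E ℝ))
        ((hf.fderiv_right le_rfl).clm_comp contDiff_const)
  rw [contDiff_infty] at hf ⊢
  exact fun n => key n F f (hf n)

end ParametricIntegral

/-! ### Poisson structures with trivial symplectic foliation -/

/-- A regular Poisson structure on `V` together with a diffeomorphism `param : C × Y ≅ V`, with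
inverse `(cas, leaf)`, whose slices `{c} × Y` are the symplectic leaves. The bivector is given by
the map `sharp` from covectors to vectors, `ξ ↦ P ξ`. -/
structure FoliatedPoisson (V C Y : Type) [NormedAddCommGroup V] [NormedSpace ℝ V]
    [NormedAddCommGroup C] [NormedSpace ℝ C] [NormedAddCommGroup Y] [NormedSpace ℝ Y] where
  sharp : V → (V →L[ℝ] ℝ) →L[ℝ] V
  cas : V → C
  leaf : V → Y
  param : C × Y → V
  contDiff_sharp : ContDiff ℝ ∞ sharp
  contDiff_cas : ContDiff ℝ ∞ cas
  contDiff_leaf : ContDiff ℝ ∞ leaf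
  contDiff_param : ContDiff ℝ ∞ param
  cas_param : ∀ z, cas (param z) = z.1
  leaf_param : ∀ z, leaf (param z) = z.2
  param_coord : ∀ x, param (cas x, leaf x) = x
  antisymm : ∀ (x : V) (ξ η : V →L[ℝ] ℝ), ξ (sharp x η) = - η (sharp x ξ)
  jacobi : ∀ (x : V) (ξ η ζ : V →L[ℝ] ℝ),
    ξ (fderiv ℝ sharp x (sharp x ζ) η) + η (fderiv ℝ sharp x (sharp x ξ) ζ)
    + ζ (fderiv ℝ sharp x (sharp x η) ξ) = 0
  exists_sharp_iff : ∀ x v, (∃ ξ, sharp x ξ = v) ↔ fderiv ℝ cas x v = 0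

theorem eq_of_forall_dual_eq {V : Type*} [NormedAddCommGroup V] [NormedSpace ℝ V] {u v : V}
    (h : ∀ ξ : V →L[ℝ] ℝ, ξ u = ξ v) : u = v := by
  rw [← sub_eq_zero, SeparatingDual.eq_zero_iff_forall_dual_eq_zero (R := ℝ)]
  intro ξ
  rw [map_sub, h, sub_self]

namespace FoliatedPoisson

variable {V C Y : Type} [NormedAddCommGroup V] [NormedSpace ℝ V]
    [NormedAddCommGroup C] [NormedSpace ℝ C] [NormedAddCommGroup Y] [NormedSpace ℝ Y]
    (G : FoliatedPoisson V C Y)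

theorem hasFDerivAt_sharp (x : V) : HasFDerivAt G.sharp (fderiv ℝ G.sharp x) x :=
  (G.contDiff_sharp.differentiable (by simp) x).hasFDerivAt

theorem hasFDerivAt_cas (x : V) : HasFDerivAt G.cas (fderiv ℝ G.cas x) x :=
  (G.contDiff_cas.differentiable (by simp) x).hasFDerivAt

theorem hasFDerivAt_leaf (x : V) : HasFDerivAt G.leaf (fderiv ℝ G.leaf x) x :=
  (G.contDiff_leaf.differentiable (by simp) x).hasFDerivAt

theorem hasFDerivAt_param (z : C × Y) : HasFDerivAt G.param (fderiv ℝ G.param z) z :=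
  (G.contDiff_param.differentiable (by simp) z).hasFDerivAt

theorem hasFDerivAt_fderiv {E F : Type*} [NormedAddCommGroup E] [NormedSpace ℝ E]
    [NormedAddCommGroup F] [NormedSpace ℝ F] {f : E → F} (hf : ContDiff ℝ ∞ f) (x : E) :
    HasFDerivAt (fderiv ℝ f) (fderiv ℝ (fderiv ℝ f) x) x :=
  ((hf.fderiv_right (m := ∞) (by simp)).differentiable (by simp) x).hasFDerivAt

theorem fderiv_fderiv_symm {E F : Type*} [NormedAddCommGroup E] [NormedSpace ℝ E]
    [NormedAddCommGroup F] [NormedSpace ℝ F] {f : E → F} (hf : ContDiff ℝ ∞ f) (x u v : E) :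
    fderiv ℝ (fderiv ℝ f) x u v = fderiv ℝ (fderiv ℝ f) x v u :=
  (hf.contDiffAt.isSymmSndFDerivAt (by simpa using two_le_infty)).eq u v

theorem fderiv_cas_param (z w : C × Y) :
    fderiv ℝ G.cas (G.param z) (fderiv ℝ G.param z w) = w.1 := by
  have h1 := (G.hasFDerivAt_cas (G.param z)).comp z (G.hasFDerivAt_param z)
  have h2 : HasFDerivAt (G.cas ∘ G.param) (ContinuousLinearMap.fst ℝ C Y) z :=
    hasFDerivAt_fst.congr_of_eventuallyEq (Filter.Eventually.of_forall G.cas_param)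
  exact DFunLike.congr_fun (h1.unique h2) w

theorem fderiv_leaf_param (z w : C × Y) :
    fderiv ℝ G.leaf (G.param z) (fderiv ℝ G.param z w) = w.2 := by
  have h1 := (G.hasFDerivAt_leaf (G.param z)).comp z (G.hasFDerivAt_param z)
  have h2 : HasFDerivAt (G.leaf ∘ G.param) (ContinuousLinearMap.snd ℝ C Y) z :=
    hasFDerivAt_snd.congr_of_eventuallyEq (Filter.Eventually.of_forall G.leaf_param)
  exact DFunLike.congr_fun (h1.unique h2) w

theorem fderiv_param_coord (x v : V) :
    fderiv ℝ G.param (G.cas x, G.leaf x) (fderiv ℝ G.cas x v, fderiv ℝ G.leaf x v) = v := by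
  have h1 := (G.hasFDerivAt_param (G.cas x, G.leaf x)).comp x
    ((G.hasFDerivAt_cas x).prodMk (G.hasFDerivAt_leaf x))
  have h2 : HasFDerivAt (G.param ∘ fun x => (G.cas x, G.leaf x)) (ContinuousLinearMap.id ℝ V) x :=
    (hasFDerivAt_id x).congr_of_eventuallyEq (Filter.Eventually.of_forall G.param_coord)
  exact DFunLike.congr_fun (h1.unique h2) v

theorem coord_param (z : C × Y) : (G.cas (G.param z), G.leaf (G.param z)) = z :=
  Prod.ext (G.cas_param z) (G.leaf_param z)

theorem fderiv_cas_sharp (x : V) (ξ : V →L[ℝ] ℝ) : fderiv ℝ G.cas x (G.sharp x ξ) = 0 :=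
  (G.exists_sharp_iff x _).1 ⟨ξ, rfl⟩

/-- The differentials of Casimir functions span the kernel of `sharp`; this is one inclusion. -/
theorem sharp_comp_fderiv_cas (x : V) (b : C →L[ℝ] ℝ) :
    G.sharp x (b.comp (fderiv ℝ G.cas x)) = 0 := by
  refine eq_of_forall_dual_eq fun ξ => ?_
  rw [G.antisymm, ContinuousLinearMap.comp_apply, G.fderiv_cas_sharp]
  simp

theorem sharp_fderiv_antisymm (x w : V) (ξ η : V →L[ℝ] ℝ) :
    ξ (fderiv ℝ G.sharp x w η) = - η (fderiv ℝ G.sharp x w ξ) := by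
  have h1 : ∀ ξ η : V →L[ℝ] ℝ, HasFDerivAt (fun x => ξ (G.sharp x η))
      (ξ.comp ((fderiv ℝ G.sharp x).flip η)) x := fun ξ η => by
    have := ξ.hasFDerivAt.comp x ((G.hasFDerivAt_sharp x).clm_apply (hasFDerivAt_const η x))
    refine this.congr_fderiv ?_
    ext v; simp
  have h2 := (h1 ξ η).unique (((h1 η ξ).neg).congr_of_eventuallyEq
    (Filter.Eventually.of_forall fun x => G.antisymm x ξ η))
  exact DFunLike.congr_fun h2 w

/-- The leaf bivector: the Poisson tensor of the leaf through `param z` in the coordinate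
`leaf`, as a map from covectors to vectors of `Y`. -/
def bivec (z : C × Y) : (Y →L[ℝ] ℝ) →L[ℝ] Y :=
  (fderiv ℝ G.leaf (G.param z)).comp ((G.sharp (G.param z)).comp
    ((ContinuousLinearMap.compL ℝ V Y ℝ).flip (fderiv ℝ G.leaf (G.param z))))

theorem bivec_apply (z : C × Y) (η : Y →L[ℝ] ℝ) :
    G.bivec z η = fderiv ℝ G.leaf (G.param z)
      (G.sharp (G.param z) (η.comp (fderiv ℝ G.leaf (G.param z)))) := rfl

/-- The restriction of a covector at `param z` to the leaf directions. -/
def restrict (z : C × Y) (ξ : V →L[ℝ] ℝ) : Y →L[ℝ] ℝ :=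
  ξ.comp ((fderiv ℝ G.param z).comp (ContinuousLinearMap.inr ℝ C Y))

theorem restrict_apply (z : C × Y) (ξ : V →L[ℝ] ℝ) (w : Y) :
    G.restrict z ξ w = ξ (fderiv ℝ G.param z (0, w)) := rfl

theorem contDiff_fderiv_leaf_param :
    ContDiff ℝ ∞ fun z => fderiv ℝ G.leaf (G.param z) :=
  (G.contDiff_leaf.fderiv_right (m := ∞) (by simp)).comp G.contDiff_param

theorem contDiff_bivec : ContDiff ℝ ∞ G.bivec := by
  refine G.contDiff_fderiv_leaf_param.clm_comp
    ((G.contDiff_sharp.comp G.contDiff_param).clm_comp ?_)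
  exact (ContinuousLinearMap.contDiff (E := V →L[ℝ] Y) (F := (Y →L[ℝ] ℝ) →L[ℝ] (V →L[ℝ] ℝ))
    (ContinuousLinearMap.compL ℝ V Y ℝ).flip).comp G.contDiff_fderiv_leaf_param

/-- The Poisson tensor of `V` is that of the leaf. -/
theorem sharp_param (z : C × Y) (ξ : V →L[ℝ] ℝ) :
    G.sharp (G.param z) ξ = fderiv ℝ G.param z (0, G.bivec z (G.restrict z ξ)) := by
  have h1 := G.fderiv_param_coord (G.param z) (G.sharp (G.param z) ξ)
  rw [G.coord_param, G.fderiv_cas_sharp] at h1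
  rw [← h1, G.bivec_apply]
  congr 3
  have h2 : ξ = (G.restrict z ξ).comp (fderiv ℝ G.leaf (G.param z))
      + (ξ.comp ((fderiv ℝ G.param z).comp (ContinuousLinearMap.inl ℝ C Y))).comp
        (fderiv ℝ G.cas (G.param z)) := by
    ext v
    have h3 := G.fderiv_param_coord (G.param z) v
    rw [G.coord_param] at h3
    conv_lhs => rw [← h3]
    simp only [restrict, ContinuousLinearMap.comp_apply, add_apply, ContinuousLinearMap.inr_apply,
      ContinuousLinearMap.inl_apply]
    rw [← map_add, ← map_add]
    simp
  conv_lhs => rw [h2, map_add, G.sharp_comp_fderiv_cas, add_zero]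

theorem restrict_comp_leaf (z : C × Y) (η : Y →L[ℝ] ℝ) :
    G.restrict z (η.comp (fderiv ℝ G.leaf (G.param z))) = η := by
  ext w
  rw [restrict_apply, ContinuousLinearMap.comp_apply, G.fderiv_leaf_param]

theorem sharp_param_comp_leaf (z : C × Y) (η : Y →L[ℝ] ℝ) :
    G.sharp (G.param z) (η.comp (fderiv ℝ G.leaf (G.param z)))
      = fderiv ℝ G.param z (0, G.bivec z η) := by
  rw [G.sharp_param, G.restrict_comp_leaf]

theorem bivec_antisymm (z : C × Y) (ξ η : Y →L[ℝ] ℝ) :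
    ξ (G.bivec z η) = - η (G.bivec z ξ) :=
  G.antisymm (G.param z) (ξ.comp (fderiv ℝ G.leaf (G.param z)))
    (η.comp (fderiv ℝ G.leaf (G.param z)))

theorem bivec_injective (z : C × Y) : Function.Injective (G.bivec z) := by
  rw [injective_iff_map_eq_zero]
  intro ξ hξ
  have h0 : G.sharp (G.param z) (ξ.comp (fderiv ℝ G.leaf (G.param z))) = 0 := by
    rw [G.sharp_param_comp_leaf, hξ]
    exact map_zero _
  ext w
  obtain ⟨ζ, hζ⟩ := (G.exists_sharp_iff (G.param z) (fderiv ℝ G.param z (0, w))).2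
    (by rw [G.fderiv_cas_param])
  have h1 := G.antisymm (G.param z) (ξ.comp (fderiv ℝ G.leaf (G.param z))) ζ
  rw [h0, hζ, ContinuousLinearMap.comp_apply, G.fderiv_leaf_param, map_zero, neg_zero] at h1
  exact h1

theorem hasFDerivAt_bivec (z : C × Y) : HasFDerivAt G.bivec (fderiv ℝ G.bivec z) z :=
  (G.contDiff_bivec.differentiable (by simp) z).hasFDerivAt

theorem fderiv_bivec_antisymm (z w : C × Y) (ξ η : Y →L[ℝ] ℝ) :
    ξ (fderiv ℝ G.bivec z w η) = - η (fderiv ℝ G.bivec z w ξ) := by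
  have h1 : ∀ ξ η : Y →L[ℝ] ℝ, HasFDerivAt (fun z => ξ (G.bivec z η))
      (ξ.comp ((fderiv ℝ G.bivec z).flip η)) z := fun ξ η => by
    have := ξ.hasFDerivAt.comp z ((G.hasFDerivAt_bivec z).clm_apply (hasFDerivAt_const η z))
    refine this.congr_fderiv ?_
    ext v <;> simp
  have h2 := (h1 ξ η).unique (((h1 η ξ).neg).congr_of_eventuallyEq
    (Filter.Eventually.of_forall fun x => G.bivec_antisymm x ξ η))
  exact DFunLike.congr_fun h2 w

/-- The Jacobi identity of the leaf bivector. The Hessians of the coordinate functions cancel in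
the cyclic sum. -/
theorem bivec_jacobi (z : C × Y) (ξ η ζ : Y →L[ℝ] ℝ) :
    ξ (fderiv ℝ G.bivec z (0, G.bivec z ζ) η) + η (fderiv ℝ G.bivec z (0, G.bivec z ξ) ζ)
      + ζ (fderiv ℝ G.bivec z (0, G.bivec z η) ξ) = 0 := by
  set x := G.param z with hx
  set D := fderiv ℝ G.leaf x with hD
  set D2 := fderiv ℝ (fderiv ℝ G.leaf) x with hD2
  have key : ∀ ξ η ζ : Y →L[ℝ] ℝ, ξ (fderiv ℝ G.bivec z (0, G.bivec z ζ) η)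
      = ξ (D2 (G.sharp x (ζ.comp D)) (G.sharp x (η.comp D)))
        + (ξ.comp D) (fderiv ℝ G.sharp x (G.sharp x (ζ.comp D)) (η.comp D))
        - η (D2 (G.sharp x (ζ.comp D)) (G.sharp x (ξ.comp D))) := by
    intro ξ η ζ
    have hp := G.hasFDerivAt_param z
    have hl : HasFDerivAt (fun z => fderiv ℝ G.leaf (G.param z)) (D2.comp (fderiv ℝ G.param z)) z :=
      (hasFDerivAt_fderiv G.contDiff_leaf x).comp z hp
    have hs : HasFDerivAt (fun z => G.sharp (G.param z))
        ((fderiv ℝ G.sharp x).comp (fderiv ℝ G.param z)) z :=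
      HasFDerivAt.comp (g := G.sharp) z (G.hasFDerivAt_sharp x) hp
    have h1 := hl.clm_apply (hs.clm_apply ((hasFDerivAt_const η z).clm_comp hl))
    have h2 := (G.hasFDerivAt_bivec z).clm_apply (hasFDerivAt_const η z)
    have h3 := DFunLike.congr_fun (h2.unique h1) (0, G.bivec z ζ)
    have h4 := G.sharp_param_comp_leaf z ζ
    have h5 := G.antisymm x (ξ.comp D) (η.comp (D2 (G.sharp x (ζ.comp D))))
    simp only [add_apply, ContinuousLinearMap.comp_apply, ContinuousLinearMap.flip_apply,
      zero_apply, map_zero, zero_add, ContinuousLinearMap.compL_apply,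
      ← h4, add_zero] at h3
    rw [h3]
    simp only [map_add]
    simp only [ContinuousLinearMap.comp_apply] at h5 ⊢
    linarith
  have hsym : ∀ (ξ : Y →L[ℝ] ℝ) u v, ξ (D2 u v) = ξ (D2 v u) := fun ξ u v => by
    rw [hD2, fderiv_fderiv_symm G.contDiff_leaf]
  have hj := G.jacobi x (ξ.comp D) (η.comp D) (ζ.comp D)
  rw [key ξ η ζ, key η ζ ξ, key ζ ξ η]
  have e1 := hsym ξ (G.sharp x (ζ.comp D)) (G.sharp x (η.comp D))
  have e2 := hsym η (G.sharp x (ζ.comp D)) (G.sharp x (ξ.comp D))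
  have e3 := hsym ζ (G.sharp x (ξ.comp D)) (G.sharp x (η.comp D))
  linarith

/-! ### The symplectic forms of the leaves and a primitive of them -/

variable [FiniteDimensional ℝ Y]

/-- The symplectic form of the leaf, as the inverse of the leaf bivector. -/
def leafForm (z : C × Y) : Y →L[ℝ] Y →L[ℝ] ℝ := (G.bivec z).inverse

theorem exists_equiv_bivec (z : C × Y) :
    ∃ e : (Y →L[ℝ] ℝ) ≃L[ℝ] Y, (e : (Y →L[ℝ] ℝ) →L[ℝ] Y) = G.bivec z := by
  have hd : Module.finrank ℝ (Y →L[ℝ] ℝ) = Module.finrank ℝ Y := by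
    rw [← (LinearMap.toContinuousLinearMap (𝕜 := ℝ) (E := Y) (F' := ℝ)).finrank_eq]
    exact Subspace.dual_finrank_eq
  let e := LinearEquiv.ofInjectiveOfFinrankEq (G.bivec z : (Y →L[ℝ] ℝ) →ₗ[ℝ] Y)
    (G.bivec_injective z) hd
  refine ⟨e.toContinuousLinearEquiv, ?_⟩
  ext ξ
  rfl

theorem bivec_leafForm (z : C × Y) (u : Y) : G.bivec z (G.leafForm z u) = u := by
  obtain ⟨e, he⟩ := G.exists_equiv_bivec z
  rw [leafForm, ← he, ContinuousLinearMap.inverse_equiv]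
  exact e.apply_symm_apply u

theorem leafForm_bivec (z : C × Y) (ξ : Y →L[ℝ] ℝ) : G.leafForm z (G.bivec z ξ) = ξ :=
  G.bivec_injective z (G.bivec_leafForm z _)

theorem contDiff_leafForm : ContDiff ℝ ∞ G.leafForm := by
  rw [contDiff_iff_contDiffAt]
  intro z
  obtain ⟨e, he⟩ := G.exists_equiv_bivec z
  have h1 := contDiffAt_map_inverse (n := ∞) e
  rw [he] at h1
  exact h1.comp z G.contDiff_bivec.contDiffAt

theorem hasFDerivAt_leafForm (z : C × Y) : HasFDerivAt G.leafForm (fderiv ℝ G.leafForm z) z :=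
  (G.contDiff_leafForm.differentiable (by simp) z).hasFDerivAt

theorem leafForm_antisymm (z : C × Y) (u v : Y) : G.leafForm z u v = - G.leafForm z v u := by
  have h := G.bivec_antisymm z (G.leafForm z u) (G.leafForm z v)
  rwa [G.bivec_leafForm, G.bivec_leafForm] at h

theorem fderiv_leafForm_bivec (z w : C × Y) (ξ η : Y →L[ℝ] ℝ) :
    fderiv ℝ G.leafForm z w (G.bivec z ξ) (G.bivec z η) = η (fderiv ℝ G.bivec z w ξ) := by
  set u := G.bivec z ξ
  have h1 := (G.hasFDerivAt_bivec z).clm_apply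
    ((G.hasFDerivAt_leafForm z).clm_apply (hasFDerivAt_const u z))
  have h2 := h1.unique ((hasFDerivAt_const u z).congr_of_eventuallyEq
    (Filter.Eventually.of_forall fun z => G.bivec_leafForm z u))
  have h3 := DFunLike.congr_fun h2 w
  simp only [add_apply, ContinuousLinearMap.comp_apply, ContinuousLinearMap.flip_apply,
      zero_apply, map_zero, zero_add] at h3
  have h4 : G.leafForm z u = ξ := G.leafForm_bivec z ξ
  rw [h4] at h3
  have h5 := G.bivec_antisymm z η (fderiv ℝ G.leafForm z w u)
  have h6 := congrArg η h3
  simp only [map_add, map_zero] at h6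
  linarith

/-- The leaf forms are closed along the leaves: this is the Jacobi identity. -/
theorem leafForm_closed (z : C × Y) (u v w : Y) :
    fderiv ℝ G.leafForm z (0, u) v w + fderiv ℝ G.leafForm z (0, v) w u
      + fderiv ℝ G.leafForm z (0, w) u v = 0 := by
  rw [← G.bivec_leafForm z u, ← G.bivec_leafForm z v, ← G.bivec_leafForm z w]
  simp only [G.fderiv_leafForm_bivec]
  have := G.bivec_jacobi z (G.leafForm z u) (G.leafForm z w) (G.leafForm z v)
  linarith

theorem fderiv_leafForm_antisymm (z w : C × Y) (u v : Y) :
    fderiv ℝ G.leafForm z w u v = - fderiv ℝ G.leafForm z w v u := by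
  rw [← G.bivec_leafForm z u, ← G.bivec_leafForm z v, G.fderiv_leafForm_bivec,
    G.fderiv_leafForm_bivec]
  exact G.fderiv_bivec_antisymm _ _ _ _

/-- The primitive of the leaf forms given by the homotopy operator of the Poincaré lemma for the
contraction of the leaf to the origin of its coordinate. -/
def potential (z : C × Y) : Y →L[ℝ] ℝ :=
  ∫ s in (0 : ℝ)..1, s • G.leafForm (z.1, s • z.2) z.2

theorem contDiff_potential_integrand : ContDiff ℝ ∞ fun p : (C × Y) × ℝ =>
    p.2 • G.leafForm (p.1.1, p.2 • p.1.2) p.1.2 := by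
  have h1 : ContDiff ℝ ∞ fun p : (C × Y) × ℝ => (p.1.1, p.2 • p.1.2) := by fun_prop
  exact contDiff_snd.smul ((G.contDiff_leafForm.comp h1).clm_apply (by fun_prop))

theorem contDiff_potential : ContDiff ℝ ∞ G.potential :=
  contDiff_integral G.contDiff_potential_integrand

theorem fderiv_potential (z : C × Y) (u v : Y) :
    fderiv ℝ G.potential z (0, u) v - fderiv ℝ G.potential z (0, v) u = G.leafForm z u v := by
  obtain ⟨c, y⟩ := z
  set f : (C × Y) × ℝ → (Y →L[ℝ] ℝ) := fun p => p.2 • G.leafForm (p.1.1, p.2 • p.1.2) p.1.2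
    with hf
  have hd := (hasFDerivAt_integral_of_contDiffOn (f := f) isOpen_univ
    (G.contDiff_potential_integrand.of_le (by simp)).contDiffOn (Set.mem_univ (c, y))).fderiv
  have hcont : Continuous fun s : ℝ =>
      (fderiv ℝ f ((c, y), s)).comp (ContinuousLinearMap.inl ℝ (C × Y) ℝ) :=
    ((G.contDiff_potential_integrand.continuous_fderiv (by simp)).comp
      (by fun_prop : Continuous fun s : ℝ => ((c, y), s))).clm_comp continuous_const
  -- the derivative of the integrand along the leaf
  have hint : ∀ (s : ℝ) (u v : Y), fderiv ℝ f ((c, y), s) ((0, u), 0) v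
      = s * (s * fderiv ℝ G.leafForm (c, s • y) (0, u) y v + G.leafForm (c, s • y) u v) := by
    intro s u v
    have h1 : HasFDerivAt (fun z : C × Y => (z.1, s • z.2))
        ((ContinuousLinearMap.fst ℝ C Y).prod (s • ContinuousLinearMap.snd ℝ C Y)) (c, y) :=
      hasFDerivAt_fst.prodMk (hasFDerivAt_snd.const_smul s)
    have h2 := ((HasFDerivAt.comp (g := G.leafForm) (c, y) (G.hasFDerivAt_leafForm (c, s • y)) h1).clm_apply
      (hasFDerivAt_snd (p := (c, y)))).const_smul s
    have h3 : HasFDerivAt f (fderiv ℝ f ((c, y), s)) ((c, y), s) :=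
      (G.contDiff_potential_integrand.differentiable (by simp) _).hasFDerivAt
    have h4 := HasFDerivAt.comp (g := f) (f := fun z : C × Y => (z, s)) (c, y) h3
      (hasFDerivAt_prodMk_left (𝕜 := ℝ) (c, y) s)
    have h5 := congrArg (fun L : Y →L[ℝ] ℝ => L v) (DFunLike.congr_fun (h4.unique h2) (0, u))
    have e : ((0 : C), s • u) = s • ((0 : C), u) := by simp
    simp only [ContinuousLinearMap.comp_apply, ContinuousLinearMap.inl_apply] at h5
    rw [h5]
    simp
    rw [e, map_smul]
    simp
    ring
  have hev : ∀ u v : Y, fderiv ℝ G.potential (c, y) (0, u) v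
      = ∫ s in (0 : ℝ)..1, fderiv ℝ f ((c, y), s) ((0, u), 0) v := by
    intro u v
    have h1 : fderiv ℝ G.potential (c, y) = ∫ s in (0 : ℝ)..1,
      (fderiv ℝ f ((c, y), s)).comp (ContinuousLinearMap.inl ℝ (C × Y) ℝ) := hd
    rw [h1, ContinuousLinearMap.intervalIntegral_apply (hcont.intervalIntegrable _ _),
      ContinuousLinearMap.intervalIntegral_apply
        ((hcont.clm_apply continuous_const).intervalIntegrable _ _)]
    rfl
  have hc2 : ∀ u v : Y, Continuous fun s : ℝ => fderiv ℝ f ((c, y), s) ((0, u), 0) v := fun u v =>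
    (hcont.clm_apply (continuous_const (y := ((0 : C), u)))).clm_apply continuous_const
  rw [hev, hev, ← intervalIntegral.integral_sub ((hc2 u v).intervalIntegrable _ _)
    ((hc2 v u).intervalIntegrable _ _)]
  -- the difference is the derivative of `s² ω(u, v)` at the point `s y`
  have hprim : ∀ s : ℝ, HasDerivAt (fun s : ℝ => s ^ 2 * G.leafForm (c, s • y) u v)
      (fderiv ℝ f ((c, y), s) ((0, u), 0) v - fderiv ℝ f ((c, y), s) ((0, v), 0) u) s := by
    intro s
    have h1 : HasDerivAt (fun s : ℝ => (c, s • y)) ((0 : C), y) s := by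
      have := (hasDerivAt_const s c).prodMk ((hasDerivAt_id s).smul_const y)
      simpa using this
    have h2 := HasFDerivAt.comp_hasDerivAt (l := G.leafForm) s
      (G.hasFDerivAt_leafForm (c, s • y)) h1
    have h3 := (h2.clm_apply (hasDerivAt_const s u)).clm_apply (hasDerivAt_const s v)
    have h4 := (hasDerivAt_pow 2 s).mul h3
    refine h4.congr_deriv ?_
    rw [hint, hint]
    have e1 := G.leafForm_antisymm (c, s • y) u v
    have e2 := G.leafForm_closed (c, s • y) u y v
    have e3 := G.fderiv_leafForm_antisymm (c, s • y) (0, y) u v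
    have e4 := G.fderiv_leafForm_antisymm (c, s • y) (0, v) u y
    simp
    linear_combination s * e1 - s ^ 2 * e2 + s ^ 2 * e3 + s ^ 2 * e4
  rw [intervalIntegral.integral_eq_sub_of_hasDerivAt (fun s _ => hprim s)
    (((hc2 u v).sub (hc2 v u)).intervalIntegrable _ _)]
  simp

end FoliatedPoisson

/-- The statement `ContinuousLinearMap.contDiff`, in a form in which the coercion to functions
elaborates also between spaces of linear maps. -/
theorem contDiff_clm {E F : Type*} [NormedAddCommGroup E] [NormedSpace ℝ E]
    [NormedAddCommGroup F] [NormedSpace ℝ F] (L : E →L[ℝ] F) : ContDiff ℝ ∞ fun x => L x :=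
  L.contDiff

namespace FoliatedPoisson

variable {V C Y : Type} [NormedAddCommGroup V] [NormedSpace ℝ V]
    [NormedAddCommGroup C] [NormedSpace ℝ C] [NormedAddCommGroup Y] [NormedSpace ℝ Y]
    (G : FoliatedPoisson V C Y)

/-! ### Directions transverse to the leaves -/

/-- The vector fields `∂/∂X^I` of the adapted coordinates. -/
def casDir (x : V) : C →L[ℝ] V :=
  (fderiv ℝ G.param (G.cas x, G.leaf x)).comp (ContinuousLinearMap.inl ℝ C Y)

theorem casDir_apply (x : V) (a : C) :
    G.casDir x a = fderiv ℝ G.param (G.cas x, G.leaf x) (a, 0) := rfl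

theorem contDiff_coord : ContDiff ℝ ∞ fun x => (G.cas x, G.leaf x) :=
  G.contDiff_cas.prodMk G.contDiff_leaf

theorem contDiff_casDir : ContDiff ℝ ∞ G.casDir :=
  ((G.contDiff_param.fderiv_right (m := ∞) (by simp)).comp G.contDiff_coord).clm_comp contDiff_const

theorem hasFDerivAt_coord (x : V) : HasFDerivAt (fun x => (G.cas x, G.leaf x))
    ((fderiv ℝ G.cas x).prod (fderiv ℝ G.leaf x)) x :=
  (G.hasFDerivAt_cas x).prodMk (G.hasFDerivAt_leaf x)

theorem exists_param_eq (x : V) : ∃ z, G.param z = x := ⟨_, G.param_coord x⟩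

theorem fderiv_coord_sharp (z : C × Y) (ξ : V →L[ℝ] ℝ) :
    (fderiv ℝ G.cas (G.param z) (G.sharp (G.param z) ξ),
      fderiv ℝ G.leaf (G.param z) (G.sharp (G.param z) ξ)) = (0, G.bivec z (G.restrict z ξ)) := by
  rw [G.fderiv_cas_sharp, G.sharp_param, G.fderiv_leaf_param]

theorem fderiv_casDir (x v : V) (a : C) : fderiv ℝ G.casDir x v a
    = fderiv ℝ (fderiv ℝ G.param) (G.cas x, G.leaf x) (fderiv ℝ G.cas x v, fderiv ℝ G.leaf x v)
        (a, 0) := by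
  have h1 := HasFDerivAt.comp (g := fderiv ℝ G.param) x
    (hasFDerivAt_fderiv G.contDiff_param (G.cas x, G.leaf x)) (G.hasFDerivAt_coord x)
  have h2 : HasFDerivAt G.casDir _ x :=
    h1.clm_comp (hasFDerivAt_const (ContinuousLinearMap.inl ℝ C Y) x)
  rw [h2.fderiv]
  simp

/-- The Lie derivative of the Poisson tensor along a transverse coordinate field is the
derivative of the leaf bivector along that coordinate. -/
theorem lie_casDir_sharp (z : C × Y) (a : C) (ξ η : V →L[ℝ] ℝ) :
    ξ (fderiv ℝ G.sharp (G.param z) (G.casDir (G.param z) a) η)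
      + η (fderiv ℝ G.casDir (G.param z) (G.sharp (G.param z) ξ) a)
      - ξ (fderiv ℝ G.casDir (G.param z) (G.sharp (G.param z) η) a)
    = G.restrict z ξ (fderiv ℝ G.bivec z (a, 0) (G.restrict z η)) := by
  rw [G.fderiv_casDir, G.fderiv_casDir, G.fderiv_coord_sharp, G.fderiv_coord_sharp, casDir_apply,
    G.coord_param]
  set D2 := fderiv ℝ (fderiv ℝ G.param) z with hD2
  have hP : HasFDerivAt (fun z => (fderiv ℝ G.param z).comp (ContinuousLinearMap.inr ℝ C Y)) _ z :=
    (hasFDerivAt_fderiv G.contDiff_param z).clm_comp (hasFDerivAt_const _ z)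
  have h1 := hP.clm_apply ((G.hasFDerivAt_bivec z).clm_apply ((hasFDerivAt_const η z).clm_comp hP))
  have h2 := (HasFDerivAt.comp (g := G.sharp) z (G.hasFDerivAt_sharp (G.param z))
    (G.hasFDerivAt_param z)).clm_apply (hasFDerivAt_const η z)
  have h3 := h2.unique (h1.congr_of_eventuallyEq
    (Filter.Eventually.of_forall fun z => G.sharp_param z η))
  have h4 := congrArg ξ (DFunLike.congr_fun h3 (a, 0))
  have h5 := G.bivec_antisymm z (G.restrict z ξ)
    (η.comp ((D2 (a, 0)).comp (ContinuousLinearMap.inr ℝ C Y)))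
  simp only [add_apply, ContinuousLinearMap.comp_apply, ContinuousLinearMap.flip_apply,
    zero_apply, map_zero, zero_add, ContinuousLinearMap.compL_apply, add_zero, map_add,
    ContinuousLinearMap.inr_apply] at h4
  simp only [restrict, ContinuousLinearMap.comp_apply, ContinuousLinearMap.inr_apply] at h4 h5 ⊢
  rw [hD2, fderiv_fderiv_symm G.contDiff_param z _ (a, 0),
    fderiv_fderiv_symm G.contDiff_param z _ (a, 0), ← hD2]
  refine (congrArg (fun r => r + _ - _) h4).trans ?_
  linarith

variable [FiniteDimensional ℝ Y]

/-- The one-forms `-∂_I θ` on `V`, where `θ` is the primitive of the leaf forms. Adding their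
pull-backs to the transverse components `A_I` of a solution makes these closed. -/
def twist (x : V) : V →L[ℝ] C →L[ℝ] ℝ :=
  -(((fderiv ℝ G.potential (G.cas x, G.leaf x)).comp (ContinuousLinearMap.inl ℝ C Y)).flip.comp
    (fderiv ℝ G.leaf x))

omit [FiniteDimensional ℝ Y] in
theorem twist_apply (x v : V) (a : C) : G.twist x v a
    = -(fderiv ℝ G.potential (G.cas x, G.leaf x) (a, 0) (fderiv ℝ G.leaf x v)) := rfl

theorem contDiff_twist : ContDiff ℝ ∞ G.twist := by
  have h1 : ContDiff ℝ ∞ fun x => (fderiv ℝ G.potential (G.cas x, G.leaf x)).comp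
      (ContinuousLinearMap.inl ℝ C Y) :=
    ((G.contDiff_potential.fderiv_right (m := ∞) (by simp)).comp G.contDiff_coord).clm_comp
      contDiff_const
  have h := contDiff_clm (E := C →L[ℝ] Y →L[ℝ] ℝ) (F := Y →L[ℝ] C →L[ℝ] ℝ)
    ((ContinuousLinearMap.flipₗᵢ ℝ C Y ℝ).toContinuousLinearEquiv :
      (C →L[ℝ] Y →L[ℝ] ℝ) →L[ℝ] (Y →L[ℝ] C →L[ℝ] ℝ))
  have h2 := h.comp h1
  exact (h2.clm_comp (G.contDiff_leaf.fderiv_right (m := ∞) (by simp))).neg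

theorem hasFDerivAt_twist (x : V) : HasFDerivAt G.twist (fderiv ℝ G.twist x) x :=
  (G.contDiff_twist.differentiable (by simp) x).hasFDerivAt

theorem fderiv_twist (x u v : V) (a : C) : fderiv ℝ G.twist x u v a
    = -(fderiv ℝ (fderiv ℝ G.potential) (G.cas x, G.leaf x)
          (fderiv ℝ G.cas x u, fderiv ℝ G.leaf x u) (a, 0) (fderiv ℝ G.leaf x v)
        + fderiv ℝ G.potential (G.cas x, G.leaf x) (a, 0)
          (fderiv ℝ (fderiv ℝ G.leaf) x u v)) := by
  have h1 := ((G.hasFDerivAt_twist x).clm_apply (hasFDerivAt_const v x)).clm_apply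
    (hasFDerivAt_const a x)
  have h2 := ((HasFDerivAt.comp (g := fderiv ℝ G.potential) x
    (hasFDerivAt_fderiv G.contDiff_potential (G.cas x, G.leaf x))
    (G.hasFDerivAt_coord x)).clm_apply (hasFDerivAt_const ((a, 0) : C × Y) x)).clm_apply
    ((hasFDerivAt_fderiv G.contDiff_leaf x).clm_apply (hasFDerivAt_const v x))
  have h3 := DFunLike.congr_fun (h1.unique (h2.neg.congr_of_eventuallyEq
    (Filter.Eventually.of_forall fun x => G.twist_apply x v a))) u
  simp at h3
  rw [h3]
  ring

/-- Along the leaves, the forms `twist` are primitives of the Lie derivative of the Poisson tensor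
along the transverse coordinate fields. -/
theorem lie_casDir (x : V) (a : C) (ξ η : V →L[ℝ] ℝ) :
    ξ (fderiv ℝ G.sharp x (G.casDir x a) η) + η (fderiv ℝ G.casDir x (G.sharp x ξ) a)
      - ξ (fderiv ℝ G.casDir x (G.sharp x η) a)
    = fderiv ℝ G.twist x (G.sharp x ξ) (G.sharp x η) a
      - fderiv ℝ G.twist x (G.sharp x η) (G.sharp x ξ) a := by
  obtain ⟨z, rfl⟩ := G.exists_param_eq x
  rw [G.lie_casDir_sharp, G.fderiv_twist, G.fderiv_twist, G.fderiv_coord_sharp,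
    G.fderiv_coord_sharp, G.coord_param, fderiv_fderiv_symm G.contDiff_leaf (G.param z) _
    (G.sharp (G.param z) η), fderiv_fderiv_symm G.contDiff_potential z _ (a, 0),
    fderiv_fderiv_symm G.contDiff_potential z _ (a, 0)]
  have hl : ∀ ξ, fderiv ℝ G.leaf (G.param z) (G.sharp (G.param z) ξ)
      = G.bivec z (G.restrict z ξ) := fun ξ => congrArg Prod.snd (G.fderiv_coord_sharp z ξ)
  rw [hl, hl]
  set u := G.bivec z (G.restrict z ξ)
  set v := G.bivec z (G.restrict z η)
  -- differentiate `dθ = ω` in the transverse direction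
  have hp := hasFDerivAt_fderiv G.contDiff_potential z
  have h1 := fun u v : Y => (hp.clm_apply (hasFDerivAt_const ((0, u) : C × Y) z)).clm_apply
    (hasFDerivAt_const v z)
  have h2 := ((G.hasFDerivAt_leafForm z).clm_apply (hasFDerivAt_const u z)).clm_apply
    (hasFDerivAt_const v z)
  have h3 := DFunLike.congr_fun (((h1 u v).sub (h1 v u)).unique (h2.congr_of_eventuallyEq
    (Filter.Eventually.of_forall fun z => G.fderiv_potential z u v))) (a, 0)
  have h4 := G.fderiv_leafForm_bivec z (a, 0) (G.restrict z ξ) (G.restrict z η)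
  have h5 := G.fderiv_bivec_antisymm z (a, 0) (G.restrict z ξ) (G.restrict z η)
  simp at h3
  linarith

/-! ### Covectors with prescribed components -/

/-- The part of a covector that is determined by its image `u` under `sharp`. -/
def leafCovector (x : V) : V →L[ℝ] V →L[ℝ] ℝ :=
  ((ContinuousLinearMap.compL ℝ V Y ℝ).flip (fderiv ℝ G.leaf x)).comp
    ((G.leafForm (G.cas x, G.leaf x)).comp (fderiv ℝ G.leaf x))

omit [FiniteDimensional ℝ Y] in
theorem leafCovector_apply (x u : V) : G.leafCovector x u
    = (G.leafForm (G.cas x, G.leaf x) (fderiv ℝ G.leaf x u)).comp (fderiv ℝ G.leaf x) := rfl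

omit [FiniteDimensional ℝ Y] in
theorem contDiff_precomp {E F W : Type*} [NormedAddCommGroup E] [NormedSpace ℝ E]
    [NormedAddCommGroup F] [NormedSpace ℝ F] [NormedAddCommGroup W] [NormedSpace ℝ W]
    {f : W → E →L[ℝ] F} (hf : ContDiff ℝ ∞ f) :
    ContDiff ℝ ∞ fun w => (ContinuousLinearMap.compL ℝ E F ℝ).flip (f w) := by
  have h := contDiff_clm (E := E →L[ℝ] F) (F := (F →L[ℝ] ℝ) →L[ℝ] (E →L[ℝ] ℝ))
    (ContinuousLinearMap.compL ℝ E F ℝ).flip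
  exact h.comp hf

theorem contDiff_leafCovector : ContDiff ℝ ∞ G.leafCovector := by
  have h := G.contDiff_leaf.fderiv_right (m := ∞) (by simp)
  exact (contDiff_precomp h).clm_comp ((G.contDiff_leafForm.comp G.contDiff_coord).clm_comp h)

/-- The covectors that are combinations of the differentials of the Casimir functions. -/
def casCovector (x : V) : (C →L[ℝ] ℝ) →L[ℝ] V →L[ℝ] ℝ :=
  (ContinuousLinearMap.compL ℝ V C ℝ).flip (fderiv ℝ G.cas x)

omit [FiniteDimensional ℝ Y] in
theorem casCovector_apply (x : V) (b : C →L[ℝ] ℝ) :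
    G.casCovector x b = b.comp (fderiv ℝ G.cas x) := rfl

omit [FiniteDimensional ℝ Y] in
theorem contDiff_casCovector : ContDiff ℝ ∞ G.casCovector :=
  contDiff_precomp (G.contDiff_cas.fderiv_right (m := ∞) (by simp))

theorem sharp_leafCovector {x u : V} (hu : fderiv ℝ G.cas x u = 0) :
    G.sharp x (G.leafCovector x u) = u := by
  obtain ⟨z, rfl⟩ := G.exists_param_eq x
  rw [leafCovector_apply, G.coord_param, G.sharp_param_comp_leaf, G.bivec_leafForm, ← hu]
  have := G.fderiv_param_coord (G.param z) u
  rwa [G.coord_param] at this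

omit [FiniteDimensional ℝ Y] in
theorem sharp_casCovector (x : V) (b : C →L[ℝ] ℝ) : G.sharp x (G.casCovector x b) = 0 :=
  G.sharp_comp_fderiv_cas x b

omit [FiniteDimensional ℝ Y] in
theorem fderiv_leaf_casDir (x : V) (a : C) : fderiv ℝ G.leaf x (G.casDir x a) = 0 := by
  obtain ⟨z, rfl⟩ := G.exists_param_eq x
  rw [casDir_apply, G.coord_param, G.fderiv_leaf_param]

omit [FiniteDimensional ℝ Y] in
theorem fderiv_cas_casDir (x : V) (a : C) : fderiv ℝ G.cas x (G.casDir x a) = a := by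
  obtain ⟨z, rfl⟩ := G.exists_param_eq x
  rw [casDir_apply, G.coord_param, G.fderiv_cas_param]

omit [FiniteDimensional ℝ Y] in
theorem leafCovector_casDir (x u : V) (a : C) : G.leafCovector x u (G.casDir x a) = 0 := by
  rw [leafCovector_apply, ContinuousLinearMap.comp_apply, G.fderiv_leaf_casDir, map_zero]

omit [FiniteDimensional ℝ Y] in
theorem casCovector_casDir (x : V) (b : C →L[ℝ] ℝ) (a : C) :
    G.casCovector x b (G.casDir x a) = b a := by
  rw [casCovector_apply, ContinuousLinearMap.comp_apply, G.fderiv_cas_casDir]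

omit [FiniteDimensional ℝ Y] in
theorem covector_apply (x : V) (r : V →L[ℝ] ℝ) (v : V) : r v
    = r (G.casDir x (fderiv ℝ G.cas x v))
      + G.restrict (G.cas x, G.leaf x) r (fderiv ℝ G.leaf x v) := by
  conv_lhs => rw [← G.fderiv_param_coord x v]
  rw [casDir_apply, restrict_apply, ← map_add, ← map_add]
  simp

omit [FiniteDimensional ℝ Y] in
theorem restrict_eq_zero {x : V} {r : V →L[ℝ] ℝ} (h : G.sharp x r = 0) :
    G.restrict (G.cas x, G.leaf x) r = 0 := by
  obtain ⟨z, rfl⟩ := G.exists_param_eq x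
  rw [G.coord_param]
  apply G.bivec_injective z
  have := congrArg Prod.snd (G.fderiv_coord_sharp z r)
  rw [h, map_zero] at this
  simpa using this.symm

omit [FiniteDimensional ℝ Y] in
/-- A covector is determined by its image under `sharp` and its transverse components. -/
theorem covector_eq_zero {x : V} {r : V →L[ℝ] ℝ} (h : G.sharp x r = 0)
    (h' : ∀ a, r (G.casDir x a) = 0) : r = 0 := by
  ext v
  rw [G.covector_apply x r v, h', G.restrict_eq_zero h]
  simp

/-! ### Contraction of the leaves -/

/-- The contraction of every leaf to its point with leaf coordinate `0`. -/
def contract (p : ℝ × V) : V := G.param (G.cas p.2, (1 - p.1) • G.leaf p.2)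

omit [FiniteDimensional ℝ Y] in
theorem contDiff_contract : ContDiff ℝ ∞ G.contract :=
  G.contDiff_param.comp ((G.contDiff_cas.comp contDiff_snd).prodMk
    ((contDiff_const.sub contDiff_fst).smul (G.contDiff_leaf.comp contDiff_snd)))

omit [FiniteDimensional ℝ Y] in
theorem hasFDerivAt_contract (p : ℝ × V) : HasFDerivAt G.contract (fderiv ℝ G.contract p) p :=
  (G.contDiff_contract.differentiable (by simp) p).hasFDerivAt

omit [FiniteDimensional ℝ Y] in
theorem contract_zero (x : V) : G.contract (0, x) = x := by
  simp [contract, G.param_coord]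

omit [FiniteDimensional ℝ Y] in
theorem contract_one (x : V) : G.contract (1, x) = G.param (G.cas x, 0) := by
  simp [contract]

omit [FiniteDimensional ℝ Y] in
theorem cas_contract (p : ℝ × V) : G.cas (G.contract p) = G.cas p.2 := by
  rw [contract, G.cas_param]

omit [FiniteDimensional ℝ Y] in
theorem fderiv_cas_contract (p : ℝ × V) (w : ℝ × V) :
    fderiv ℝ G.cas (G.contract p) (fderiv ℝ G.contract p w) = fderiv ℝ G.cas p.2 w.2 := by
  have h1 := (G.hasFDerivAt_cas (G.contract p)).comp p (G.hasFDerivAt_contract p)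
  have h2 : HasFDerivAt (G.cas ∘ Prod.snd) _ p := (G.hasFDerivAt_cas p.2).comp p hasFDerivAt_snd
  exact DFunLike.congr_fun (h1.unique (h2.congr_of_eventuallyEq
    (Filter.Eventually.of_forall G.cas_contract))) w

omit [FiniteDimensional ℝ Y] in
theorem fderiv_contract_zero (x v : V) : fderiv ℝ G.contract (0, x) (0, v) = v := by
  have h1 := HasFDerivAt.comp (g := G.contract) (f := fun x : V => ((0 : ℝ), x)) x
    (G.hasFDerivAt_contract (0, x)) (hasFDerivAt_prodMk_right (𝕜 := ℝ) (0 : ℝ) x)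
  have h2 := h1.unique ((hasFDerivAt_id x).congr_of_eventuallyEq
    (Filter.Eventually.of_forall G.contract_zero))
  exact DFunLike.congr_fun h2 v

/-- The image under the contraction of the vector `sharp x a`, as a function of `a`. -/
def contractSharp (p : ℝ × V) : (V →L[ℝ] ℝ) →L[ℝ] V :=
  ((fderiv ℝ G.contract p).comp (ContinuousLinearMap.inr ℝ ℝ V)).comp (G.sharp p.2)

/-- The evolution of the one-forms of a solution along the contraction of the leaves: the leaf
components are determined by `dX + P A = 0`, and the transverse components follow from the
conservation of `A_I + X^* twist_I`. -/
def transport (p : ℝ × V) : (V →L[ℝ] ℝ) →L[ℝ] V →L[ℝ] ℝ :=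
  (G.leafCovector (G.contract p)).comp (G.contractSharp p)
    + (G.casCovector (G.contract p)).comp
      ((ContinuousLinearMap.compL ℝ C V ℝ).flip (G.casDir p.2) - (G.twist p.2).comp (G.sharp p.2)
        + (G.twist (G.contract p)).comp (G.contractSharp p))

/-- The gauge parameter whose infinitesimal symmetry moves the fields along the contraction of the
leaves. -/
def contractParam (p : ℝ × V) : V →L[ℝ] ℝ :=
  G.leafCovector (G.contract p) (-fderiv ℝ G.contract p (1, 0))
    + G.casCovector (G.contract p) (-G.twist (G.contract p) (fderiv ℝ G.contract p (1, 0)))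

omit [FiniteDimensional ℝ Y] in
theorem contDiff_fderiv_contract : ContDiff ℝ ∞ (fderiv ℝ G.contract) :=
  G.contDiff_contract.fderiv_right (m := ∞) (by simp)

omit [FiniteDimensional ℝ Y] in
theorem contDiff_contractSharp : ContDiff ℝ ∞ G.contractSharp :=
  (G.contDiff_fderiv_contract.clm_comp contDiff_const).clm_comp
    (G.contDiff_sharp.comp contDiff_snd)

theorem contDiff_transport : ContDiff ℝ ∞ G.transport := by
  have hs := G.contDiff_contractSharp
  have hc := G.contDiff_contract
  have h2 : ContDiff ℝ ∞ (Prod.snd : ℝ × V → V) := contDiff_snd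
  refine ((G.contDiff_leafCovector.comp hc).clm_comp hs).add
    ((G.contDiff_casCovector.comp hc).clm_comp (ContDiff.add (ContDiff.sub ?_ ?_) ?_))
  · exact contDiff_precomp (G.contDiff_casDir.comp h2)
  · exact (G.contDiff_twist.comp h2).clm_comp (G.contDiff_sharp.comp h2)
  · exact (G.contDiff_twist.comp hc).clm_comp hs

theorem contDiff_contractParam : ContDiff ℝ ∞ G.contractParam := by
  have hc := G.contDiff_contract
  have hd : ContDiff ℝ ∞ fun p => fderiv ℝ G.contract p (1, 0) :=
    G.contDiff_fderiv_contract.clm_apply contDiff_const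
  exact ((G.contDiff_leafCovector.comp hc).clm_apply hd.neg).add
    ((G.contDiff_casCovector.comp hc).clm_apply ((G.contDiff_twist.comp hc).clm_apply hd).neg)

omit [FiniteDimensional ℝ Y] in
theorem contractSharp_apply (p : ℝ × V) (a : V →L[ℝ] ℝ) :
    G.contractSharp p a = fderiv ℝ G.contract p (0, G.sharp p.2 a) := rfl

theorem sharp_transport (p : ℝ × V) (a : V →L[ℝ] ℝ) :
    G.sharp (G.contract p) (G.transport p a) = fderiv ℝ G.contract p (0, G.sharp p.2 a) := by
  rw [transport, add_apply, map_add, ContinuousLinearMap.comp_apply, ContinuousLinearMap.comp_apply,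
    G.sharp_casCovector, add_zero, G.sharp_leafCovector, contractSharp_apply]
  rw [contractSharp_apply, G.fderiv_cas_contract, G.fderiv_cas_sharp]

omit [FiniteDimensional ℝ Y] in
theorem transport_casDir (p : ℝ × V) (a : V →L[ℝ] ℝ) (c : C) :
    G.transport p a (G.casDir (G.contract p) c) = a (G.casDir p.2 c)
      - G.twist p.2 (G.sharp p.2 a) c
      + G.twist (G.contract p) (fderiv ℝ G.contract p (0, G.sharp p.2 a)) c := by
  rw [transport, add_apply, add_apply, ContinuousLinearMap.comp_apply,
    ContinuousLinearMap.comp_apply, G.leafCovector_casDir, zero_add, G.casCovector_casDir]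
  rfl

theorem transport_zero (x : V) (a : V →L[ℝ] ℝ) : G.transport (0, x) a = a := by
  rw [← sub_eq_zero]
  have h1 := G.sharp_transport (0, x) a
  have h2 := G.transport_casDir (0, x) a
  simp only [G.contract_zero, G.fderiv_contract_zero] at h1 h2
  refine G.covector_eq_zero (x := x) ?_ fun c => ?_
  · rw [map_sub, h1, sub_self]
  · rw [sub_apply, h2]
    ring

/-- At the end of the contraction, only the transverse components of the one-forms are left. -/
theorem transport_one (x : V) (a : V →L[ℝ] ℝ) : G.transport (1, x) a
    = G.casCovector (G.param (G.cas x, 0)) (a.comp (G.casDir x) - G.twist x (G.sharp x a)) := by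
  have hc0 : fderiv ℝ G.contract (1, x) (0, G.sharp x a) = 0 := by
    have h1 := HasFDerivAt.comp (g := G.contract) (f := fun z : V => ((1 : ℝ), z)) x
      (G.hasFDerivAt_contract (1, x)) (hasFDerivAt_prodMk_right (𝕜 := ℝ) (1 : ℝ) x)
    have h2 := HasFDerivAt.comp (g := G.param) x (G.hasFDerivAt_param (G.cas x, 0))
      ((G.hasFDerivAt_cas x).prodMk (hasFDerivAt_const (0 : Y) x))
    have h3 := DFunLike.congr_fun (h1.unique (h2.congr_of_eventuallyEq
      (Filter.Eventually.of_forall G.contract_one))) (G.sharp x a)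
    refine h3.trans ?_
    rw [ContinuousLinearMap.comp_apply, ContinuousLinearMap.prod_apply, G.fderiv_cas_sharp]
    exact map_zero (fderiv ℝ G.param (G.cas x, 0))
  rw [← sub_eq_zero]
  refine G.covector_eq_zero (x := G.param (G.cas x, 0)) ?_ fun c => ?_
  · have h1 := G.sharp_transport (1, x) a
    rw [G.contract_one, hc0] at h1
    rw [map_sub, h1, G.sharp_casCovector, sub_zero]
  · have h1 := G.transport_casDir (1, x) a c
    rw [G.contract_one, hc0, map_zero, zero_apply, add_zero] at h1
    rw [sub_apply, h1, G.casCovector_casDir]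
    exact sub_self _

theorem sharp_contractParam (p : ℝ × V) :
    G.sharp (G.contract p) (G.contractParam p) = -fderiv ℝ G.contract p (1, 0) := by
  rw [contractParam, map_add, G.sharp_casCovector, add_zero, G.sharp_leafCovector]
  rw [map_neg, G.fderiv_cas_contract]
  simp

omit [FiniteDimensional ℝ Y] in
theorem contractParam_casDir (p : ℝ × V) (c : C) :
    G.contractParam p (G.casDir (G.contract p) c)
      = -G.twist (G.contract p) (fderiv ℝ G.contract p (1, 0)) c := by
  rw [contractParam, add_apply, G.leafCovector_casDir, zero_add, G.casCovector_casDir]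
  rfl

end FoliatedPoisson

/-! ### Variation of the field equations along gauge orbits -/

theorem hasDerivAt_slice {E F : Type*} [NormedAddCommGroup E] [NormedSpace ℝ E]
    [NormedAddCommGroup F] [NormedSpace ℝ F] {g : ℝ × E → F} {g' : ℝ × E →L[ℝ] F} {t : ℝ} {y : E}
    (hg : HasFDerivAt g g' (t, y)) : HasDerivAt (fun s => g (s, y)) (g' (1, 0)) t :=
  HasFDerivAt.comp_hasDerivAt (l := g) t hg ((hasDerivAt_id t).prodMk (hasDerivAt_const t y))

theorem fderiv_slice {E F : Type*} [NormedAddCommGroup E] [NormedSpace ℝ E]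
    [NormedAddCommGroup F] [NormedSpace ℝ F] {g : ℝ × E → F} {t : ℝ} {y : E}
    (hg : DifferentiableAt ℝ g (t, y)) (v : E) :
    fderiv ℝ (fun y => g (t, y)) y v = fderiv ℝ g (t, y) (0, v) := by
  have h := HasFDerivAt.comp (g := g) (f := fun y => (t, y)) y hg.hasFDerivAt
    (hasFDerivAt_prodMk_right (𝕜 := ℝ) t y)
  have h' : HasFDerivAt (fun y => g (t, y)) _ y := h
  rw [h'.fderiv]
  simp

namespace FoliatedPoisson

section Variation

variable {V C Y : Type} [NormedAddCommGroup V] [NormedSpace ℝ V]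
    [NormedAddCommGroup C] [NormedSpace ℝ C] [NormedAddCommGroup Y] [NormedSpace ℝ Y]
    (G : FoliatedPoisson V C Y)

/-- The covector `(∂_i P^{kl}) a_k e_l`. -/
def coupling (x : V) (a e : V →L[ℝ] ℝ) : V →L[ℝ] ℝ := a.comp ((fderiv ℝ G.sharp x).flip e)

theorem coupling_apply (x : V) (a e : V →L[ℝ] ℝ) (w : V) :
    G.coupling x a e w = a (fderiv ℝ G.sharp x w e) := rfl

/-- The Jacobi identity: the bracket of one-forms is compatible with that of vector fields. -/
theorem sharp_coupling (x : V) (a e : V →L[ℝ] ℝ) : G.sharp x (G.coupling x a e)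
    = fderiv ℝ G.sharp x (G.sharp x e) a - fderiv ℝ G.sharp x (G.sharp x a) e := by
  refine eq_of_forall_dual_eq fun η => ?_
  rw [G.antisymm, coupling_apply, map_sub]
  have h1 := G.jacobi x a e η
  have h2 := G.sharp_fderiv_antisymm x (G.sharp x a) e η
  linarith

theorem coupling_casCovector {x : V} {a : V →L[ℝ] ℝ} (ha : G.sharp x a = 0) (b : C →L[ℝ] ℝ) :
    G.coupling x a (G.casCovector x b) = 0 := by
  ext w
  have h1 := (G.hasFDerivAt_sharp x).clm_apply
    (((G.contDiff_casCovector.differentiable (by simp) x).hasFDerivAt).clm_apply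
      (hasFDerivAt_const b x))
  have h2 := DFunLike.congr_fun (h1.unique ((hasFDerivAt_const (0 : V) x).congr_of_eventuallyEq
    (Filter.Eventually.of_forall fun x => G.sharp_casCovector x b))) w
  simp only [add_apply, ContinuousLinearMap.comp_apply, ContinuousLinearMap.flip_apply,
    zero_apply, map_zero, zero_add] at h2
  have h3 := congrArg a h2
  rw [map_add, G.antisymm x a, ha] at h3
  rw [coupling_apply]
  simpa using h3

variable {E : Type*} [NormedAddCommGroup E] [NormedSpace ℝ E]

/-- Under a variation `∂_t X = -P ε` the defect `dX + P A` of the first field equation satisfies a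
linear differential equation, which is homogeneous if `A` varies by the infinitesimal symmetry. -/
theorem hasDerivAt_defect {f : ℝ × E → V} {ε : ℝ × E → V →L[ℝ] ℝ} {a : ℝ → V →L[ℝ] ℝ}
    {a' : V →L[ℝ] ℝ} {t : ℝ} {y : E} (v : E) (hf : ContDiffAt ℝ 2 f (t, y))
    (hε : DifferentiableAt ℝ ε (t, y)) (ha : HasDerivAt a a' t)
    (hX : ∀ᶠ q in nhds (t, y), fderiv ℝ f q (1, 0) = -G.sharp (f q) (ε q)) :
    HasDerivAt (fun s => fderiv ℝ f (s, y) (0, v) + G.sharp (f (s, y)) (a s))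
      (-fderiv ℝ G.sharp (f (t, y)) (fderiv ℝ f (t, y) (0, v) + G.sharp (f (t, y)) (a t)) (ε (t, y))
        + G.sharp (f (t, y)) (a' - (fderiv ℝ ε (t, y) (0, v)
          + G.coupling (f (t, y)) (a t) (ε (t, y))))) t := by
  have hD : HasFDerivAt (fderiv ℝ f) (fderiv ℝ (fderiv ℝ f) (t, y)) (t, y) :=
    ((hf.fderiv_right (m := 1) (by norm_num)).differentiableAt (by simp)).hasFDerivAt
  have hf1 := (hf.differentiableAt (by simp)).hasFDerivAt
  have hS := HasFDerivAt.comp (g := G.sharp) (t, y) (G.hasFDerivAt_sharp (f (t, y))) hf1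
  have h1 := hD.clm_apply (hasFDerivAt_const ((1, 0) : ℝ × E) (t, y))
  have h2 := ((hS.clm_apply hε.hasFDerivAt).neg).congr_of_eventuallyEq hX
  have h3 := DFunLike.congr_fun (h1.unique h2) (0, v)
  have hsymm : fderiv ℝ (fderiv ℝ f) (t, y) (1, 0) (0, v)
      = fderiv ℝ (fderiv ℝ f) (t, y) (0, v) (1, 0) :=
    (hf.isSymmSndFDerivAt (by simp)).eq _ _
  have h4 := (hasDerivAt_slice (hD.clm_apply (hasFDerivAt_const ((0, v) : ℝ × E) (t, y)))).add
    ((hasDerivAt_slice hS).clm_apply ha)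
  refine h4.congr_deriv ?_
  simp at h3
  simp [hsymm, h3, hX.self_of_nhds, G.sharp_coupling]
  abel

/-- On solutions of the first field equation, the one-forms `A_I + X^* twist_I` vary by exact
forms. Here `r` is the defect of the equation of motion for `A`. -/
theorem hasDerivAt_charge [FiniteDimensional ℝ Y] {f : ℝ × E → V} {ε : ℝ × E → V →L[ℝ] ℝ}
    {a : ℝ → V →L[ℝ] ℝ} {a' : V →L[ℝ] ℝ} {t : ℝ} {y : E} (v : E) (c : C)
    (hf : ContDiffAt ℝ 2 f (t, y)) (hε : DifferentiableAt ℝ ε (t, y)) (ha : HasDerivAt a a' t)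
    (hX : ∀ᶠ q in nhds (t, y), fderiv ℝ f q (1, 0) = -G.sharp (f q) (ε q))
    (h0 : fderiv ℝ f (t, y) (0, v) + G.sharp (f (t, y)) (a t) = 0) :
    HasDerivAt (fun s => a s (G.casDir (f (s, y)) c)
        + G.twist (f (s, y)) (fderiv ℝ f (s, y) (0, v)) c)
      ((a' - (fderiv ℝ ε (t, y) (0, v) + G.coupling (f (t, y)) (a t) (ε (t, y))))
          (G.casDir (f (t, y)) c)
        + fderiv ℝ (fun q => ε q (G.casDir (f q) c) - G.twist (f q) (G.sharp (f q) (ε q)) c)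
          (t, y) (0, v)) t := by
  have hD : HasFDerivAt (fderiv ℝ f) (fderiv ℝ (fderiv ℝ f) (t, y)) (t, y) :=
    ((hf.fderiv_right (m := 1) (by norm_num)).differentiableAt (by simp)).hasFDerivAt
  have hf1 := (hf.differentiableAt (by simp)).hasFDerivAt
  have hT := HasFDerivAt.comp (g := G.twist) (t, y) (G.hasFDerivAt_twist (f (t, y))) hf1
  have hC := HasFDerivAt.comp (g := G.casDir) (t, y)
    (G.contDiff_casDir.differentiable (by simp) (f (t, y))).hasFDerivAt hf1
  have h1 := ((hε.hasFDerivAt.clm_apply (hC.clm_apply (hasFDerivAt_const c (t, y)))).add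
    ((hT.clm_apply (hD.clm_apply (hasFDerivAt_const ((1, 0) : ℝ × E) (t, y)))).clm_apply
      (hasFDerivAt_const c (t, y)))).congr_of_eventuallyEq
    (f₁ := fun q => ε q (G.casDir (f q) c) - G.twist (f q) (G.sharp (f q) (ε q)) c) (by
      filter_upwards [hX] with q hq
      simp [hq, sub_eq_add_neg])
  have hsymm : fderiv ℝ (fderiv ℝ f) (t, y) (1, 0) (0, v)
      = fderiv ℝ (fderiv ℝ f) (t, y) (0, v) (1, 0) :=
    (hf.isSymmSndFDerivAt (by simp)).eq _ _
  have h4 := (ha.clm_apply ((hasDerivAt_slice hC).clm_apply (hasDerivAt_const t c))).add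
    (((hasDerivAt_slice hT).clm_apply
      (hasDerivAt_slice (hD.clm_apply (hasFDerivAt_const ((0, v) : ℝ × E) (t, y))))).clm_apply
        (hasDerivAt_const t c))
  refine h4.congr_deriv ?_
  rw [h1.fderiv]
  have hv : fderiv ℝ f (t, y) (0, v) = -G.sharp (f (t, y)) (a t) := eq_neg_of_add_eq_zero_left h0
  have hl := G.lie_casDir (f (t, y)) c (a t) (ε (t, y))
  simp [hsymm, hv, hX.self_of_nhds, G.coupling_apply]
  linarith

/-- On solutions of the field equations, the one-forms `A_I + X^* twist_I` are closed. -/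
theorem planeExtD_charge [FiniteDimensional ℝ Y] {f : Plane → V}
    {a : Plane → Plane →L[ℝ] V →L[ℝ] ℝ} {b : Plane → Plane →L[ℝ] ℝ} {y : Plane} (c : C)
    (hf : ContDiffAt ℝ 2 f y) (ha : DifferentiableAt ℝ a y)
    (hb : ∀ᶠ z in nhds y, ∀ v, b z v
      = a z v (G.casDir (f z) c) + G.twist (f z) (fderiv ℝ f z v) c)
    (hb' : DifferentiableAt ℝ b y)
    (hX : ∀ v, fderiv ℝ f y v = -G.sharp (f y) (a y v))
    (hA : ∀ u v w, planeExtD a y u v w + G.coupling (f y) (a y u) (a y v) w = 0) (u v : Plane) :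
    planeExtD b y u v = 0 := by
  have hD : HasFDerivAt (fderiv ℝ f) (fderiv ℝ (fderiv ℝ f) y) y :=
    ((hf.fderiv_right (m := 1) (by norm_num)).differentiableAt (by simp)).hasFDerivAt
  have hf1 := (hf.differentiableAt (by simp)).hasFDerivAt
  have hT := HasFDerivAt.comp (g := G.twist) y (G.hasFDerivAt_twist (f y)) hf1
  have hC := HasFDerivAt.comp (g := G.casDir) y
    (G.contDiff_casDir.differentiable (by simp) (f y)).hasFDerivAt hf1
  have h1 : ∀ u v : Plane, fderiv ℝ b y u v = fderiv ℝ a y u v (G.casDir (f y) c)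
      + a y v (fderiv ℝ G.casDir (f y) (fderiv ℝ f y u) c)
      + (fderiv ℝ G.twist (f y) (fderiv ℝ f y u) (fderiv ℝ f y v) c
        + G.twist (f y) (fderiv ℝ (fderiv ℝ f) y u v) c) := by
    intro u v
    have h2 := ((ha.hasFDerivAt.clm_apply (hasFDerivAt_const v y)).clm_apply
      (hC.clm_apply (hasFDerivAt_const c y))).add
      ((hT.clm_apply (hD.clm_apply (hasFDerivAt_const v y))).clm_apply (hasFDerivAt_const c y))
    have h3 := hb'.hasFDerivAt.clm_apply (hasFDerivAt_const v y)
    have h4 := DFunLike.congr_fun (h3.unique (h2.congr_of_eventuallyEq (hb.mono fun z h => h v))) u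
    simp at h4
    rw [h4]
    ring
  have hsymm : fderiv ℝ (fderiv ℝ f) y u v = fderiv ℝ (fderiv ℝ f) y v u :=
    (hf.isSymmSndFDerivAt (by simp)).eq _ _
  have h5 := hA u v (G.casDir (f y) c)
  have hl := G.lie_casDir (f y) c (a y u) (a y v)
  rw [planeExtD, sub_apply, G.coupling_apply] at h5
  rw [planeExtD, h1, h1, hsymm, hX, hX]
  simp
  linarith

end Variation

end FoliatedPoisson

/-! ### Smooth families of functions on a surface -/

section Families

variable {S : Type*} [TopologicalSpace S] [ChartedSpace Plane S] [IsManifold (𝓡 2) ∞ S]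
variable {F : Type*} [NormedAddCommGroup F] [NormedSpace ℝ F]
variable {F' : Type*} [NormedAddCommGroup F'] [NormedSpace ℝ F']

/-- Smoothness of a time dependent function jointly in the time and the point. -/
def SmoothFamily (Z : ℝ → S → F) : Prop :=
  ContMDiff (𝓘(ℝ, ℝ).prod (𝓡 2)) 𝓘(ℝ, F) ∞ (fun q : ℝ × S => Z q.1 q.2)

/-- A time dependent function in the local coordinates around `p`. -/
def inChart (Z : ℝ → S → F) (p : S) (q : ℝ × Plane) : F := Z q.1 ((extChartAt (𝓡 2) p).symm q.2)

omit [IsManifold (𝓡 2) ∞ S] [NormedAddCommGroup F] [NormedSpace ℝ F] in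
theorem inChart_self (Z : ℝ → S → F) (x : S) (t : ℝ) :
    inChart Z x (t, extChartAt (𝓡 2) x x) = Z t x :=
  congrArg (Z t) (extChartAt_to_inv (I := 𝓡 2) x)

theorem SmoothFamily.contDiffAt_inChart {Z : ℝ → S → F} (hZ : SmoothFamily Z) (p : S)
    {q : ℝ × Plane} (hq : q.2 ∈ (extChartAt (𝓡 2) p).target) :
    ContDiffAt ℝ ∞ (inChart Z p) q := by
  have h1 : ContMDiffAt 𝓘(ℝ, ℝ × Plane) 𝓘(ℝ, ℝ) ∞ (fun q : ℝ × Plane => q.1) q :=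
    contDiff_fst.contMDiff q
  have h2 : ContMDiffAt 𝓘(ℝ, ℝ × Plane) (𝓡 2) ∞
      (fun q : ℝ × Plane => (extChartAt (𝓡 2) p).symm q.2) q :=
    ContMDiffAt.comp q (contMDiffAt_chart_symm p hq) (contDiff_snd.contMDiff q)
  exact contMDiffAt_iff_contDiffAt.1 (ContMDiffAt.comp q (hZ _) (h1.prodMk h2))

omit [IsManifold (𝓡 2) ∞ S] in
theorem SmoothFamily.contMDiff {Z : ℝ → S → F} (hZ : SmoothFamily Z) (t : ℝ) :
    ContMDiff (𝓡 2) 𝓘(ℝ, F) ∞ (Z t) :=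
  ContMDiff.comp (g := fun q : ℝ × S => Z q.1 q.2) hZ (contMDiff_const.prodMk contMDiff_id : ContMDiff (𝓡 2)
    (𝓘(ℝ, ℝ).prod (𝓡 2)) ∞ fun x : S => (t, x))

omit [IsManifold (𝓡 2) ∞ S] in
/-- A smooth function of the time and a smooth function on the surface. -/
theorem smoothFamily_comp {h : ℝ × F → F'} (hh : ContDiff ℝ ∞ h) {f : S → F}
    (hf : ContMDiff (𝓡 2) 𝓘(ℝ, F) ∞ f) : SmoothFamily fun t x => h (t, f x) :=
  ContMDiff.comp hh.contMDiff (contMDiff_fst.prodMk_space (hf.comp contMDiff_snd))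

omit [IsManifold (𝓡 2) ∞ S] in
theorem SmoothFamily.comp₂ {G : Type*} [NormedAddCommGroup G] [NormedSpace ℝ G]
    {h : F × F' → G} (hh : ContDiff ℝ ∞ h) {Z : ℝ → S → F} {W : ℝ → S → F'}
    (hZ : SmoothFamily Z) (hW : SmoothFamily W) : SmoothFamily fun t x => h (Z t x, W t x) :=
  ContMDiff.comp hh.contMDiff (ContMDiff.prodMk_space hZ hW)

theorem dFun_eq_fderiv {f : S → F} (hf : ContMDiff (𝓡 2) 𝓘(ℝ, F) ∞ f) (x : S) :
    dFun f x = fderiv ℝ (f ∘ (extChartAt (𝓡 2) x).symm) (extChartAt (𝓡 2) x x) := by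
  rw [← formInChart_self (dFun f) x]
  exact formInChart_dFun x (mem_extChartAt_target x) (hf.mdifferentiableAt (by simp))

theorem SmoothFamily.dFun_apply {Z : ℝ → S → F} (hZ : SmoothFamily Z) (t : ℝ) (x : S)
    (v : Plane) :
    dFun (Z t) x v = fderiv ℝ (inChart Z x) (t, extChartAt (𝓡 2) x x) (0, v) := by
  rw [dFun_eq_fderiv (hZ.contMDiff t)]
  exact fderiv_slice ((hZ.contDiffAt_inChart x (q := (t, extChartAt (𝓡 2) x x))
    (mem_extChartAt_target x)).differentiableAt (by simp)) v

/-- Differentiation under the integral over the time. -/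
theorem SmoothFamily.hasMFDerivAt_integral {g : ℝ → S → ℝ} (hg : SmoothFamily g)
    {η : RawForm S ℝ}
    (hη : ∀ (x : S) (v : Plane), ∫ t in (0 : ℝ)..1, dFun (g t) x v = η x v) (x : S) :
    HasMFDerivAt (𝓡 2) 𝓘(ℝ, ℝ) (fun x => ∫ t in (0 : ℝ)..1, g t x) x (η x) := by
  refine hasMFDerivAt_of_comp_chart_symm x (mem_extChartAt_source x) ?_
  rw [formInChart_self]
  set y := extChartAt (𝓡 2) x x
  set f : Plane × ℝ → ℝ := fun q => inChart g x (q.2, q.1)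
  have hf : ∀ q ∈ (extChartAt (𝓡 2) x).target ×ˢ (Set.univ : Set ℝ), ContDiffAt ℝ ∞ f q :=
    fun q hq => ContDiffAt.comp q (hg.contDiffAt_inChart x (q := (q.2, q.1)) hq.1)
      (contDiffAt_snd.prodMk contDiffAt_fst)
  have hy : y ∈ (extChartAt (𝓡 2) x).target := mem_extChartAt_target x
  have h1 := hasFDerivAt_integral_of_contDiffOn (f := f) (isOpen_extChartAt_target x)
    (fun q hq => ((hf q hq).of_le (by simp)).contDiffWithinAt) hy
  refine h1.congr_fderiv ?_
  have hcont : Continuous fun s : ℝ =>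
      (fderiv ℝ f (y, s)).comp (ContinuousLinearMap.inl ℝ Plane ℝ) := by
    refine Continuous.clm_comp ?_ continuous_const
    rw [continuous_iff_continuousAt]
    intro s
    exact ContinuousAt.comp (g := fderiv ℝ f) (f := fun s : ℝ => (y, s))
      ((hf (y, s) ⟨hy, trivial⟩).fderiv_right (m := 0) (by simp)).continuousAt
      (by fun_prop)
  ext v
  rw [ContinuousLinearMap.intervalIntegral_apply (hcont.intervalIntegrable _ _)]
  refine Eq.trans ?_ (hη x v)
  refine intervalIntegral.integral_congr fun s _ => ?_
  have h2 : HasFDerivAt f _ (y, s) := HasFDerivAt.comp (g := inChart g x) (y, s)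
    ((hg.contDiffAt_inChart x (q := (s, y)) hy).differentiableAt (by simp)).hasFDerivAt
    (hasFDerivAt_snd.prodMk hasFDerivAt_fst)
  simp only [h2.fderiv, hg.dFun_apply]
  simp [y]

end Families

namespace FoliatedPoisson

variable {S : Type*} [TopologicalSpace S] [ChartedSpace Plane S] [IsManifold (𝓡 2) ∞ S]
variable {V C Y : Type} [NormedAddCommGroup V] [NormedSpace ℝ V]
    [NormedAddCommGroup C] [NormedSpace ℝ C] [NormedAddCommGroup Y] [NormedSpace ℝ Y]
    [FiniteDimensional ℝ Y] (G : FoliatedPoisson V C Y)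

/-! ### The closed one-forms attached to a solution -/

/-- The one-forms `A_I + X^* twist_I`, as a function of the index `I` or, free of coordinates, of a
vector of `C`. Their cohomology classes are the invariants of the solution. -/
def charge (X : S → V) (A : RawForm S (V →L[ℝ] ℝ)) (c : C) : RawForm S ℝ := fun x =>
  (ContinuousLinearMap.apply ℝ ℝ (G.casDir (X x) c)).comp (A x)
    + (ContinuousLinearMap.apply ℝ ℝ c).comp ((G.twist (X x)).comp (dFun X x))

omit [IsManifold (𝓡 2) ∞ S] [FiniteDimensional ℝ Y] in
theorem charge_apply (X : S → V) (A : RawForm S (V →L[ℝ] ℝ)) (c : C) (x : S) (v : Plane) :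
    G.charge X A c x v = A x v (G.casDir (X x) c) + G.twist (X x) (dFun X x v) c := rfl

theorem contDiff_apply {E F : Type*} [NormedAddCommGroup E] [NormedSpace ℝ E]
    [NormedAddCommGroup F] [NormedSpace ℝ F] :
    ContDiff ℝ ∞ fun w : E => (ContinuousLinearMap.apply ℝ F w : (E →L[ℝ] F) →L[ℝ] F) :=
  contDiff_clm (E := E) (F := (E →L[ℝ] F) →L[ℝ] F) (ContinuousLinearMap.apply ℝ F)

theorem isSmoothForm_charge {X : S → V} {A : RawForm S (V →L[ℝ] ℝ)}
    (hX : ContMDiff (𝓡 2) 𝓘(ℝ, V) ∞ X) (hA : IsSmoothForm A) (c : C) :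
    IsSmoothForm (G.charge X A c) := by
  intro p
  have hf : ContDiffOn ℝ ∞ (X ∘ (extChartAt (𝓡 2) p).symm) (extChartAt (𝓡 2) p).target :=
    fun y hy => (contDiffAt_comp_chart_symm p hy (hX _)).contDiffWithinAt
  have h1 : ContDiffOn ℝ ∞ (fun y => G.casDir ((X ∘ (extChartAt (𝓡 2) p).symm) y) c)
      (extChartAt (𝓡 2) p).target :=
    (G.contDiff_casDir.clm_apply contDiff_const).comp_contDiffOn hf
  have h2 := (G.contDiff_twist.comp_contDiffOn hf).clm_comp (isSmoothForm_dFun hX p)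
  exact ((contDiff_apply.comp_contDiffOn h1).clm_comp (hA p)).add (contDiffOn_const.clm_comp h2)

theorem charge_mem_closedForms {X : S → V} {A : RawForm S (V →L[ℝ] ℝ)}
    (hX : ContMDiff (𝓡 2) 𝓘(ℝ, V) ∞ X) (hA : IsSmoothForm A)
    (eX : ∀ (x : S) (v : Plane), dFun X x v + G.sharp (X x) (A x v) = 0)
    (eA : ∀ (x : S) (u v : Plane) (w : V),
      extD A x u v w + G.coupling (X x) (A x u) (A x v) w = 0) (c : C) :
    G.charge X A c ∈ closedForms S := by
  have hs := G.isSmoothForm_charge hX hA c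
  refine ⟨hs, fun x u v => ?_⟩
  have hx : (X ∘ (extChartAt (𝓡 2) x).symm) (extChartAt (𝓡 2) x x) = X x :=
    congrArg X (extChartAt_to_inv (I := 𝓡 2) x)
  have hy := mem_extChartAt_target (I := 𝓡 2) x
  refine G.planeExtD_charge c ((contDiffAt_comp_chart_symm x hy (hX _)).of_le two_le_infty)
    (hA.differentiableAt x) ?_ (hs.differentiableAt x) ?_ ?_ u v
  · filter_upwards [(isOpen_extChartAt_target x).mem_nhds hy] with z hz v
    rw [← formInChart_dFun x hz (hX.mdifferentiableAt (by simp))]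
    rfl
  · intro v
    rw [hx, formInChart_self, ← dFun_eq_fderiv hX]
    exact eq_neg_of_add_eq_zero_left (eX x v)
  · intro u v w
    rw [hx, formInChart_self]
    exact eA x u v w

/-! ### Gauge flows -/

/-- A smooth path of maps that integrates the infinitesimal symmetries with parameters `ε`. -/
structure IsVariation (X : ℝ → S → V) (ε : ℝ → S → V →L[ℝ] ℝ) : Prop where
  smooth_X : SmoothFamily X
  smooth_ε : SmoothFamily ε
  deriv_X : ∀ t x, HasDerivAt (fun s => X s x) (-G.sharp (X t x) (ε t x)) t

/-- A path of fields that integrates the infinitesimal symmetries with parameters `ε`. -/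
structure IsFlow (X : ℝ → S → V) (A : ℝ → RawForm S (V →L[ℝ] ℝ)) (ε : ℝ → S → V →L[ℝ] ℝ) : Prop
    extends G.IsVariation X ε where
  deriv_A : ∀ (t : ℝ) (x : S) (v : Plane), HasDerivAt (fun s => A s x v)
    (dFun (ε t) x v + G.coupling (X t x) (A t x v) (ε t x)) t

/-- The functions whose differentials are the variation of the forms `charge`. -/
def generator (X : ℝ → S → V) (ε : ℝ → S → V →L[ℝ] ℝ) (c : C) (t : ℝ) (x : S) : ℝ :=
  ε t x (G.casDir (X t x) c) - G.twist (X t x) (G.sharp (X t x) (ε t x)) c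

variable {G} {X : ℝ → S → V} {A : ℝ → RawForm S (V →L[ℝ] ℝ)} {ε : ℝ → S → V →L[ℝ] ℝ}

omit [FiniteDimensional ℝ Y] in
theorem IsVariation.eventually (h : G.IsVariation X ε) (x : S) (t : ℝ) :
    ∀ᶠ q in nhds (t, extChartAt (𝓡 2) x x),
      fderiv ℝ (inChart X x) q (1, 0) = -G.sharp (inChart X x q) (inChart ε x q) := by
  have h1 : ∀ᶠ q : ℝ × Plane in nhds (t, extChartAt (𝓡 2) x x),
      q.2 ∈ (extChartAt (𝓡 2) x).target :=
    continuous_snd.continuousAt.eventually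
      ((isOpen_extChartAt_target x).mem_nhds (mem_extChartAt_target x))
  filter_upwards [h1] with q hq
  have h2 := hasDerivAt_slice (t := q.1) (y := q.2)
    ((h.smooth_X.contDiffAt_inChart x hq).differentiableAt (by simp)).hasFDerivAt
  exact h2.unique (h.deriv_X q.1 ((extChartAt (𝓡 2) x).symm q.2))

omit [IsManifold (𝓡 2) ∞ S] in
theorem IsVariation.smoothFamily_generator (h : G.IsVariation X ε) (c : C) :
    SmoothFamily (G.generator X ε c) := by
  have h1 : ContDiff ℝ ∞ (Prod.fst : V × (V →L[ℝ] ℝ) → V) := contDiff_fst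
  have h2 : ContDiff ℝ ∞ (Prod.snd : V × (V →L[ℝ] ℝ) → (V →L[ℝ] ℝ)) := contDiff_snd
  have h3 : ContDiff ℝ ∞ fun p : V × (V →L[ℝ] ℝ) =>
      p.2 (G.casDir p.1 c) - G.twist p.1 (G.sharp p.1 p.2) c :=
    (h2.clm_apply ((G.contDiff_casDir.comp h1).clm_apply contDiff_const)).sub
      (((G.contDiff_twist.comp h1).clm_apply ((G.contDiff_sharp.comp h1).clm_apply h2)).clm_apply
        contDiff_const)
  exact SmoothFamily.comp₂ h3 h.smooth_X h.smooth_ε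

omit [FiniteDimensional ℝ Y] in
theorem IsVariation.hasDerivAt_defect (h : G.IsVariation X ε) {a : ℝ → V →L[ℝ] ℝ}
    {a' : V →L[ℝ] ℝ} {t : ℝ} (x : S) (v : Plane) (ha : HasDerivAt a a' t) :
    HasDerivAt (fun s => dFun (X s) x v + G.sharp (X s x) (a s))
      (-fderiv ℝ G.sharp (X t x) (dFun (X t) x v + G.sharp (X t x) (a t)) (ε t x)
        + G.sharp (X t x) (a' - (dFun (ε t) x v + G.coupling (X t x) (a t) (ε t x)))) t := by
  have hy := mem_extChartAt_target (I := 𝓡 2) x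
  have h1 := G.hasDerivAt_defect v
    ((h.smooth_X.contDiffAt_inChart x (q := (t, _)) hy).of_le two_le_infty)
    ((h.smooth_ε.contDiffAt_inChart x (q := (t, _)) hy).differentiableAt (by simp)) ha
    (h.eventually x t)
  simp only [inChart_self, ← h.smooth_X.dFun_apply, ← h.smooth_ε.dFun_apply] at h1
  exact h1

theorem IsVariation.hasDerivAt_charge (h : G.IsVariation X ε) {a : ℝ → V →L[ℝ] ℝ}
    {a' : V →L[ℝ] ℝ} {t : ℝ} (x : S) (v : Plane) (c : C) (ha : HasDerivAt a a' t)
    (h0 : dFun (X t) x v + G.sharp (X t x) (a t) = 0) :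
    HasDerivAt (fun s => a s (G.casDir (X s x) c) + G.twist (X s x) (dFun (X s) x v) c)
      ((a' - (dFun (ε t) x v + G.coupling (X t x) (a t) (ε t x))) (G.casDir (X t x) c)
        + dFun (G.generator X ε c t) x v) t := by
  have hy := mem_extChartAt_target (I := 𝓡 2) x
  rw [h.smooth_X.dFun_apply, ← inChart_self X x t] at h0
  have h1 := G.hasDerivAt_charge v c
    ((h.smooth_X.contDiffAt_inChart x (q := (t, _)) hy).of_le two_le_infty)
    ((h.smooth_ε.contDiffAt_inChart x (q := (t, _)) hy).differentiableAt (by simp)) ha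
    (h.eventually x t) h0
  simp only [inChart_self, ← h.smooth_X.dFun_apply, ← h.smooth_ε.dFun_apply] at h1
  rw [(h.smoothFamily_generator c).dFun_apply]
  exact h1

omit [IsManifold (𝓡 2) ∞ S] [FiniteDimensional ℝ Y] in
theorem IsVariation.cas_eq (h : G.IsVariation X ε) (s t : ℝ) (x : S) :
    G.cas (X s x) = G.cas (X t x) := by
  have h1 : ∀ t, HasDerivAt (fun s => G.cas (X s x)) 0 t := fun t => by
    have := HasFDerivAt.comp_hasDerivAt (l := G.cas) t (G.hasFDerivAt_cas (X t x)) (h.deriv_X t x)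
    refine this.congr_deriv ?_
    rw [map_neg, G.fderiv_cas_sharp, neg_zero]
  exact is_const_of_deriv_eq_zero (fun t => (h1 t).differentiableAt) (fun t => (h1 t).deriv) s t

/-- A solution of a homogeneous linear differential equation that vanishes somewhere is zero. -/
theorem eq_zero_of_hasDerivAt_linear {W : Type*} [NormedAddCommGroup W] [NormedSpace ℝ W]
    {L : ℝ → W →L[ℝ] W} (hL : Continuous L) {e : ℝ → W} (he : ∀ t, HasDerivAt e (L t (e t)) t)
    {t₀ : ℝ} (h0 : e t₀ = 0) (t : ℝ) : e t = 0 := by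
  obtain ⟨K, hK⟩ := (isCompact_Icc (a := min t t₀ - 1)
    (b := max t t₀ + 1)).exists_bound_of_continuousOn hL.continuousOn
  have h1 : ∀ s ∈ Set.Ioo (min t t₀ - 1) (max t t₀ + 1),
      LipschitzOnWith K.toNNReal (fun w => L s w) Set.univ := fun s hs => by
    refine ((L s).lipschitz.weaken ?_).lipschitzOnWith
    rw [← NNReal.coe_le_coe]
    exact (hK s (Set.Ioo_subset_Icc_self hs)).trans (Real.le_coe_toNNReal K)
  refine ODE_solution_unique_of_mem_Ioo (g := fun _ => 0) (v := fun s w => L s w) h1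
    (t₀ := t₀) ⟨by grind, by grind⟩ (fun s _ => ⟨he s, trivial⟩)
    (fun s _ => ⟨?_, trivial⟩) h0 ⟨by grind, by grind⟩
  rw [map_zero]
  exact hasDerivAt_const s 0

omit [FiniteDimensional ℝ Y] in
/-- Gauge transformations map solutions of the first field equation to solutions. -/
theorem IsFlow.defect_eq_zero (h : G.IsFlow X A ε) {t₀ : ℝ} (x : S) (v : Plane)
    (h0 : dFun (X t₀) x v + G.sharp (X t₀ x) (A t₀ x v) = 0) (t : ℝ) :
    dFun (X t) x v + G.sharp (X t x) (A t x v) = 0 := by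
  have hXc : Continuous fun t => X t x :=
    continuous_iff_continuousAt.2 fun t => (h.deriv_X t x).continuousAt
  have hεc : Continuous fun t => ε t x :=
    h.smooth_ε.continuous.comp (by fun_prop : Continuous fun t => (t, x))
  have hDc := (G.contDiff_sharp.continuous_fderiv (by simp)).comp hXc
  refine eq_zero_of_hasDerivAt_linear
    (L := fun t => -(ContinuousLinearMap.apply ℝ V (ε t x)).comp (fderiv ℝ G.sharp (X t x)))
    (e := fun t => dFun (X t) x v + G.sharp (X t x) (A t x v)) ?_ (fun t => ?_) h0 t
  · exact ((contDiff_apply.continuous.comp hεc).clm_comp hDc).neg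
  · have h1 := h.toIsVariation.hasDerivAt_defect x v (h.deriv_A t x v)
    rw [sub_self, map_zero, add_zero] at h1
    exact h1

/-- On solutions of the first field equation the forms `charge` change by exact forms. -/
theorem IsFlow.exists_hasMFDerivAt (h : G.IsFlow X A ε)
    (h0 : ∀ (x : S) (v : Plane), dFun (X 0) x v + G.sharp (X 0 x) (A 0 x v) = 0) (c : C) :
    ∃ f : S → ℝ, ∀ x, HasMFDerivAt (𝓡 2) 𝓘(ℝ, ℝ) f x
      (G.charge (X 1) (A 1) c x - G.charge (X 0) (A 0) c x) := by
  have hg := h.toIsVariation.smoothFamily_generator c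
  refine ⟨_, hg.hasMFDerivAt_integral
    (η := fun x => G.charge (X 1) (A 1) c x - G.charge (X 0) (A 0) c x) fun x v => ?_⟩
  have h1 : ∀ t, HasDerivAt (fun t => G.charge (X t) (A t) c x v)
      (dFun (G.generator X ε c t) x v) t := fun t => by
    have h2 := h.toIsVariation.hasDerivAt_charge x v c (h.deriv_A t x v)
      (h.defect_eq_zero x v (h0 x v) t)
    rw [sub_self, zero_apply, zero_add] at h2
    exact h2
  have hcont : Continuous fun t => dFun (G.generator X ε c t) x v := by
    simp only [hg.dFun_apply]
    refine Continuous.clm_apply ?_ continuous_const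
    rw [continuous_iff_continuousAt]
    intro s
    exact ContinuousAt.comp (g := fderiv ℝ _) (f := fun s : ℝ => (s, extChartAt (𝓡 2) x x))
      ((hg.contDiffAt_inChart x (q := (s, _)) (mem_extChartAt_target x)).fderiv_right (m := 0)
        (by simp)).continuousAt (by fun_prop)
  rw [intervalIntegral.integral_eq_sub_of_hasDerivAt (fun t _ => h1 t)
    (hcont.intervalIntegrable _ _)]
  rfl

/-- Every solution can be contracted along the leaves by a gauge transformation. -/
theorem isFlow_contract (G : FoliatedPoisson V C Y) {X : S → V} {A : RawForm S (V →L[ℝ] ℝ)}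
    (hX : ContMDiff (𝓡 2) 𝓘(ℝ, V) ∞ X)
    (eX : ∀ (x : S) (v : Plane), dFun X x v + G.sharp (X x) (A x v) = 0) :
    G.IsFlow (fun t x => G.contract (t, X x)) (fun t x => (G.transport (t, X x)).comp (A x))
      (fun t x => G.contractParam (t, X x)) := by
  have hv : G.IsVariation (fun t x => G.contract (t, X x)) (fun t x => G.contractParam (t, X x)) :=
    { smooth_X := smoothFamily_comp G.contDiff_contract hX
      smooth_ε := smoothFamily_comp G.contDiff_contractParam hX
      deriv_X := fun t x => by
        rw [G.sharp_contractParam, neg_neg]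
        exact hasDerivAt_slice (G.hasFDerivAt_contract (t, X x)) }
  refine { hv with deriv_A := fun t x v => ?_ }
  have eX' : dFun X x v = -G.sharp (X x) (A x v) := eq_neg_of_add_eq_zero_left (eX x v)
  have hd : ∀ t, dFun (fun x => G.contract (t, X x)) x v
      = -fderiv ℝ G.contract (t, X x) (0, G.sharp (X x) (A x v)) := fun t => by
    have h1 := HasFDerivAt.comp (g := G.contract) (f := fun z : V => (t, z)) (X x)
      (G.hasFDerivAt_contract (t, X x)) (hasFDerivAt_prodMk_right (𝕜 := ℝ) t (X x))
    have h2 := HasMFDerivAt.comp x h1.hasMFDerivAt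
      (hX.mdifferentiableAt (x := x) (by simp)).hasMFDerivAt
    refine (congrArg (fun L : Plane →L[ℝ] V => L v) h2.mfderiv).trans ?_
    refine Eq.trans (b := fderiv ℝ G.contract (t, X x) (0, dFun X x v)) rfl ?_
    rw [eX', ← map_neg (fderiv ℝ G.contract (t, X x)), Prod.neg_mk, neg_zero]
  have h0 : ∀ t, dFun (fun x => G.contract (t, X x)) x v
      + G.sharp (G.contract (t, X x)) (G.transport (t, X x) (A x v)) = 0 := fun t => by
    rw [hd, G.sharp_transport, neg_add_cancel]
  have ha : HasDerivAt (fun s => G.transport (s, X x) (A x v))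
      (fderiv ℝ G.transport (t, X x) (1, 0) (A x v)) t := by
    have h1 := (hasDerivAt_slice ((G.contDiff_transport.differentiable (by simp)
      (t, X x)).hasFDerivAt)).clm_apply (hasDerivAt_const t (A x v))
    simpa using h1
  refine ha.congr_deriv (?_ : _ = dFun (fun x => G.contractParam (t, X x)) x v
    + G.coupling (G.contract (t, X x)) (G.transport (t, X x) (A x v)) (G.contractParam (t, X x)))
  -- the defect `r` of the equation of motion of `A` is annihilated by `sharp`, since `dX + P A`
  -- vanishes for all times, and by the transverse directions, since `charge` is constant in time
  rw [← sub_eq_zero]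
  refine G.covector_eq_zero (x := G.contract (t, X x)) ?_ fun c => ?_
  · have h1 := hv.hasDerivAt_defect x v ha
    simp only [h0] at h1
    have h2 := h1.unique (hasDerivAt_const t 0)
    simpa using h2
  · have h1 := hv.hasDerivAt_charge x v c ha (h0 t)
    have hg : G.generator (fun t x => G.contract (t, X x)) (fun t x => G.contractParam (t, X x)) c t
        = fun _ => 0 := by
      funext x
      rw [generator, G.sharp_contractParam, G.contractParam_casDir]
      simp
    have hc : ∀ s, G.transport (s, X x) (A x v) (G.casDir (G.contract (s, X x)) c)
        + G.twist (G.contract (s, X x)) (dFun (fun x => G.contract (s, X x)) x v) c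
        = A x v (G.casDir (X x) c) - G.twist (X x) (G.sharp (X x) (A x v)) c := fun s => by
      rw [hd, G.transport_casDir]
      simp
    simp only [hc, hg] at h1
    have h2 := h1.unique (hasDerivAt_const t _)
    have h3 : dFun (fun _ : S => (0 : ℝ)) x v = 0 :=
      congrArg (fun L : Plane →L[ℝ] ℝ => L v) (mfderiv_const (I := 𝓡 2) (I' := 𝓘(ℝ, ℝ)) (x := x))
    rwa [h3, add_zero] at h2

theorem contDiffOn_transport (G : FoliatedPoisson V C Y) {X : S → V} {A : RawForm S (V →L[ℝ] ℝ)}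
    (hX : ContMDiff (𝓡 2) 𝓘(ℝ, V) ∞ X) (hA : IsSmoothForm A) (x₀ : S) : ContDiffOn ℝ ∞
      (fun p : ℝ × Plane => formInChart (fun x => (G.transport (p.1, X x)).comp (A x)) x₀ p.2)
      (Set.univ ×ˢ (extChartAt (𝓡 2) x₀).target) := by
  have hs : Set.MapsTo Prod.snd ((Set.univ : Set ℝ) ×ˢ (extChartAt (𝓡 2) x₀).target)
    (extChartAt (𝓡 2) x₀).target := fun q hq => hq.2
  have hf : ContDiffOn ℝ ∞ (X ∘ (extChartAt (𝓡 2) x₀).symm) (extChartAt (𝓡 2) x₀).target :=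
    fun y hy => (contDiffAt_comp_chart_symm x₀ hy (hX _)).contDiffWithinAt
  have h1 : ContDiffOn ℝ ∞ (fun p : ℝ × Plane => (p.1, (X ∘ (extChartAt (𝓡 2) x₀).symm) p.2))
      (Set.univ ×ˢ (extChartAt (𝓡 2) x₀).target) :=
    contDiffOn_fst.prodMk (hf.comp contDiffOn_snd hs)
  have h2 : ContDiffOn ℝ ∞ (fun p : ℝ × Plane => formInChart A x₀ p.2)
      (Set.univ ×ˢ (extChartAt (𝓡 2) x₀).target) := (hA x₀).comp contDiffOn_snd hs
  have h3 : ContDiffOn ℝ ∞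
      (fun p : ℝ × Plane => G.transport (p.1, (X ∘ (extChartAt (𝓡 2) x₀).symm) p.2))
      (Set.univ ×ˢ (extChartAt (𝓡 2) x₀).target) := G.contDiff_transport.comp_contDiffOn h1
  exact (h3.clm_comp h2).congr fun p _ => rfl

omit [IsManifold (𝓡 2) ∞ S] [FiniteDimensional ℝ Y] in
/-- The gauge flow that adds exact forms to the transverse components of a solution with constant
`X`. -/
theorem isFlow_exact (G : FoliatedPoisson V C Y) (x₀ : V) {A : RawForm S (V →L[ℝ] ℝ)}
    (hA : ∀ (x : S) (v : Plane), G.sharp x₀ (A x v) = 0) {f : S → C →L[ℝ] ℝ}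
    (hf : ContMDiff (𝓡 2) 𝓘(ℝ, C →L[ℝ] ℝ) ∞ f) :
    G.IsFlow (fun _ _ => x₀) (fun t x => A x + t • (G.casCovector x₀).comp (dFun f x))
      (fun _ x => G.casCovector x₀ (f x)) where
  smooth_X := contMDiff_const
  smooth_ε := ContMDiff.comp (G.casCovector x₀).contDiff.contMDiff (hf.comp contMDiff_snd)
  deriv_X t x := by
    rw [G.sharp_casCovector, neg_zero]
    exact hasDerivAt_const t x₀
  deriv_A t x v := by
    rw [G.coupling_casCovector, add_zero]
    · have h1 := ((hasDerivAt_id t).smul_const (G.casCovector x₀ (dFun f x v))).const_add (A x v)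
      refine h1.congr_deriv ?_
      have h2 := HasMFDerivAt.comp x (G.casCovector x₀).hasFDerivAt.hasMFDerivAt
        (hf.mdifferentiableAt (x := x) (by simp)).hasMFDerivAt
      rw [one_smul]
      exact (congrArg (fun L : Plane →L[ℝ] (V →L[ℝ] ℝ) => L v) h2.mfderiv).symm
    · refine Eq.trans (b := G.sharp x₀ (A x v + t • G.casCovector x₀ (dFun f x v))) rfl ?_
      rw [map_add, map_smul, hA, G.sharp_casCovector, smul_zero, add_zero]

end FoliatedPoisson

/-! ### One-forms with values in covectors -/

/-- The covector with given components. -/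
def flat (n : ℕ) : (Fin n → ℝ) →L[ℝ] ((Fin n → ℝ) →L[ℝ] ℝ) :=
  ∑ i, (ContinuousLinearMap.proj i : (Fin n → ℝ) →L[ℝ] ℝ).smulRight
    (ContinuousLinearMap.proj i : (Fin n → ℝ) →L[ℝ] ℝ)

/-- The components of a covector. -/
def unflat (n : ℕ) : ((Fin n → ℝ) →L[ℝ] ℝ) →L[ℝ] (Fin n → ℝ) :=
  ContinuousLinearMap.pi fun i => ContinuousLinearMap.apply ℝ ℝ (Pi.single i 1)

theorem flat_apply {n : ℕ} (a w : Fin n → ℝ) : flat n a w = ∑ i, a i * w i := by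
  simp [flat]

theorem flat_single {n : ℕ} (a : Fin n → ℝ) (i : Fin n) : flat n a (Pi.single i 1) = a i := by
  simp [flat_apply, Pi.single_apply]

theorem unflat_apply {n : ℕ} (ξ : (Fin n → ℝ) →L[ℝ] ℝ) (i : Fin n) :
    unflat n ξ i = ξ (Pi.single i 1) := rfl

theorem unflat_flat {n : ℕ} (a : Fin n → ℝ) : unflat n (flat n a) = a := by
  ext i
  rw [unflat_apply, flat_single]

theorem eq_sum_single {n : ℕ} (ξ : (Fin n → ℝ) →L[ℝ] ℝ) (w : Fin n → ℝ) :
    ξ w = ∑ i, ξ (Pi.single i 1) * w i := by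
  conv_lhs => rw [pi_eq_sum_univ' w]
  simp [map_sum, mul_comm]

theorem flat_unflat {n : ℕ} (ξ : (Fin n → ℝ) →L[ℝ] ℝ) : flat n (unflat n ξ) = ξ := by
  ext w
  rw [flat_apply, eq_sum_single ξ w]
  rfl

section Forms

variable {S : Type*} [TopologicalSpace S] [ChartedSpace Plane S]
variable {F F' : Type*} [NormedAddCommGroup F] [NormedSpace ℝ F] [NormedAddCommGroup F']
  [NormedSpace ℝ F']

theorem isSmoothForm_comp (L : F →L[ℝ] F') {η : RawForm S F} (hη : IsSmoothForm η) :
    IsSmoothForm fun x => L.comp (η x) :=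
  fun p => contDiffOn_const.clm_comp (hη p)

theorem extD_comp (L : F →L[ℝ] F') {η : RawForm S F} (hη : IsSmoothForm η) (x : S) (u v : Plane) :
    extD (fun x => L.comp (η x)) x u v = L (extD η x u v) := by
  have h1 : HasFDerivAt (formInChart (fun x => L.comp (η x)) x) _ (extChartAt (𝓡 2) x x) :=
    (hasFDerivAt_const L _).clm_comp (hη.differentiableAt x).hasFDerivAt
  simp only [extD, planeExtD, h1.fderiv]
  simp

theorem dFun_comp (L : F →L[ℝ] F') {f : S → F} (hf : ContMDiff (𝓡 2) 𝓘(ℝ, F) ∞ f) (x : S)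
    (v : Plane) : dFun (fun x => L (f x)) x v = L (dFun f x v) := by
  have h := HasMFDerivAt.comp x L.hasFDerivAt.hasMFDerivAt
    (hf.mdifferentiableAt (x := x) (by simp)).hasMFDerivAt
  exact congrArg (fun L : Plane →L[ℝ] F' => L v) h.mfderiv

theorem dFun_const (w : F) (x : S) : dFun (fun _ : S => w) x = 0 :=
  mfderiv_const (I := 𝓡 2) (I' := 𝓘(ℝ, F)) (x := x)

/-- The form `A_i dXⁱ` with values in covectors, for a form with components `A_i`. -/
def dualForm {n : ℕ} (A : RawForm S (Fin n → ℝ)) : RawForm S ((Fin n → ℝ) →L[ℝ] ℝ) :=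
  fun x => (flat n).comp (A x)

theorem dualForm_apply {n : ℕ} (A : RawForm S (Fin n → ℝ)) (x : S) (v : Plane) :
    dualForm A x v = flat n (A x v) := rfl

theorem dualForm_injective {n : ℕ} {A B : RawForm S (Fin n → ℝ)} (h : dualForm A = dualForm B) :
    A = B := by
  funext x
  ext1 v
  have h1 : flat n (A x v) = flat n (B x v) :=
    congrArg (fun D : RawForm S ((Fin n → ℝ) →L[ℝ] ℝ) => D x v) h
  rw [← unflat_flat (A x v), h1, unflat_flat]

theorem dualForm_unflat {n : ℕ} (A : RawForm S ((Fin n → ℝ) →L[ℝ] ℝ)) :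
    dualForm (fun x => (unflat n).comp (A x)) = A := by
  funext x
  ext1 v
  exact flat_unflat (A x v)

/-- The linear map with values in covectors that has the given components. -/
def covectorMap {k : ℕ} (g : Fin k → Plane →L[ℝ] ℝ) : Plane →L[ℝ] (Fin k → ℝ) →L[ℝ] ℝ :=
  ∑ I, (g I).smulRight (ContinuousLinearMap.proj I : (Fin k → ℝ) →L[ℝ] ℝ)

theorem covectorMap_apply {k : ℕ} (g : Fin k → Plane →L[ℝ] ℝ) (v : Plane) :
    covectorMap g v = flat k (fun I => g I v) := by
  ext c
  simp [covectorMap, flat_apply]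

/-- The one-forms `α_I` collected to the form `α_I dX^I` with values in covectors. -/
def collect {k : ℕ} (α : Fin k → closedForms S) : RawForm S ((Fin k → ℝ) →L[ℝ] ℝ) :=
  fun x => covectorMap fun I => (α I : RawForm S ℝ) x

theorem collect_apply {k : ℕ} (α : Fin k → closedForms S) (x : S) (v : Plane) :
    collect α x v = flat k (fun I => (α I : RawForm S ℝ) x v) :=
  covectorMap_apply _ v

theorem isSmoothForm_collect {k : ℕ} (α : Fin k → closedForms S) : IsSmoothForm (collect α) := by
  intro p
  have h : ContDiffOn ℝ ∞ (fun y => covectorMap fun I => formInChart (α I : RawForm S ℝ) p y)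
      (extChartAt (𝓡 2) p).target :=
    ContDiffOn.sum fun I _ => ((α I).2.1 p).smulRight contDiffOn_const
  refine h.congr fun y _ => ?_
  ext1 v
  rw [covectorMap_apply]
  exact collect_apply α _ _

theorem extD_collect {k : ℕ} (α : Fin k → closedForms S) (x : S) (u v : Plane) :
    extD (collect α) x u v = 0 := by
  ext c
  refine (extD_comp (ContinuousLinearMap.apply ℝ ℝ c) (isSmoothForm_collect α) x u v).symm.trans ?_
  have h : (fun x => (ContinuousLinearMap.apply ℝ ℝ c).comp (collect α x) : RawForm S ℝ)
      = ((∑ I, c I • α I : closedForms S) : RawForm S ℝ) := by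
    funext x
    ext v
    refine (congrArg (fun ξ : (Fin k → ℝ) →L[ℝ] ℝ => ξ c) (collect_apply α x v)).trans ?_
    rw [flat_apply, Submodule.coe_sum, Finset.sum_apply, sum_apply]
    exact Finset.sum_congr rfl fun I _ => mul_comm _ _
  rw [h]
  exact (∑ I, c I • α I : closedForms S).2.2 x u v

end Forms

/-! ### The foliated Poisson structure given by a matrix of components -/

section Components

variable {n k : ℕ} {P : (Fin n → ℝ) → Matrix (Fin n) (Fin n) ℝ}

/-- The map `ξ ↦ P ξ` from covectors to vectors. -/
def sharpOf (P : (Fin n → ℝ) → Matrix (Fin n) (Fin n) ℝ) (x : Fin n → ℝ) :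
    ((Fin n → ℝ) →L[ℝ] ℝ) →L[ℝ] (Fin n → ℝ) :=
  ∑ i, ∑ j, P x i j • (ContinuousLinearMap.apply ℝ ℝ (Pi.single j 1 : Fin n → ℝ)).smulRight
    (Pi.single i 1 : Fin n → ℝ)

theorem sharpOf_apply (x : Fin n → ℝ) (ξ : (Fin n → ℝ) →L[ℝ] ℝ) (i : Fin n) :
    sharpOf P x ξ i = ∑ j, P x i j * ξ (Pi.single j 1) := by
  simp [sharpOf, Finset.sum_apply, Pi.single_apply]

theorem sharpOf_eq_mulVec (x : Fin n → ℝ) (ξ : (Fin n → ℝ) →L[ℝ] ℝ) :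
    sharpOf P x ξ = (P x).mulVecLin (unflat n ξ) := by
  ext i
  rw [sharpOf_apply]
  rfl

set_option maxSynthPendingDepth 3 in
theorem contDiff_sharpOf (hP : IsPoisson P) : ContDiff ℝ ∞ (sharpOf P) :=
  ContDiff.sum fun i _ => ContDiff.sum fun j _ => (hP.smooth i j).smul contDiff_const

theorem fderiv_sharpOf (hP : IsPoisson P) (x w : Fin n → ℝ) (ξ : (Fin n → ℝ) →L[ℝ] ℝ)
    (i : Fin n) : fderiv ℝ (sharpOf P) x w ξ i
      = ∑ j, fderiv ℝ (fun y => P y i j) x w * ξ (Pi.single j 1) := by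
  have h1 := (ContinuousLinearMap.proj (R := ℝ) (φ := fun _ : Fin n => ℝ) i).hasFDerivAt.comp x
    ((((contDiff_sharpOf hP).differentiable (by simp) x).hasFDerivAt).clm_apply
      (hasFDerivAt_const ξ x))
  have h2 : HasFDerivAt (fun x => ∑ j, P x i j * ξ (Pi.single j 1)) _ x :=
    HasFDerivAt.fun_sum fun j _ => (((hP.smooth i j).differentiable (by simp) x).hasFDerivAt).mul_const
      (ξ (Pi.single j 1))
  have h3 := DFunLike.congr_fun (h1.unique (h2.congr_of_eventuallyEq
    (Filter.Eventually.of_forall fun x => sharpOf_apply x ξ i))) w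
  simp at h3
  rw [h3]
  exact Finset.sum_congr rfl fun j _ => mul_comm _ _

theorem fderiv_eq_sum_pd (f : (Fin n → ℝ) → ℝ) (x w : Fin n → ℝ) :
    fderiv ℝ f x w = ∑ l, pd l f x * w l := eq_sum_single _ w

theorem pd_antisymm (hP : IsPoisson P) (x : Fin n → ℝ) (i k l : Fin n) :
    pd i (fun y => P y k l) x = -pd i (fun y => P y l k) x := by
  have h : (fun y => P y k l) = fun y => -P y l k := funext fun y => hP.antisymm y k l
  rw [pd, h, fderiv_fun_neg]
  rfl

theorem apply_fderiv_sharpOf (hP : IsPoisson P) (x : Fin n → ℝ) (ξ η ζ : (Fin n → ℝ) →L[ℝ] ℝ) :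
    ξ (fderiv ℝ (sharpOf P) x (sharpOf P x ζ) η)
      = -∑ i, ∑ j, ∑ m, ξ (Pi.single i 1) * η (Pi.single j 1) * ζ (Pi.single m 1)
          * ∑ l, P x m l * pd l (fun y => P y i j) x := by
  rw [eq_sum_single ξ]
  simp only [fderiv_sharpOf hP, fderiv_eq_sum_pd, sharpOf_apply, Finset.mul_sum, Finset.sum_mul]
  simp only [← Finset.sum_neg_distrib]
  refine Finset.sum_congr rfl fun i _ => Finset.sum_congr rfl fun j _ => ?_
  rw [Finset.sum_comm]
  refine Finset.sum_congr rfl fun m _ => Finset.sum_congr rfl fun l _ => ?_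
  rw [hP.antisymm x l m]
  ring

/-- The Poisson structure with components `P` and its trivial foliation. -/
def foliatedPoisson (hP : IsPoisson P) (T : TrivialFoliation P k) :
    FoliatedPoisson (Fin n → ℝ) (Fin k → ℝ) (Fin (n - k) → ℝ) where
  sharp := sharpOf P
  cas x := (T.coord x).1
  leaf x := (T.coord x).2
  param := T.coord.symm
  contDiff_sharp := contDiff_sharpOf hP
  contDiff_cas := T.smooth.fst
  contDiff_leaf := T.smooth.snd
  contDiff_param := T.smooth_symm
  cas_param z := by rw [Equiv.apply_symm_apply]
  leaf_param z := by rw [Equiv.apply_symm_apply]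
  param_coord x := T.coord.symm_apply_apply x
  antisymm x ξ η := by
    rw [eq_sum_single ξ, eq_sum_single η]
    simp only [sharpOf_apply, Finset.mul_sum]
    rw [Finset.sum_comm, ← Finset.sum_neg_distrib]
    refine Finset.sum_congr rfl fun j _ => ?_
    rw [← Finset.sum_neg_distrib]
    refine Finset.sum_congr rfl fun i _ => ?_
    rw [hP.antisymm x i j]
    ring
  jacobi x ξ η ζ := by
    rw [apply_fderiv_sharpOf hP x ξ η ζ, apply_fderiv_sharpOf hP x η ζ ξ,
      apply_fderiv_sharpOf hP x ζ ξ η]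
    have rot : ∀ f : Fin n → Fin n → Fin n → ℝ,
        ∑ a, ∑ b, ∑ c, f a b c = ∑ c, ∑ a, ∑ b, f a b c := fun f =>
      (Finset.sum_congr rfl fun a _ => Finset.sum_comm).trans Finset.sum_comm
    rw [rot fun j m i => η (Pi.single j 1) * ζ (Pi.single m 1) * ξ (Pi.single i 1)
        * ∑ l, P x i l * pd l (fun y => P y j m) x,
      rot fun m i j => ζ (Pi.single m 1) * ξ (Pi.single i 1) * η (Pi.single j 1)
        * ∑ l, P x j l * pd l (fun y => P y m i) x,
      rot fun j m i => ζ (Pi.single m 1) * ξ (Pi.single i 1) * η (Pi.single j 1)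
        * ∑ l, P x j l * pd l (fun y => P y m i) x]
    simp only [← Finset.sum_neg_distrib, ← Finset.sum_add_distrib]
    refine Finset.sum_eq_zero fun i _ => Finset.sum_eq_zero fun j _ =>
      Finset.sum_eq_zero fun m _ => ?_
    have hJ := hP.jacobi x i j m
    simp only [Finset.sum_add_distrib] at hJ
    linear_combination -(ξ (Pi.single i 1) * η (Pi.single j 1) * ζ (Pi.single m 1)) * hJ
  exists_sharp_iff x v := by
    have h1 : v ∈ LinearMap.range (P x).mulVecLin ↔
        fderiv ℝ (fun y => (T.coord y).1) x v = 0 := by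
      rw [T.leaves x]; exact Iff.rfl
    refine Iff.trans ⟨?_, ?_⟩ h1
    · rintro ⟨ξ, rfl⟩
      exact ⟨unflat n ξ, (sharpOf_eq_mulVec x ξ).symm⟩
    · rintro ⟨a, rfl⟩
      exact ⟨flat n a, by rw [sharpOf_eq_mulVec, unflat_flat]⟩

end Components

/-! ### The sigma model in terms of covectors -/

section Model

variable {S : Type*} [TopologicalSpace S] [ChartedSpace Plane S]
variable {n k : ℕ} {P : (Fin n → ℝ) → Matrix (Fin n) (Fin n) ℝ} (hP : IsPoisson P)
  (T : TrivialFoliation P k)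

theorem sharp_flat (x a : Fin n → ℝ) (i : Fin n) :
    (foliatedPoisson hP T).sharp x (flat n a) i = ∑ j, P x i j * a j := by
  refine (sharpOf_apply x (flat n a) i).trans ?_
  simp only [flat_single]

/-- The term `½ (∂_i P^{kl}) A_k ∧ A_l` and the term `(∂_i P^{kl}) A_k ε_l` of the symmetries are
both given by `coupling`. -/
theorem coupling_flat (x a e : Fin n → ℝ) :
    (foliatedPoisson hP T).coupling x (flat n a) (flat n e)
      = flat n fun i => ∑ k, ∑ l, pd i (fun y => P y k l) x * a k * e l := by
  rw [← flat_unflat ((foliatedPoisson hP T).coupling x (flat n a) (flat n e))]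
  congr 1
  ext i
  refine (flat_apply a (fderiv ℝ (sharpOf P) x (Pi.single i 1) (flat n e))).trans ?_
  refine Finset.sum_congr rfl fun k _ => ?_
  rw [fderiv_sharpOf hP, Finset.mul_sum]
  refine Finset.sum_congr rfl fun l _ => ?_
  rw [flat_single, pd]
  ring

theorem eq_X_iff (φ : Config S n) (x : S) (v : Plane) :
    (∀ i, dFun φ.X x v i + ∑ j, P (φ.X x) i j * φ.A x v j = 0)
      ↔ dFun φ.X x v + (foliatedPoisson hP T).sharp (φ.X x) (dualForm φ.A x v) = 0 := by
  rw [funext_iff]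
  refine forall_congr' fun i => ?_
  rw [dualForm_apply, Pi.add_apply, sharp_flat]
  rfl

theorem eq_A_iff (φ : Config S n) (x : S) (u v : Plane) :
    (∀ i, extD φ.A x u v i + (1 / 2) * ∑ k, ∑ l, pd i (fun y => P y k l) (φ.X x)
      * (φ.A x u k * φ.A x v l - φ.A x v k * φ.A x u l) = 0)
      ↔ extD (dualForm φ.A) x u v + (foliatedPoisson hP T).coupling (φ.X x) (dualForm φ.A x u)
          (dualForm φ.A x v) = 0 := by
  have h1 : extD (dualForm φ.A) x u v = flat n (extD φ.A x u v) :=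
    extD_comp (flat n) φ.smooth_A x u v
  rw [h1, dualForm_apply, dualForm_apply, coupling_flat, ← map_add,
    map_eq_zero_iff _ (Function.LeftInverse.injective unflat_flat), funext_iff]
  refine forall_congr' fun i => ?_
  have h2 : (1 / 2) * ∑ k, ∑ l, pd i (fun y => P y k l) (φ.X x)
      * (φ.A x u k * φ.A x v l - φ.A x v k * φ.A x u l)
      = ∑ k, ∑ l, pd i (fun y => P y k l) (φ.X x) * φ.A x u k * φ.A x v l := by
    have h3 : ∑ k, ∑ l, pd i (fun y => P y k l) (φ.X x) * (φ.A x v k * φ.A x u l)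
        = -∑ k, ∑ l, pd i (fun y => P y k l) (φ.X x) * (φ.A x u k * φ.A x v l) := by
      rw [Finset.sum_comm, ← Finset.sum_neg_distrib]
      refine Finset.sum_congr rfl fun k _ => ?_
      rw [← Finset.sum_neg_distrib]
      refine Finset.sum_congr rfl fun l _ => ?_
      rw [pd_antisymm hP (φ.X x) i l k]
      ring
    simp only [mul_sub, Finset.sum_sub_distrib, h3, mul_assoc]
    ring
  rw [h2]
  rfl

theorem isSolution_iff (φ : Config S n) : IsSolution P φ ↔
    (∀ (x : S) (v : Plane),
      dFun φ.X x v + (foliatedPoisson hP T).sharp (φ.X x) (dualForm φ.A x v) = 0) ∧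
    ∀ (x : S) (u v : Plane), extD (dualForm φ.A) x u v
      + (foliatedPoisson hP T).coupling (φ.X x) (dualForm φ.A x u) (dualForm φ.A x v) = 0 :=
  ⟨fun h => ⟨fun x v => (eq_X_iff hP T φ x v).1 (h.eq_X x v),
      fun x u v => (eq_A_iff hP T φ x u v).1 (h.eq_A x u v)⟩,
    fun h => ⟨fun x v => (eq_X_iff hP T φ x v).2 (h.1 x v),
      fun x u v => (eq_A_iff hP T φ x u v).2 (h.2 x u v)⟩⟩

theorem hasDerivAt_flat_iff {a : ℝ → Fin n → ℝ} {a' : Fin n → ℝ} {t : ℝ} :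
    HasDerivAt (fun s => flat n (a s)) (flat n a') t
      ↔ ∀ i, HasDerivAt (fun s => a s i) (a' i) t := by
  rw [← hasDerivAt_pi]
  refine ⟨fun h => ?_, fun h => (flat n).hasFDerivAt.comp_hasDerivAt t h⟩
  have h1 := (unflat n).hasFDerivAt.comp_hasDerivAt t h
  rw [unflat_flat] at h1
  exact h1.congr_of_eventuallyEq (Filter.Eventually.of_forall fun s => (unflat_flat (a s)).symm)

theorem IsGaugePath.isFlow {Φ : ℝ → Config S n} {ε : ℝ → S → Fin n → ℝ}
    (h : IsGaugePath P Φ ε) : (foliatedPoisson hP T).IsFlow (fun t => (Φ t).X)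
      (fun t => dualForm (Φ t).A) (fun t x => flat n (ε t x)) where
  smooth_X := h.smooth_X
  smooth_ε := ContMDiff.comp (flat n).contDiff.contMDiff h.smooth_ε
  deriv_X t x := by
    rw [hasDerivAt_pi]
    intro i
    refine (h.deriv_X t x i).congr_deriv ?_
    rw [Pi.neg_apply, sharp_flat, ← Finset.sum_neg_distrib]
    refine Finset.sum_congr rfl fun j _ => ?_
    rw [hP.antisymm _ j i]
    ring
  deriv_A t x v := by
    have hε : SmoothFamily ε := h.smooth_ε
    rw [dFun_comp _ (hε.contMDiff t), dualForm_apply, coupling_flat, ← map_add]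
    exact hasDerivAt_flat_iff.2 (h.deriv_A t x v)

/-- A gauge flow in terms of covectors gives a path of field configurations. -/
theorem gaugeStep_of_isFlow {X : ℝ → S → Fin n → ℝ} {A : ℝ → RawForm S ((Fin n → ℝ) →L[ℝ] ℝ)}
    {ε : ℝ → S → (Fin n → ℝ) →L[ℝ] ℝ} (h : (foliatedPoisson hP T).IsFlow X A ε)
    (hA : ∀ x₀ : S, ContDiffOn ℝ ∞ (fun p : ℝ × Plane => formInChart (A p.1) x₀ p.2)
      (Set.univ ×ˢ (extChartAt (𝓡 2) x₀).target))
    {φ ψ : Config S n} (hφX : φ.X = X 0) (hφA : dualForm φ.A = A 0) (hψX : ψ.X = X 1)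
    (hψA : dualForm ψ.A = A 1) : GaugeStep P φ ψ := by
  have hA' : ∀ t, IsSmoothForm (A t) := fun t x₀ =>
    (hA x₀).comp (g := fun p : ℝ × Plane => formInChart (A p.1) x₀ p.2) (f := fun y => (t, y))
      (contDiff_const.prodMk contDiff_id).contDiffOn fun y hy => ⟨trivial, hy⟩
  let Φ : ℝ → Config S n := fun t =>
    ⟨X t, fun x => (unflat n).comp (A t x), h.smooth_X.contMDiff t,
      isSmoothForm_comp (unflat n) (hA' t)⟩
  have hΦ : ∀ t, dualForm (Φ t).A = A t := fun t => dualForm_unflat (A t)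
  have hΦ' : ∀ t x (v : Plane), flat n ((Φ t).A x v) = A t x v := fun t x v => flat_unflat _
  have hε : ∀ t x, flat n (unflat n (ε t x)) = ε t x := fun t x => flat_unflat _
  have hε' : SmoothFamily fun t x => unflat n (ε t x) :=
    ContMDiff.comp (unflat n).contDiff.contMDiff h.smooth_ε
  refine ⟨Φ, fun t x => unflat n (ε t x), ⟨h.smooth_X, fun x₀ => ?_, hε', fun t x i => ?_,
    fun t x v => ?_⟩, ?_, ?_⟩
  · exact (contDiffOn_const (c := unflat n)).clm_comp (hA x₀)
  · refine (hasDerivAt_pi.1 (h.deriv_X t x) i).congr_deriv ?_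
    rw [Pi.neg_apply, ← hε t x, sharp_flat, ← Finset.sum_neg_distrib, hε]
    refine Finset.sum_congr rfl fun j _ => ?_
    rw [hP.antisymm _ j i]
    have h1 : ∀ a b : ℝ, -(a * b) = b * -a := fun a b => by ring
    exact h1 _ _
  · refine (hasDerivAt_flat_iff (a := fun s => (Φ s).A x v) (t := t)).1 ?_
    have h1 := h.deriv_A t x v
    rw [← hΦ' t x v, ← hε t x, coupling_flat] at h1
    have h2 : dFun (ε t) x v = flat n (dFun (fun x => unflat n (ε t x)) x v) := by
      refine Eq.trans ?_ (dFun_comp (flat n) (hε'.contMDiff t) x v)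
      simp only [hε]
    rw [h2, ← map_add] at h1
    exact h1.congr_of_eventuallyEq (Filter.Eventually.of_forall fun s => hΦ' s x v)
  · exact Config.ext hφX.symm (dualForm_injective (by rw [hΦ, hφA]))
  · exact Config.ext hψX.symm (dualForm_injective (by rw [hΦ, hψA]))

/-! ### Invariants of gauge equivalence -/

/-- The first field equation, the values of the Casimir functions and the cohomology classes of the
forms `charge` are preserved. -/
def SameInvariants (φ ψ : Config S n) : Prop :=
  ((∀ (x : S) (v : Plane),
      dFun φ.X x v + (foliatedPoisson hP T).sharp (φ.X x) (dualForm φ.A x v) = 0) ↔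
    ∀ (x : S) (v : Plane),
      dFun ψ.X x v + (foliatedPoisson hP T).sharp (ψ.X x) (dualForm ψ.A x v) = 0) ∧
  ((∀ (x : S) (v : Plane),
      dFun φ.X x v + (foliatedPoisson hP T).sharp (φ.X x) (dualForm φ.A x v) = 0) →
    (∀ x, (T.coord (φ.X x)).1 = (T.coord (ψ.X x)).1) ∧
    ∀ c, ∃ f : S → ℝ, ∀ x, HasMFDerivAt (𝓡 2) 𝓘(ℝ, ℝ) f x
      ((foliatedPoisson hP T).charge ψ.X (dualForm ψ.A) c x
        - (foliatedPoisson hP T).charge φ.X (dualForm φ.A) c x))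

theorem sameInvariants_of_gaugeStep [IsManifold (𝓡 2) ∞ S] {φ ψ : Config S n} (h : GaugeStep P φ ψ) :
    SameInvariants hP T φ ψ := by
  obtain ⟨Φ, ε, hΦ, rfl, rfl⟩ := h
  have hf := hΦ.isFlow hP T
  refine ⟨⟨fun h x v => hf.defect_eq_zero x v (h x v) 1,
    fun h x v => hf.defect_eq_zero x v (h x v) 0⟩, fun h => ⟨fun x => ?_, fun c => ?_⟩⟩
  · exact hf.toIsVariation.cas_eq 0 1 x
  · exact hf.exists_hasMFDerivAt h c

theorem sameInvariants_of_eqvGen [IsManifold (𝓡 2) ∞ S] {φ ψ : Config S n}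
    (h : Relation.EqvGen (GaugeStep P) φ ψ) : SameInvariants hP T φ ψ := by
  induction h with
  | rel φ ψ h => exact sameInvariants_of_gaugeStep hP T h
  | refl φ =>
    refine ⟨Iff.rfl, fun _ => ⟨fun _ => rfl, fun c => ⟨fun _ => 0, fun x => ?_⟩⟩⟩
    rw [sub_self]
    exact hasMFDerivAt_const _ _
  | symm φ ψ _ ih =>
    refine ⟨ih.1.symm, fun h => ⟨fun x => ((ih.2 (ih.1.2 h)).1 x).symm, fun c => ?_⟩⟩
    obtain ⟨f, hf⟩ := (ih.2 (ih.1.2 h)).2 c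
    refine ⟨-f, fun x => ?_⟩
    rw [← neg_sub]
    exact (hf x).neg
  | trans φ χ ψ _ _ ih ih' =>
    refine ⟨ih.1.trans ih'.1, fun h =>
      ⟨fun x => ((ih.2 h).1 x).trans ((ih'.2 (ih.1.1 h)).1 x), fun c => ?_⟩⟩
    obtain ⟨f, hf⟩ := (ih.2 h).2 c
    obtain ⟨g, hg⟩ := (ih'.2 (ih.1.1 h)).2 c
    refine ⟨g + f, fun x => ?_⟩
    rw [← sub_add_sub_cancel]
    exact (hg x).add (hf x)

/-! ### Representatives -/

theorem casCovector_param (C b : Fin k → ℝ) (w : (Fin k → ℝ) × (Fin (n - k) → ℝ)) :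
    (foliatedPoisson hP T).casCovector (T.coord.symm (C, 0)) (flat k b)
      (fderiv ℝ T.coord.symm (C, 0) w) = flat k b w.1 :=
  congrArg (flat k b) ((foliatedPoisson hP T).fderiv_cas_param (C, 0) w)

theorem adaptedComponent_eq (φ : Config S n) (w : (Fin k → ℝ) × (Fin (n - k) → ℝ)) (x : S)
    (v : Plane) : adaptedComponent T φ w x v
      = dualForm φ.A x v (fderiv ℝ T.coord.symm (T.coord (φ.X x)) w) :=
  (flat_apply _ _).symm

theorem isRepresentative_iff (C : Fin k → ℝ) (α : Fin k → closedForms S) (φ : Config S n) :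
    IsRepresentative T C α φ ↔ (∀ x, φ.X x = T.coord.symm (C, 0)) ∧
      ∀ x (v : Plane), dualForm φ.A x v
        = (foliatedPoisson hP T).casCovector (T.coord.symm (C, 0)) (collect α x v) := by
  constructor
  · intro h
    have hX : ∀ x, T.coord (φ.X x) = (C, 0) := fun x => Prod.ext (h.casimir_X x) (h.leaf_X x)
    refine ⟨fun x => by rw [← hX x, Equiv.symm_apply_apply], fun x v => ?_⟩
    set z : (Fin k → ℝ) × (Fin (n - k) → ℝ) := (C, 0) with hz
    set D := fderiv ℝ T.coord.symm z with hD
    have h1 : ∀ I, dualForm φ.A x v (D (Pi.single I 1, 0)) = (α I : RawForm S ℝ) x v := fun I => by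
      rw [← h.casimir_A I x v, adaptedComponent_eq, hX]
    have h2 : ∀ a, dualForm φ.A x v (D (0, Pi.single a 1)) = 0 := fun a => by
      rw [← h.leaf_A a x v, adaptedComponent_eq, hX]
    ext u
    have h0 := (foliatedPoisson hP T).fderiv_param_coord ((foliatedPoisson hP T).param z) u
    rw [(foliatedPoisson hP T).coord_param z] at h0
    obtain ⟨w, rfl⟩ : ∃ w, D w = u := ⟨_, h0⟩
    rw [collect_apply, casCovector_param]
    have e : w = ContinuousLinearMap.inl ℝ (Fin k → ℝ) (Fin (n - k) → ℝ) w.1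
        + ContinuousLinearMap.inr ℝ (Fin k → ℝ) (Fin (n - k) → ℝ) w.2 := by simp
    have h3 := eq_sum_single ((dualForm φ.A x v).comp (D.comp (ContinuousLinearMap.inl ℝ _ _))) w.1
    have h4 := eq_sum_single ((dualForm φ.A x v).comp (D.comp (ContinuousLinearMap.inr ℝ _ _))) w.2
    simp only [ContinuousLinearMap.comp_apply, ContinuousLinearMap.inl_apply,
      ContinuousLinearMap.inr_apply, h1, h2, zero_mul, Finset.sum_const_zero] at h3 h4
    conv_lhs => rw [e]
    rw [map_add, map_add, ContinuousLinearMap.inl_apply, ContinuousLinearMap.inr_apply, h3, h4,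
      add_zero, flat_apply]
  · rintro ⟨hX, hA⟩
    have hX' : ∀ x, T.coord (φ.X x) = (C, 0) := fun x => by rw [hX, Equiv.apply_symm_apply]
    refine ⟨fun x => by rw [hX'], fun x => by rw [hX'], fun a x (v : Plane) => ?_,
      fun I x (v : Plane) => ?_⟩
    · refine (adaptedComponent_eq T φ _ x v).trans ?_
      rw [hX', hA, collect_apply, casCovector_param, map_zero]
    · refine (adaptedComponent_eq T φ _ x v).trans ?_
      rw [hX', hA, collect_apply, casCovector_param, flat_single]

/-- The field configuration with `X^I = C^I`, `X^α = 0 = A_α` and `A_I = α_I`. -/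
def representative (C : Fin k → ℝ) (α : Fin k → closedForms S) : Config S n where
  X _ := T.coord.symm (C, 0)
  A x := (unflat n).comp (((foliatedPoisson hP T).casCovector (T.coord.symm (C, 0))).comp
    (collect α x))
  smooth_X := contMDiff_const
  smooth_A := isSmoothForm_comp (unflat n) (isSmoothForm_comp _ (isSmoothForm_collect α))

theorem isRepresentative_representative (C : Fin k → ℝ) (α : Fin k → closedForms S) :
    IsRepresentative T C α (representative hP T C α) :=
  (isRepresentative_iff hP T C α _).2 ⟨fun _ => rfl, fun x v => flat_unflat
    ((foliatedPoisson hP T).casCovector (T.coord.symm (C, 0)) (collect α x v))⟩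

theorem IsRepresentative.eq {C : Fin k → ℝ} {α : Fin k → closedForms S} {φ ψ : Config S n}
    (hφ : IsRepresentative T C α φ) (hψ : IsRepresentative T C α ψ) (hP : IsPoisson P) :
    φ = ψ := by
  rw [isRepresentative_iff hP] at hφ hψ
  refine Config.ext (funext fun x => (hφ.1 x).trans (hψ.1 x).symm) (dualForm_injective ?_)
  funext x
  refine ContinuousLinearMap.ext fun (v : Plane) => ?_
  exact (hφ.2 x v).trans (hψ.2 x v).symm

variable {T}

theorem IsRepresentative.X_eq {C : Fin k → ℝ} {α : Fin k → closedForms S} {φ : Config S n}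
    (h : IsRepresentative T C α φ) : φ.X = fun _ => T.coord.symm (C, 0) := by
  funext x
  rw [Equiv.eq_symm_apply]
  exact Prod.ext (h.casimir_X x) (h.leaf_X x)

theorem IsRepresentative.dualForm_eq {C : Fin k → ℝ} {α : Fin k → closedForms S} {φ : Config S n}
    (h : IsRepresentative T C α φ) : dualForm φ.A = fun x =>
      ((foliatedPoisson hP T).casCovector (T.coord.symm (C, 0))).comp (collect α x) := by
  funext x
  refine ContinuousLinearMap.ext fun (v : Plane) => ?_
  exact ((isRepresentative_iff hP T C α φ).1 h).2 x v

theorem IsRepresentative.isSolution {C : Fin k → ℝ} {α : Fin k → closedForms S} {φ : Config S n}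
    (h : IsRepresentative T C α φ) (hP : IsPoisson P) : IsSolution P φ := by
  rw [isSolution_iff hP T, h.X_eq, h.dualForm_eq hP]
  refine ⟨fun x v => ?_, fun x u v => ?_⟩
  · rw [dFun_const]
    exact (zero_add _).trans ((foliatedPoisson hP T).sharp_casCovector _ _)
  · rw [extD_comp _ (isSmoothForm_collect α), extD_collect, map_zero, zero_add]
    exact (foliatedPoisson hP T).coupling_casCovector
      ((foliatedPoisson hP T).sharp_casCovector _ _) _

theorem IsRepresentative.charge_eq {C : Fin k → ℝ} {α : Fin k → closedForms S} {φ : Config S n}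
    (h : IsRepresentative T C α φ) (I : Fin k) :
    (foliatedPoisson hP T).charge φ.X (dualForm φ.A) (Pi.single I 1) = α I := by
  funext x
  refine ContinuousLinearMap.ext fun (v : Plane) => ?_
  refine (FoliatedPoisson.charge_apply _ _ _ _ x v).trans ?_
  rw [h.X_eq, h.dualForm_eq hP, dFun_const]
  set G := foliatedPoisson hP T
  refine Eq.trans (b := G.casCovector (T.coord.symm (C, 0)) (collect α x v)
    (G.casDir (T.coord.symm (C, 0)) (Pi.single I 1))
    + G.twist (T.coord.symm (C, 0)) 0 (Pi.single I 1)) rfl ?_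
  rw [map_zero, zero_apply, add_zero, G.casCovector_casDir, collect_apply, flat_single]

theorem cohomologyClass_eq_iff {α β : closedForms S} : cohomologyClass α = cohomologyClass β ↔
    ∃ f : S → ℝ, ContMDiff (𝓡 2) 𝓘(ℝ, ℝ) ∞ f ∧ ∀ x, HasMFDerivAt (𝓡 2) 𝓘(ℝ, ℝ) f x
      ((α : RawForm S ℝ) x - (β : RawForm S ℝ) x) := by
  rw [cohomologyClass, cohomologyClass, Submodule.Quotient.eq]
  constructor
  · rintro ⟨f, hf, e⟩
    refine ⟨f, hf, fun x => ?_⟩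
    have h1 : (α : RawForm S ℝ) x - (β : RawForm S ℝ) x = dFun f x :=
      congrArg (fun η : RawForm S ℝ => η x) e
    rw [h1]
    exact (hf.mdifferentiableAt (by simp)).hasMFDerivAt
  · rintro ⟨f, hf, e⟩
    exact ⟨f, hf, funext fun x => (e x).mfderiv.symm⟩

/-- Representatives that are gauge equivalent have the same data. -/
theorem IsRepresentative.data_eq [IsManifold (𝓡 2) ∞ S] [Nonempty S] {C C' : Fin k → ℝ} {α α' : Fin k → closedForms S}
    {φ φ' : Config S n} (h : IsRepresentative T C α φ) (h' : IsRepresentative T C' α' φ')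
    (hP : IsPoisson P) (hg : Relation.EqvGen (GaugeStep P) φ φ') :
    C = C' ∧ ∀ I, cohomologyClass (α I) = cohomologyClass (α' I) := by
  have hi := (sameInvariants_of_eqvGen hP T hg).2
    ((isSolution_iff hP T φ).1 (h.isSolution hP)).1
  refine ⟨?_, fun I => ?_⟩
  · obtain ⟨x⟩ := ‹Nonempty S›
    rw [← h.casimir_X x, ← h'.casimir_X x]
    exact hi.1 x
  · obtain ⟨f, hf⟩ := hi.2 (Pi.single I 1)
    rw [h.charge_eq hP, h'.charge_eq hP] at hf
    refine (cohomologyClass_eq_iff.2 ⟨f, ?_, hf⟩).symm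
    exact contMDiff_of_hasMFDerivAt (η := fun x => (α' I : RawForm S ℝ) x - (α I : RawForm S ℝ) x)
      (α' I - α I).2.1 hf

/-- Representatives with the same constants and the same cohomology classes are related by a gauge
transformation. -/
theorem IsRepresentative.gaugeStep [IsManifold (𝓡 2) ∞ S] {C : Fin k → ℝ} {α α' : Fin k → closedForms S}
    {φ φ' : Config S n} (h : IsRepresentative T C α φ) (h' : IsRepresentative T C α' φ')
    (hP : IsPoisson P) (hα : ∀ I, cohomologyClass (α I) = cohomologyClass (α' I)) : GaugeStep P φ φ' := by
  choose f hf hd using fun I => cohomologyClass_eq_iff.1 (hα I).symm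
  set G := foliatedPoisson hP T with hG
  set x₀ := T.coord.symm (C, 0)
  have hf' : ContMDiff (𝓡 2) 𝓘(ℝ, Fin k → ℝ) ∞ fun x I => f I x := contMDiff_pi_space.2 hf
  have hF : ContMDiff (𝓡 2) 𝓘(ℝ, (Fin k → ℝ) →L[ℝ] ℝ) ∞ fun x => flat k fun I => f I x :=
    ContMDiff.comp (flat k).contDiff.contMDiff hf'
  have hdF : ∀ x (v : Plane), dFun (fun x => flat k fun I => f I x) x v
      = collect α' x v - collect α x v := fun x v => by
    rw [dFun_comp _ hf', collect_apply, collect_apply, ← map_sub]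
    congr 1
    funext I
    have h1 := dFun_comp (ContinuousLinearMap.proj (R := ℝ) (φ := fun _ : Fin k => ℝ) I) hf' x v
    refine h1.symm.trans ?_
    exact congrArg (fun L : Plane →L[ℝ] ℝ => L v) (hd I x).mfderiv
  have hA := h.dualForm_eq hP
  have hflow := FoliatedPoisson.isFlow_exact G x₀ (A := dualForm φ.A)
    (fun x v => by rw [hA]; exact G.sharp_casCovector _ _) hF
  refine gaugeStep_of_isFlow hP T hflow (fun p => ?_) h.X_eq ?_ h'.X_eq ?_
  · have h1 := isSmoothForm_comp (flat n) φ.smooth_A p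
    have h2 := isSmoothForm_comp (G.casCovector x₀) (isSmoothForm_dFun hF) p
    have hs : Set.MapsTo Prod.snd ((Set.univ : Set ℝ) ×ˢ (extChartAt (𝓡 2) p).target)
      (extChartAt (𝓡 2) p).target := fun q hq => hq.2
    exact (h1.comp contDiffOn_snd hs).add (contDiffOn_fst.smul (h2.comp contDiffOn_snd hs))
  · funext x
    refine ContinuousLinearMap.ext fun (v : Plane) => ?_
    refine Eq.symm (Eq.trans (b := dualForm φ.A x v
      + (0 : ℝ) • G.casCovector x₀ (dFun (fun x => flat k fun I => f I x) x v)) rfl ?_)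
    rw [zero_smul, add_zero]
  · rw [h'.dualForm_eq hP, hA]
    funext x
    refine ContinuousLinearMap.ext fun (v : Plane) => ?_
    refine Eq.trans (b := G.casCovector x₀ (collect α x v)
      + (1 : ℝ) • G.casCovector x₀ (dFun (fun x => flat k fun I => f I x) x v)) ?_ rfl
    rw [hdF, one_smul, ← map_add, add_sub_cancel]
    rfl

/-- The Casimir functions are constant on solutions. -/
theorem cas_eq_of_isSolution [IsManifold (𝓡 2) ∞ S] [PreconnectedSpace S] {φ : Config S n}
    (eX : ∀ (x : S) (v : Plane),
      dFun φ.X x v + (foliatedPoisson hP T).sharp (φ.X x) (dualForm φ.A x v) = 0) (x y : S) :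
    (T.coord (φ.X x)).1 = (T.coord (φ.X y)).1 := by
  set G := foliatedPoisson hP T
  have h1 : ∀ x, HasMFDerivAt (𝓡 2) 𝓘(ℝ, Fin k → ℝ) (G.cas ∘ φ.X) x
      (0 : Plane →L[ℝ] (Fin k → ℝ)) := fun x => by
    have h2 : HasMFDerivAt (𝓡 2) 𝓘(ℝ, Fin k → ℝ) (G.cas ∘ φ.X) x
        ((fderiv ℝ G.cas (φ.X x)).comp (dFun φ.X x : Plane →L[ℝ] (Fin n → ℝ))) :=
      HasMFDerivAt.comp x (G.hasFDerivAt_cas (φ.X x)).hasMFDerivAt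
        (φ.smooth_X.mdifferentiableAt (x := x) (by simp)).hasMFDerivAt
    have h4 : (fderiv ℝ G.cas (φ.X x)).comp (dFun φ.X x : Plane →L[ℝ] (Fin n → ℝ)) = 0 := by
      refine ContinuousLinearMap.ext fun v => ?_
      refine (congrArg (fderiv ℝ G.cas (φ.X x)) (eq_neg_of_add_eq_zero_left (eX x v))).trans ?_
      rw [map_neg, G.fderiv_cas_sharp, neg_zero]
      rfl
    rw [h4] at h2
    exact h2
  have h3 : IsLocallyConstant (G.cas ∘ φ.X) := (IsLocallyConstant.iff_eventually_eq _).2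
    fun x => eventually_eq_of_hasMFDerivAt_zero (Filter.Eventually.of_forall h1)
  exact h3.apply_eq_of_preconnectedSpace x y

/-- Every solution is gauge equivalent to a representative. -/
theorem exists_representative [IsManifold (𝓡 2) ∞ S] [ConnectedSpace S] {φ : Config S n}
    (h : IsSolution P φ) : ∃ (C : Fin k → ℝ) (α : Fin k → closedForms S),
      GaugeStep P φ (representative hP T C α) := by
  obtain ⟨eX, eA⟩ := (isSolution_iff hP T φ).1 h
  have hcas := cas_eq_of_isSolution hP eX
  set G := foliatedPoisson hP T with hG
  have hAs : IsSmoothForm (dualForm φ.A) := isSmoothForm_comp (flat n) φ.smooth_A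
  obtain ⟨p⟩ := (inferInstance : Nonempty S)
  have hcl := G.charge_mem_closedForms φ.smooth_X hAs eX
    fun x u v w => congrArg (fun ξ : (Fin n → ℝ) →L[ℝ] ℝ => ξ w) (eA x u v)
  set C := (T.coord (φ.X p)).1 with hC
  set α : Fin k → closedForms S := fun I => ⟨_, hcl (Pi.single I 1)⟩ with hα
  refine ⟨C, α, ?_⟩
  have hX1 : ∀ x, G.param (G.cas (φ.X x), 0) = T.coord.symm (C, 0) := fun x => by
    rw [hC, ← hcas x p]
    rfl
  refine gaugeStep_of_isFlow hP T (G.isFlow_contract φ.smooth_X eX) (fun q => ?_) ?_ ?_ ?_ ?_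
  · exact G.contDiffOn_transport φ.smooth_X hAs q
  · funext x
    exact (G.contract_zero (φ.X x)).symm
  · funext x
    refine ContinuousLinearMap.ext fun (v : Plane) => ?_
    exact (G.transport_zero (φ.X x) (dualForm φ.A x v)).symm
  · funext x
    exact ((G.contract_one (φ.X x)).trans (hX1 x)).symm
  · rw [(isRepresentative_representative hP T C α).dualForm_eq hP]
    funext x
    refine ContinuousLinearMap.ext fun (v : Plane) => ?_
    have h1 := G.transport_one (φ.X x) (dualForm φ.A x v)
    rw [hX1] at h1
    refine Eq.trans ?_ h1.symm
    refine congrArg (G.casCovector (T.coord.symm (C, 0))) ?_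
    refine (collect_apply α x v).trans ?_
    rw [← flat_unflat ((dualForm φ.A x v).comp _ - _)]
    congr 1
    funext I
    refine (G.charge_apply φ.X (dualForm φ.A) (Pi.single I 1) x v).trans ?_
    rw [eq_neg_of_add_eq_zero_left (eX x v), map_neg, unflat_apply]
    exact (sub_eq_add_neg _ _).symm

end Model

/-! ### The moduli space -/

theorem finrank_pi_prod_pi (k : ℕ) (W : Type*) [AddCommGroup W] [Module ℝ W] [Module.Finite ℝ W] :
    Module.finrank ℝ ((Fin k → ℝ) × (Fin k → W))
      = Module.finrank ℝ (Fin (k * (Module.finrank ℝ W + 1)) → ℝ) := by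
  simp only [Module.finrank_prod, Module.finrank_pi, Module.finrank_pi_fintype,
    Finset.sum_const, Finset.card_univ, Fintype.card_fin, smul_eq_mul]
  ring

section Moduli

variable {S : Type*} [TopologicalSpace S] [ChartedSpace Plane S] [IsManifold (𝓡 2) ∞ S]
  [ConnectedSpace S] {n k : ℕ} {P : (Fin n → ℝ) → Matrix (Fin n) (Fin n) ℝ}

theorem IsRepresentative.gaugeEquiv_iff (hP : IsPoisson P) {T : TrivialFoliation P k}
    {C C' : Fin k → ℝ} {α α' : Fin k → closedForms S} {φ φ' : Solution S P}
    (h : IsRepresentative T C α φ.1) (h' : IsRepresentative T C' α' φ'.1) :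
    GaugeEquiv φ φ' ↔ C = C' ∧ ∀ I, cohomologyClass (α I) = cohomologyClass (α' I) := by
  refine ⟨fun hg => h.data_eq h' hP hg, ?_⟩
  rintro ⟨rfl, hα⟩
  exact Relation.EqvGen.rel _ _ (h.gaugeStep h' hP hα)

theorem exists_gaugeEquiv_representative (hP : IsPoisson P) (T : TrivialFoliation P k)
    (ψ : Solution S P) : ∃ (C : Fin k → ℝ) (α : Fin k → closedForms S) (φ : Solution S P),
      IsRepresentative T C α φ.1 ∧ GaugeEquiv ψ φ := by
  obtain ⟨C, α, h⟩ := exists_representative hP (T := T) ψ.2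
  have hr := isRepresentative_representative hP T C α
  exact ⟨C, α, ⟨_, hr.isSolution hP⟩, hr, Relation.EqvGen.rel _ _ h⟩

/-- The moduli space is `ℝᵏ × H¹(S)ᵏ`. -/
theorem exists_moduliSpace_equiv (hP : IsPoisson P) (T : TrivialFoliation P k) :
    ∃ Ψ : ModuliSpace S P ≃ (Fin k → ℝ) × (Fin k → H1 S),
      ∀ (C : Fin k → ℝ) (α : Fin k → closedForms S) (φ : Solution S P),
        IsRepresentative T C α φ.1 → Ψ (gaugeClass φ) = (C, fun I => cohomologyClass (α I)) := by
  choose lift hlift using fun h : H1 S => Submodule.Quotient.mk_surjective (exactForms S) h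
  let sol : (Fin k → ℝ) × (Fin k → H1 S) → Solution S P := fun d =>
    ⟨_, (isRepresentative_representative hP T d.1 fun I => lift (d.2 I)).isSolution hP⟩
  have hsol : ∀ d, IsRepresentative T d.1 (fun I => lift (d.2 I)) (sol d).1 := fun d =>
    isRepresentative_representative hP T d.1 _
  have hclass : ∀ h, cohomologyClass (lift h) = h := hlift
  have hsound : ∀ (C : Fin k → ℝ) (α : Fin k → closedForms S) (φ : Solution S P),
      IsRepresentative T C α φ.1 →
        gaugeClass (sol (C, fun I => cohomologyClass (α I))) = gaugeClass φ := fun C α φ h =>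
    Quotient.sound (((hsol _).gaugeEquiv_iff hP h).2 ⟨rfl, fun I => hclass _⟩)
  have hbij : Function.Bijective fun d => gaugeClass (sol d) := by
    constructor
    · intro d d' h
      obtain ⟨h1, h2⟩ := ((hsol d).gaugeEquiv_iff hP (hsol d')).1 (Quotient.exact h)
      refine Prod.ext h1 (funext fun I => ?_)
      rw [← hclass (d.2 I), ← hclass (d'.2 I)]
      exact h2 I
    · intro m
      obtain ⟨ψ, rfl⟩ := Quotient.exists_rep m
      obtain ⟨C, α, φ, hr, hg⟩ := exists_gaugeEquiv_representative hP T ψ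
      exact ⟨_, (hsound C α φ hr).trans (Quotient.sound hg).symm⟩
  refine ⟨(Equiv.ofBijective _ hbij).symm, fun C α φ h => ?_⟩
  rw [Equiv.symm_apply_eq]
  exact (hsound C α φ h).symm

end Moduli

end PSM

end

theorem proposition1 {S : Type*} [TopologicalSpace S] [T2Space S] [SecondCountableTopology S]
    [ConnectedSpace S] [ChartedSpace PSM.Plane S] [IsManifold (𝓡 2) ∞ S]
    {n k : ℕ} (P : (Fin n → ℝ) → Matrix (Fin n) (Fin n) ℝ) (hP : PSM.IsPoisson P)
    (T : PSM.TrivialFoliation P k) :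
    -- every choice of data gives exactly one representative, and it solves the field equations
    (∀ (C : Fin k → ℝ) (α : Fin k → PSM.closedForms S),
      ∃! φ : PSM.Config S n, PSM.IsRepresentative T C α φ) ∧
    (∀ (C : Fin k → ℝ) (α : Fin k → PSM.closedForms S) (φ : PSM.Config S n),
      PSM.IsRepresentative T C α φ → PSM.IsSolution P φ) ∧
    -- every solution is gauge equivalent to a representative
    (∀ ψ : PSM.Solution S P, ∃ (C : Fin k → ℝ) (α : Fin k → PSM.closedForms S)
      (φ : PSM.Solution S P), PSM.IsRepresentative T C α φ.1 ∧ PSM.GaugeEquiv ψ φ) ∧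
    -- representatives are equivalent exactly if they have the same constants and cohomology classes
    (∀ (C C' : Fin k → ℝ) (α α' : Fin k → PSM.closedForms S) (φ φ' : PSM.Solution S P),
      PSM.IsRepresentative T C α φ.1 → PSM.IsRepresentative T C' α' φ'.1 →
      (PSM.GaugeEquiv φ φ' ↔
        C = C' ∧ ∀ I, PSM.cohomologyClass (α I) = PSM.cohomologyClass (α' I))) ∧
    -- the moduli space, for a worldsheet whose first cohomology has finite rank
    (Module.Finite ℝ (PSM.H1 S) →
      (∃ (L : ((Fin k → ℝ) × (Fin k → PSM.H1 S)) ≃ₗ[ℝ]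
              (Fin (k * (Module.finrank ℝ (PSM.H1 S) + 1)) → ℝ))
          (Ψ : PSM.ModuliSpace S P ≃ (Fin (k * (Module.finrank ℝ (PSM.H1 S) + 1)) → ℝ)),
          ∀ (C : Fin k → ℝ) (α : Fin k → PSM.closedForms S) (φ : PSM.Solution S P),
            PSM.IsRepresentative T C α φ.1 →
            Ψ (PSM.gaugeClass φ) = L (C, fun I => PSM.cohomologyClass (α I))) ∧
      ∀ x₀ : S, Module.rank ℤ (Additive (Abelianization (FundamentalGroup S x₀)))
        = (Module.finrank ℝ (PSM.H1 S) : Cardinal)) := by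
  refine ⟨fun C α => ?_, fun C α φ h => h.isSolution hP,
    PSM.exists_gaugeEquiv_representative hP T,
    fun C C' α α' φ φ' h h' => h.gaugeEquiv_iff hP h', fun _ => ⟨?_, PSM.rank_fundamentalGroup⟩⟩
  · exact ⟨_, PSM.isRepresentative_representative hP T C α, fun ψ h =>
      h.eq T (PSM.isRepresentative_representative hP T C α) hP⟩
  · obtain ⟨Ψ, hΨ⟩ := PSM.exists_moduliSpace_equiv (S := S) hP T
    let L : ((Fin k → ℝ) × (Fin k → PSM.H1 S)) ≃ₗ[ℝ]
        (Fin (k * (Module.finrank ℝ (PSM.H1 S) + 1)) → ℝ) :=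
      LinearEquiv.ofFinrankEq _ _ (PSM.finrank_pi_prod_pi k _)
    exact ⟨L, Ψ.trans L.toEquiv, fun C α φ h => congrArg L (hΨ C α φ h)⟩
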